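/- Let $K$ be an imaginary quadratic field with discriminant $D$, and let $D_K=|D|$. Let $v_K(m)$ be the number of integral ideals of $K$ of norm $m$, and put $\sigma_{K,a}(n)=\sum_{d\mid n}v_K(d)\,d^a$ for $a\in\mathbb C$. Let $\zeta_K$ be the Dedekind zeta function of $K$, which continues holomorphically from $\mathrm{Re}(s)>1$ to $\mathbb C\setminus\{1\}$, and let $L(s,\chi_D)$ be the $L$-function of the Kronecker symbol $\chi_D=\left(\frac{D}{\cdot}\right)$, which continues from $\mathrm{Re}(s)>1$ to an entire function. Let ${}_pF_q$ denote the generalized hypergeometric function, and let $\mathrm{ber},\mathrm{bei}$ be the Kelvin functions of order $0$, that is, the entire functions with $\mathrm{ber}(x)+i\,\mathrm{bei}(x)=J_0(xe^{3\pi i/4})$, both real for real $x$. All complex powers and square roots take their principal values. Let $\mathrm{Re}(y)>0$ and $\mathrm{Re}(a)>-1$. The series $\sum_{n\ge1}\sigma_{K,a}(n)e^{-ny}$ converges absolutely, and if $a\notin\{0,1,2,\dots\}$, then \begin{align*} &\sum_{n=1}^\infty \sigma_{K,a}(n)e^{-ny}+\frac12\zeta_K(-a)-\frac{\zeta_K(1-a)}{y}-\frac{L(1,\chi_D)\Gamma(a+1)\zeta(a+1)}{y^{a+1}}\\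 &=\frac{4\pi^{2-2a}D_K^{a-\frac12}}{y\sin(\pi a)}\sum_{n=1}^\infty \sigma_{K,-a}(n)\Bigg\{\frac{2^{-2a}}{\Gamma(1-a)^2}\,{}_1F_4\!\left(1;\,1-\tfrac a2,1-\tfrac a2,\tfrac{1-a}2,\tfrac{1-a}2;\,-\frac{4\pi^6n^2}{y^2D_K^2}\right)\\ &\qquad-\left(\frac{4\pi^6n^2}{y^2D_K^2}\right)^{\frac a2}\left(\cos\left(\frac{\pi a}2\right)\mathrm{ber}\left(4\pi\sqrt{\frac{2n\pi}{yD_K}}\right)-\sin\left(\frac{\pi a}2\right)\mathrm{bei}\left(4\pi\sqrt{\frac{2n\pi}{yD_K}}\right)\right)\Bigg\}, \end{align*} where the series on the right converges absolutely. For $a=N\in\{0,1,2,\dots\}$ the identity holds in the limit: each term of the right-hand series, multiplied by the factor in front of the sum, has a finite limit $T_n$ as $a\to N$, the series $\sum_n T_n$ converges absolutely, and the left-hand side tends to $\sum_n T_n$ as $a\to N$; for $N\ge1$ the left-hand side at $a=N$ itself equals $\sum_n T_n$. -/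

import Mathlib

open Filter Topology

noncomputable section

namespace QuadLambert

/-- `F` continues `f`, given on the half-plane `Re s > 1`, holomorphically to `ℂ \ S`.
For finite `S` the values of `F` off `S` are determined by `f`. -/
def IsContinuation (S : Set ℂ) (f F : ℂ → ℂ) : Prop :=
  DifferentiableOn ℂ F Sᶜ ∧ ∀ s : ℂ, 1 < s.re → F s = f s

open Classical in
/-- The holomorphic continuation of `f` from `Re s > 1` to `ℂ \ S` (`0` if there is none). -/
def continuation (S : Set ℂ) (f : ℂ → ℂ) : ℂ → ℂ :=
  if h : ∃ F, IsContinuation S f F then h.choose else 0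

/-- The Kronecker symbol `(D / n)` for `n ≥ 1`; it is completely multiplicative in `n`, is the
Jacobi symbol for odd `n`, and `(D / 2)` is `0`, `1`, `-1` according as `D` is even,
`D ≡ ±1 mod 8`, `D ≡ ±3 mod 8`. -/
def kroneckerSym (D : ℤ) (n : ℕ) : ℤ :=
  ZMod.χ₈ (D : ZMod 8) ^ padicValNat 2 n * jacobiSym D (n / 2 ^ padicValNat 2 n)

/-- `L(s, χ_D)`: the entire continuation of `∑ χ_D(n) n^{-s}`, with `χ_D = (D / ·)`. -/
def quadraticL (D : ℤ) : ℂ → ℂ :=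
  continuation ∅ (LSeries fun n ↦ (kroneckerSym D n : ℂ))

/-- The Bessel function of the first kind `J_ν(z)`. -/
def besselJ (ν z : ℂ) : ℂ :=
  ∑' m : ℕ, (-1) ^ m * (z / 2) ^ (2 * (m : ℂ) + ν) / (m.factorial * Complex.Gamma (m + 1 + ν))

/-- The Kelvin function `ber`, as an entire function: for real `x` it is the real part of
`J_0(x e^{3πi/4})`. -/
def ber (z : ℂ) : ℂ :=
  (besselJ 0 (z * Complex.exp (3 * Real.pi * Complex.I / 4)) +
    besselJ 0 (z * Complex.exp (-(3 * Real.pi * Complex.I / 4)))) / 2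

/-- The Kelvin function `bei`, as an entire function: for real `x` it is the imaginary part of
`J_0(x e^{3πi/4})`. -/
def bei (z : ℂ) : ℂ :=
  (besselJ 0 (z * Complex.exp (3 * Real.pi * Complex.I / 4)) -
    besselJ 0 (z * Complex.exp (-(3 * Real.pi * Complex.I / 4)))) / (2 * Complex.I)

theorem besselJ_zero_conj (z : ℂ) :
    besselJ 0 ((starRingEnd ℂ) z) = (starRingEnd ℂ) (besselJ 0 z) := by
  unfold besselJ
  rw [Complex.conj_tsum]
  refine tsum_congr fun m ↦ ?_
  have h : (2 * (m : ℂ) + 0) = ((2 * m : ℕ) : ℂ) := by push_cast; ring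
  rw [h, Complex.cpow_natCast, Complex.cpow_natCast]
  simp [← Complex.Gamma_conj, map_ofNat (starRingEnd ℂ) 2]

theorem ber_bei_ofReal (x : ℝ) :
    ber x = (besselJ 0 (x * Complex.exp (3 * Real.pi * Complex.I / 4))).re ∧
    bei x = (besselJ 0 (x * Complex.exp (3 * Real.pi * Complex.I / 4))).im := by
  have h : (x : ℂ) * Complex.exp (-(3 * Real.pi * Complex.I / 4)) =
      (starRingEnd ℂ) (x * Complex.exp (3 * Real.pi * Complex.I / 4)) := by
    rw [map_mul, ← Complex.exp_conj]
    simp [neg_div, map_ofNat (starRingEnd ℂ) 3, map_ofNat (starRingEnd ℂ) 4]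
  constructor
  · rw [ber, h, besselJ_zero_conj, Complex.add_conj]
    push_cast; ring
  · rw [bei, h, besselJ_zero_conj, Complex.sub_conj]
    have := Complex.I_ne_zero
    push_cast; field_simp

/-- The generalized hypergeometric function `_pF_q(as; bs; z)`. -/
def hypergeom (as bs : List ℂ) (z : ℂ) : ℂ :=
  ∑' n : ℕ, (as.map fun c ↦ (ascPochhammer ℂ n).eval c).prod /
    (bs.map fun c ↦ (ascPochhammer ℂ n).eval c).prod * (z ^ n / n.factorial)

variable (K : Type*) [Field K] [NumberField K]

/-- `D_K`, the absolute value of the discriminant. -/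
def absDiscr : ℂ := ((NumberField.discr K).natAbs : ℂ)

/-- `v_K(m)`, the number of integral ideals of norm `m`. -/
def idealCount (m : ℕ) : ℕ :=
  Nat.card {I : Ideal (NumberField.RingOfIntegers K) // Ideal.absNorm I = m}

/-- `σ_{K,a}(n) = ∑_{d ∣ n} v_K(d) d^a`. -/
def sigmaK (a : ℂ) (n : ℕ) : ℂ :=
  ∑ d ∈ n.divisors, (idealCount K d : ℂ) * (d : ℂ) ^ a

/-- The Dedekind zeta function, continued to `ℂ \ {1}`. -/
def zetaK : ℂ → ℂ := continuation {1} (NumberField.dedekindZeta K)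

/-- The series side:
`∑ σ_{K,a}(n) e^{-ny} + ζ_K(-a)/2 - ζ_K(1-a)/y - L(1,χ_D) Γ(a+1) ζ(a+1) / y^{a+1}`. -/
def lambertSide (a y : ℂ) : ℂ :=
  (∑' n : ℕ+, sigmaK K a n * Complex.exp (-(n * y))) + 1 / 2 * zetaK K (-a) -
    zetaK K (1 - a) / y -
    quadraticL (NumberField.discr K) 1 * Complex.Gamma (a + 1) * riemannZeta (a + 1) / y ^ (a + 1)

/-- `4π^6 n^2 / (y^2 D_K^2)` -/
def zArg (y : ℂ) (n : ℕ) : ℂ :=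
  4 * (Real.pi : ℂ) ^ 6 * (n : ℂ) ^ 2 / (y ^ 2 * absDiscr K ^ 2)

/-- `4π √(2nπ / (y D_K))`, principal square root. -/
def kelvinArg (y : ℂ) (n : ℕ) : ℂ :=
  4 * Real.pi * (2 * n * Real.pi / (y * absDiscr K)) ^ (1 / 2 : ℂ)

/-- The factor `4π^{2-2a} D_K^{a-1/2} / (y sin(πa))`. -/
def prefactor (a y : ℂ) : ℂ :=
  4 * (Real.pi : ℂ) ^ (2 - 2 * a) * absDiscr K ^ (a - 1 / 2) / (y * Complex.sin (Real.pi * a))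

/-- The `n`-th term of the transformed series, without the prefactor. -/
def transTerm (a y : ℂ) (n : ℕ) : ℂ :=
  sigmaK K (-a) n *
    ((2 : ℂ) ^ (-2 * a) / Complex.Gamma (1 - a) ^ 2 *
        hypergeom [1] [1 - a / 2, 1 - a / 2, (1 - a) / 2, (1 - a) / 2] (-zArg K y n) -
      zArg K y n ^ (a / 2) *
        (Complex.cos (Real.pi * a / 2) * ber (kelvinArg K y n) -
          Complex.sin (Real.pi * a / 2) * bei (kelvinArg K y n)))

end QuadLambert

end

/-! ### Exponential bounds for the Gamma function on vertical lines -/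

namespace QuadLambert

/-! The Dirichlet series of `σ_{K,a}` is `ζ(s) ζ_K(s - a)`, so the Cahen–Mellin integral
`integral_Gamma_mul_cpow` turns the Lambert series into the integral of `Γ(s) ζ(s) ζ_K(s - a)
y^{-s}`, divided by `2πi`, over a line to the right of `1` and `1 + Re a` (`hasSum_lambert`). The
line is moved to `Re s = c` with `-1 < c < 0` and `c < Re a`. The poles crossed are `0`, `1` and `1
+ a`, and their residues are the three explicit terms of the left-hand side
(`lambertSide_eq_integral`).

On the new line both functional equations apply. They replace `ζ(s) ζ_K(s - a)` by `ζ(1 - s) ζ_K(1 -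
s + a)`, the Dirichlet series of `σ_{K,-a}` at `1 - s`, times elementary and Gamma factors.
Integrating term by term (`hasSum_barnesTerm`) gives one Mellin–Barnes integral for each `n`, of
`ω^s Γ(1 - (s - a)) / Γ(s - a) / (2 cos(πs/2))` with `ω = 8π³n / (y D_K)`. Since `|arg ω| < π/2`,
the decay of `1 / cos` makes it converge absolutely. Its contour closes to the right, where `1 / Γ(s
- a)²` decays superexponentially. For noninteger `a` all poles there are simple: those at the odd
positive integers, from the cosine, sum to the `₁F₄` function, and those at `a + 1 + j`, from the
Gamma function, sum to the Kelvin combination (`integral_barnesKernel`, `prefactor_mul_transTerm`).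

At a nonnegative integer `a` the two families of poles collide and `sin(πa)` vanishes, but the
integral over `Re s = c` knows nothing of this. It is continuous in `a` and dominated by a summable
sequence near the integer, so the limits of the terms are the integrals themselves, and they sum to
the limit of the left-hand side (`transformation_formula_nat`).

The arithmetic input is built from scratch. The norm form on an ideal is a positive definite binary
form of fixed discriminant after scaling, so Poisson summation inverts its theta series. Summing
over ideal classes gives a self-dual theta series with coefficients `v_K(n)`, and its Mellin
transform gives the continuation and functional equation of `ζ_K`. Counting ideals of prime power
norm gives `v_K = 1 * χ_D`, hence `ζ_K = ζ L(·, χ_D)`. Reciprocity makes `χ_D` periodic on positive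
integers, and its sum over a period is zero because `ζ_K` has only a simple pole at `1`. So `L` is
entire and `L(1, χ_D)` is the residue of `ζ_K` at `1`.

Moving the first line needs decay in the strip. The product of the integrand with `s (s - 1) (s - 1
- a)` is holomorphic in the strip, of at most exponential growth, and bounded on both edges, so
Phragmén–Lindelöf bounds it throughout (`lambertIntegrand_decay`). All Gamma estimates come from the
beta integral and the reflection formula instead of Stirling's. -/

open Complex in
-- The beta integral satisfies `‖B(z, δ)‖ ≤ B(Re z, δ)`. Hence `‖Γ(z)‖ / Γ(Re z)` does not decrease
-- when `z` moves to the right, and bounds can be carried from one vertical line to another.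
theorem norm_Gamma_mul_Gamma_le {z : ℂ} (hz : 0 < z.re) {δ : ℝ} (hδ : 0 < δ) :
    ‖Gamma z‖ * Real.Gamma (z.re + δ) ≤ Real.Gamma z.re * ‖Gamma (z + δ)‖ := by
  have h1 := Gamma_mul_Gamma_eq_betaIntegral hz (t := (δ : ℂ)) (by simpa using hδ)
  have h2 := Gamma_mul_Gamma_eq_betaIntegral (s := (z.re : ℂ)) (t := (δ : ℂ)) (by simpa using hz)
    (by simpa using hδ)
  have hb : ‖betaIntegral z δ‖ ≤ ‖betaIntegral z.re δ‖ := by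
    have hreal : betaIntegral z.re δ =
        ((∫ x : ℝ in (0 : ℝ)..1, x ^ (z.re - 1) * (1 - x) ^ (δ - 1) : ℝ) : ℂ) := by
      rw [betaIntegral, ← intervalIntegral.integral_ofReal]
      refine intervalIntegral.integral_congr fun x hx ↦ ?_
      rw [Set.uIcc_of_le zero_le_one] at hx
      rw [ofReal_mul, ofReal_cpow hx.1, ofReal_cpow (by linarith [hx.2])]
      push_cast
      rfl
    rw [hreal, norm_real]
    refine le_trans ?_ (le_abs_self _)
    rw [betaIntegral, intervalIntegral.integral_of_le zero_le_one,
      intervalIntegral.integral_of_le zero_le_one, MeasureTheory.integral_Ioc_eq_integral_Ioo,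
      MeasureTheory.integral_Ioc_eq_integral_Ioo]
    refine (MeasureTheory.norm_integral_le_integral_norm _).trans (le_of_eq ?_)
    refine MeasureTheory.setIntegral_congr_fun measurableSet_Ioo fun x hx ↦ ?_
    have h1x : (1 : ℂ) - x = ((1 - x : ℝ) : ℂ) := by push_cast; rfl
    rw [norm_mul, h1x, norm_cpow_eq_rpow_re_of_pos hx.1,
      norm_cpow_eq_rpow_re_of_pos (by linarith [hx.2])]
    simp
  have hGδ : 0 < ‖Gamma (δ : ℂ)‖ := norm_pos_iff.mpr (Gamma_ne_zero_of_re_pos (by simpa using hδ))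
  have e1 := congrArg norm h1
  have e2 := congrArg norm h2
  rw [norm_mul, norm_mul] at e1 e2
  rw [← ofReal_add, Gamma_ofReal z.re, Gamma_ofReal (z.re + δ), norm_real, norm_real,
    Real.norm_of_nonneg (Real.Gamma_pos_of_pos hz).le,
    Real.norm_of_nonneg (Real.Gamma_pos_of_pos (by linarith : 0 < z.re + δ)).le] at e2
  refine le_of_mul_le_mul_right ?_ hGδ
  have hA : 0 < Real.Gamma (z.re + δ) := Real.Gamma_pos_of_pos (by linarith)
  calc ‖Gamma z‖ * Real.Gamma (z.re + δ) * ‖Gamma (δ : ℂ)‖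
      = (‖Gamma z‖ * ‖Gamma (δ : ℂ)‖) * Real.Gamma (z.re + δ) := by ring
    _ = ‖Gamma (z + δ)‖ * ‖betaIntegral z δ‖ * Real.Gamma (z.re + δ) := by rw [e1]
    _ ≤ ‖Gamma (z + δ)‖ * ‖betaIntegral z.re δ‖ * Real.Gamma (z.re + δ) := by gcongr
    _ = ‖Gamma (z + δ)‖ * (Real.Gamma (z.re + δ) * ‖betaIntegral z.re δ‖) := by ring
    _ = _ := by rw [← e2]; ring

open Complex in
-- On `Re z = 1/2` one has `1 - z = conj z`, so the reflection formula gives the modulus exactly.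
theorem norm_Gamma_half_add_mul_I_sq (t : ℝ) :
    ‖Gamma (1 / 2 + t * I)‖ ^ 2 = Real.pi / Real.cosh (Real.pi * t) := by
  have h := Gamma_mul_Gamma_one_sub (1 / 2 + t * I)
  have h1 : (1 : ℂ) - (1 / 2 + t * I) = (starRingEnd ℂ) (1 / 2 + t * I) := by
    rw [map_add, map_mul, conj_ofReal, conj_I, map_div₀, map_one, map_ofNat]; ring
  have h2 : sin (Real.pi * (1 / 2 + t * I)) = ((Real.cosh (Real.pi * t) : ℝ) : ℂ) := by
    rw [show (Real.pi : ℂ) * (1 / 2 + t * I) = ((Real.pi * t : ℝ) : ℂ) * I + Real.pi / 2 by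
      push_cast; ring, sin_add_pi_div_two, cos_mul_I, ofReal_cosh]
  rw [h1, Gamma_conj, mul_conj, h2, normSq_eq_norm_sq] at h
  exact_mod_cast h

open Complex in
theorem norm_Gamma_half_add_mul_I_le (t : ℝ) :
    ‖Gamma (1 / 2 + t * I)‖ ≤ 3 * Real.exp (-(Real.pi / 2 * |t|)) := by
  have h := norm_Gamma_half_add_mul_I_sq t
  have hc : Real.exp (Real.pi * |t|) / 2 ≤ Real.cosh (Real.pi * t) := by
    rw [← Real.cosh_abs, abs_mul, abs_of_pos Real.pi_pos, Real.cosh_eq]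
    have := Real.exp_pos (-(Real.pi * |t|))
    linarith
  have he := Real.exp_pos (Real.pi * |t|)
  refine le_of_sq_le_sq ?_ (by positivity)
  rw [h, mul_pow, ← Real.exp_nat_mul, div_le_iff₀ (by positivity)]
  have : Real.exp (((2 : ℕ) : ℝ) * -(Real.pi / 2 * |t|)) = (Real.exp (Real.pi * |t|))⁻¹ := by
    rw [← Real.exp_neg]; congr 1; push_cast; ring
  rw [this]
  calc Real.pi ≤ 3 ^ 2 * (Real.exp (Real.pi * |t|))⁻¹ * (Real.exp (Real.pi * |t|) / 2) := by
        field_simp; linarith [Real.pi_lt_four]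
    _ ≤ _ := by gcongr

open Complex in
theorem norm_Gamma_nat_add_half_le (m : ℕ) (t : ℝ) :
    ‖Gamma (m + 1 / 2 + t * I)‖ ≤ 3 * (m + |t|) ^ m * Real.exp (-(Real.pi / 2 * |t|)) := by
  -- `m` stays fixed while `k` grows, so that every factor of the recurrence has the same bound `m +
  -- |t|`.
  have key : ∀ k : ℕ, k ≤ m → ‖Gamma (k + 1 / 2 + t * I)‖ ≤
      3 * (m + |t|) ^ k * Real.exp (-(Real.pi / 2 * |t|)) := by
    intro k
    induction k with
    | zero => intro _; simpa using norm_Gamma_half_add_mul_I_le t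
    | succ k ih =>
      intro hk
      have hne : (k + 1 / 2 + t * I : ℂ) ≠ 0 := by
        intro h0
        have := congrArg re h0
        simp at this
        have : (0 : ℝ) ≤ k := k.cast_nonneg
        linarith
      rw [show ((k + 1 : ℕ) + 1 / 2 + t * I : ℂ) = (k + 1 / 2 + t * I) + 1 by push_cast; ring,
        Gamma_add_one _ hne, norm_mul]
      have h1 : ‖(k + 1 / 2 + t * I : ℂ)‖ ≤ m + |t| := by
        calc ‖(k + 1 / 2 + t * I : ℂ)‖ = ‖((k + 1 / 2 : ℝ) : ℂ) + t * I‖ := by push_cast; rfl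
          _ ≤ ‖((k + 1 / 2 : ℝ) : ℂ)‖ + ‖(t * I : ℂ)‖ := norm_add_le _ _
          _ = (k + 1 / 2) + |t| := by
              rw [norm_real, Real.norm_of_nonneg (by positivity)]; simp
          _ ≤ m + |t| := by
              have : ((k + 1 : ℕ) : ℝ) ≤ m := by exact_mod_cast hk
              push_cast at this
              linarith
      calc _ ≤ (m + |t|) * (3 * (m + |t|) ^ k * Real.exp (-(Real.pi / 2 * |t|))) := by
            gcongr; exact ih (by omega)
        _ = _ := by ring
  exact key m le_rfl

/-- Uniform exponential decay of `Γ` on closed vertical strips in the right half-plane. -/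
theorem exists_norm_Gamma_le {σ₁ : ℝ} (h₁ : 0 < σ₁) (σ₂ : ℝ) :
    ∃ C : ℝ, 0 ≤ C ∧ ∃ m : ℕ, ∀ z : ℂ, σ₁ ≤ z.re → z.re ≤ σ₂ →
      ‖Complex.Gamma z‖ ≤ C * (1 + |z.im|) ^ m * Real.exp (-(Real.pi / 2 * |z.im|)) := by
  obtain ⟨m, hm⟩ := exists_nat_gt σ₂
  have hcont : ContinuousOn Real.Gamma (Set.Icc σ₁ σ₂) := fun x hx ↦
    (Real.differentiableAt_Gamma fun k hk ↦ by
      have := hx.1; have : (0 : ℝ) ≤ k := k.cast_nonneg; linarith).continuousAt.continuousWithinAt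
  obtain ⟨A, hA⟩ := isCompact_Icc.exists_bound_of_continuousOn hcont
  have hG : 0 < Real.Gamma (m + 1 / 2) := Real.Gamma_pos_of_pos (by positivity)
  refine ⟨|A| * 3 * (m + 1) ^ m / Real.Gamma (m + 1 / 2), by positivity, m, fun z hz1 hz2 ↦ ?_⟩
  have hz0 : 0 < z.re := by linarith
  -- This `δ` moves `z` onto the line `Re = m + 1/2`, to the right of `σ₂`, where the modulus is
  -- already under control.
  have h := norm_Gamma_mul_Gamma_le hz0 (δ := m + 1 / 2 - z.re) (by linarith)
  rw [show z.re + (m + 1 / 2 - z.re) = m + 1 / 2 by ring] at h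
  rw [show z + ((m + 1 / 2 - z.re : ℝ) : ℂ) = m + 1 / 2 + z.im * Complex.I by
    apply Complex.ext <;> simp] at h
  have hA' : Real.Gamma z.re ≤ |A| := by
    have := hA z.re ⟨hz1, hz2⟩
    rw [Real.norm_eq_abs] at this
    exact (le_abs_self _).trans (this.trans (le_abs_self _))
  have := norm_Gamma_nat_add_half_le m z.im
  rw [div_mul_eq_mul_div, div_mul_eq_mul_div, le_div_iff₀ hG]
  calc _ ≤ _ := h
    _ ≤ |A| * (3 * (m + |z.im|) ^ m * Real.exp (-(Real.pi / 2 * |z.im|))) := by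
        gcongr
    _ ≤ |A| * (3 * ((m + 1) * (1 + |z.im|)) ^ m * Real.exp (-(Real.pi / 2 * |z.im|))) := by
        gcongr
        nlinarith [abs_nonneg z.im, (Nat.cast_nonneg m : (0 : ℝ) ≤ m)]
    _ = _ := by rw [mul_pow]; ring

open Complex in
-- On `Re z = 1/2` this follows from the exact modulus and `cosh x ≤ exp |x|`; the monotonicity of
-- `‖Γ(z)‖ / Γ(Re z)` carries it to the right.
theorem Gamma_mul_exp_le_norm_Gamma {z : ℂ} (hz : 1 / 2 ≤ z.re) :
    Real.Gamma z.re * Real.exp (-(Real.pi / 2 * |z.im|)) ≤ ‖Gamma z‖ := by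
  have hhalf : Real.Gamma (1 / 2) * Real.exp (-(Real.pi / 2 * |z.im|)) ≤
      ‖Gamma (1 / 2 + z.im * I)‖ := by
    refine le_of_sq_le_sq ?_ (norm_nonneg _)
    rw [norm_Gamma_half_add_mul_I_sq, mul_pow, Real.Gamma_one_half_eq, Real.sq_sqrt Real.pi_pos.le,
      ← Real.exp_nat_mul, div_eq_mul_inv Real.pi (Real.cosh _)]
    refine mul_le_mul_of_nonneg_left ?_ Real.pi_pos.le
    rw [show ((2 : ℕ) : ℝ) * -(Real.pi / 2 * |z.im|) = -(Real.pi * |z.im|) by push_cast; ring,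
      Real.exp_neg]
    gcongr
    rw [← Real.cosh_abs, abs_mul, abs_of_pos Real.pi_pos, Real.cosh_eq]
    have h1 : Real.exp (-(Real.pi * |z.im|)) ≤ Real.exp (Real.pi * |z.im|) := by
      gcongr
      have : 0 ≤ Real.pi * |z.im| := by positivity
      linarith
    linarith
  rcases hz.eq_or_lt with h | h
  · have hz' : z = 1 / 2 + z.im * I := by
      conv_lhs => rw [← re_add_im z, ← h]
      push_cast; rfl
    rw [← h]
    conv_rhs => rw [hz']
    exact hhalf
  · have h' := norm_Gamma_mul_Gamma_le (z := 1 / 2 + z.im * I) (by simp)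
      (δ := z.re - 1 / 2) (by linarith)
    rw [show (1 / 2 + z.im * I : ℂ).re = 1 / 2 by simp,
      show (1 / 2 : ℝ) + (z.re - 1 / 2) = z.re by ring,
      show (1 / 2 + z.im * I : ℂ) + ((z.re - 1 / 2 : ℝ) : ℂ) = z by
        conv_rhs => rw [← re_add_im z]
        push_cast; ring] at h'
    have hGz : 0 < Real.Gamma z.re := Real.Gamma_pos_of_pos (by linarith)
    have hG2 : 0 < Real.Gamma (1 / 2) := Real.Gamma_pos_of_pos (by norm_num)
    refine le_of_mul_le_mul_left ?_ hG2
    calc _ = Real.Gamma (1 / 2) * Real.exp (-(Real.pi / 2 * |z.im|)) * Real.Gamma z.re := by ring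
      _ ≤ ‖Gamma (1 / 2 + z.im * I)‖ * Real.Gamma z.re := by gcongr
      _ ≤ _ := h'

open Complex in
/-- Upper bound for `1 / Γ` obtained by moving the argument `k` steps to the right. -/
theorem norm_inv_Gamma_le (k : ℕ) {z : ℂ} (hz : 1 / 2 ≤ z.re + k) :
    ‖(Gamma z)⁻¹‖ ≤ (‖z‖ + k) ^ k * Real.exp (Real.pi / 2 * |z.im|) / Real.Gamma (z.re + k) := by
  have h : ‖(Gamma z)⁻¹‖ ≤ (‖z‖ + k) ^ k * ‖(Gamma (z + k))⁻¹‖ := by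
    have key : ∀ j : ℕ, j ≤ k → ‖(Gamma z)⁻¹‖ ≤ (‖z‖ + k) ^ j * ‖(Gamma (z + j))⁻¹‖ := by
      intro j
      induction j with
      | zero => intro _; simp
      | succ j ih =>
        intro hj
        refine (ih (by omega)).trans ?_
        rw [one_div_Gamma_eq_self_mul_one_div_Gamma_add_one (z + j), norm_mul, pow_succ, mul_assoc]
        have hn : ‖z + j‖ ≤ ‖z‖ + k := by
          refine (norm_add_le _ _).trans ?_
          rw [norm_natCast]
          have : ((j + 1 : ℕ) : ℝ) ≤ k := by exact_mod_cast hj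
          push_cast at this
          linarith
        rw [show z + j + 1 = z + ((j + 1 : ℕ) : ℂ) by push_cast; ring]
        gcongr
    exact key k le_rfl
  refine h.trans ?_
  rw [mul_div_assoc]
  gcongr
  have h2 := Gamma_mul_exp_le_norm_Gamma (z := z + k) (by simpa using hz)
  have hG : 0 < Real.Gamma (z.re + k) := Real.Gamma_pos_of_pos (by linarith)
  simp only [add_re, natCast_re, add_im, natCast_im, add_zero] at h2
  rw [norm_inv, ← one_div, div_le_div_iff₀ (by
    refine lt_of_lt_of_le ?_ h2; positivity) hG, one_mul]
  calc Real.Gamma (z.re + k) = Real.exp (Real.pi / 2 * |z.im|) *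
        (Real.Gamma (z.re + k) * Real.exp (-(Real.pi / 2 * |z.im|))) := by
        rw [Real.exp_neg]; field_simp
    _ ≤ _ := by gcongr

/-- Uniform exponential bound for `1 / Γ` on closed vertical strips. -/
theorem exists_norm_inv_Gamma_le (σ₁ σ₂ : ℝ) :
    ∃ C : ℝ, 0 ≤ C ∧ ∃ m : ℕ, ∀ z : ℂ, σ₁ ≤ z.re → z.re ≤ σ₂ →
      ‖(Complex.Gamma z)⁻¹‖ ≤ C * (1 + |z.im|) ^ m * Real.exp (Real.pi / 2 * |z.im|) := by
  obtain ⟨k, hk⟩ := exists_nat_gt (1 / 2 - σ₁)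
  have hcont : ContinuousOn (fun x : ℝ ↦ (Real.Gamma (x + k))⁻¹) (Set.Icc σ₁ σ₂) := by
    intro x hx
    have hx0 : 0 < x + k := by linarith [hx.1]
    have h1 : ContinuousAt Real.Gamma (x + k) := (Real.differentiableAt_Gamma fun j hj ↦ by
      have : (0 : ℝ) ≤ j := j.cast_nonneg; linarith).continuousAt
    have h2 : ContinuousAt (fun x : ℝ ↦ Real.Gamma (x + k)) x :=
      ContinuousAt.comp (f := fun x : ℝ ↦ x + k) h1 (by fun_prop)
    exact (h2.inv₀ (Real.Gamma_pos_of_pos hx0).ne').continuousWithinAt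
  obtain ⟨A, hA⟩ := isCompact_Icc.exists_bound_of_continuousOn hcont
  set M : ℝ := |σ₁| + |σ₂| + k with hM
  refine ⟨|A| * (M + 1) ^ k, by positivity, k, fun z hz1 hz2 ↦ ?_⟩
  have h := norm_inv_Gamma_le k (z := z) (by linarith)
  have hA' : (Real.Gamma (z.re + k))⁻¹ ≤ |A| :=
    (le_abs_self _).trans ((hA z.re ⟨hz1, hz2⟩).trans (le_abs_self _))
  have hre : |z.re| ≤ |σ₁| + |σ₂| := by
    rcases abs_cases z.re with h | h <;> rcases abs_cases σ₁ with h' | h' <;>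
      rcases abs_cases σ₂ with h'' | h'' <;> linarith
  have hn : ‖z‖ + k ≤ (M + 1) * (1 + |z.im|) := by
    have := Complex.norm_le_abs_re_add_abs_im z
    have hM0 : 0 ≤ M := by positivity
    nlinarith [abs_nonneg z.im]
  have hG : 0 < Real.Gamma (z.re + k) := Real.Gamma_pos_of_pos (by linarith)
  calc _ ≤ _ := h
    _ = (‖z‖ + k) ^ k * Real.exp (Real.pi / 2 * |z.im|) * (Real.Gamma (z.re + k))⁻¹ := by
        rw [div_eq_mul_inv]
    _ ≤ ((M + 1) * (1 + |z.im|)) ^ k * Real.exp (Real.pi / 2 * |z.im|) * |A| := by gcongr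
    _ = _ := by rw [mul_pow]; ring

end QuadLambert

/-! ### Moving a vertical line of integration across simple poles -/

namespace QuadLambert

open Complex MeasureTheory

/-- Cauchy's theorem on rectangles of height `±T`; the horizontal sides vanish as `T → ∞` by the
uniform decay. -/
theorem integral_vertical_eq_of_differentiable {f : ℂ → ℂ} {σ₁ σ₂ : ℝ} (h : σ₁ ≤ σ₂)
    (hd : ∀ z : ℂ, σ₁ ≤ z.re → z.re ≤ σ₂ → DifferentiableAt ℂ f z)
    (hdecay : ∀ ε > 0, ∃ T : ℝ, ∀ z : ℂ, σ₁ ≤ z.re → z.re ≤ σ₂ → T ≤ |z.im| → ‖f z‖ ≤ ε)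
    (h₁ : Integrable fun t : ℝ ↦ f (σ₁ + t * I)) (h₂ : Integrable fun t : ℝ ↦ f (σ₂ + t * I)) :
    ∫ t : ℝ, f (σ₂ + t * I) = ∫ t : ℝ, f (σ₁ + t * I) := by
  have hrect : ∀ T : ℝ, (∫ x : ℝ in σ₁..σ₂, f (x + (-T : ℝ) * I)) -
      (∫ x : ℝ in σ₁..σ₂, f (x + T * I)) + I * (∫ y : ℝ in (-T)..T, f (σ₂ + y * I)) -
      I * (∫ y : ℝ in (-T)..T, f (σ₁ + y * I)) = 0 := by
    intro T
    have := integral_boundary_rect_eq_zero_of_differentiableOn f (⟨σ₁, -T⟩ : ℂ) (⟨σ₂, T⟩ : ℂ) (by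
      intro z hz
      rw [mem_reProdIm] at hz
      simp only [Set.uIcc_of_le h] at hz
      exact (hd z hz.1.1 hz.1.2).differentiableWithinAt)
    simpa using this
  have hhor : ∀ s : ℝ → ℝ, (∀ T, |s T| = |T|) →
      Tendsto (fun T : ℝ ↦ ∫ x : ℝ in σ₁..σ₂, f (x + (s T : ℝ) * I)) atTop (𝓝 0) := by
    intro s hs
    rw [Metric.tendsto_atTop]
    intro ε hε
    obtain ⟨T, hT⟩ := hdecay (ε / (2 * (σ₂ - σ₁ + 1))) (by
      have : 0 < σ₂ - σ₁ + 1 := by linarith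
      positivity)
    refine ⟨T, fun S hS ↦ ?_⟩
    rw [dist_zero_right]
    have hb : ‖∫ x : ℝ in σ₁..σ₂, f (x + (s S : ℝ) * I)‖ ≤
        (ε / (2 * (σ₂ - σ₁ + 1))) * |σ₂ - σ₁| := by
      refine intervalIntegral.norm_integral_le_of_norm_le_const fun x hx ↦ ?_
      rw [Set.uIoc_of_le h] at hx
      exact hT _ (by simpa using hx.1.le) (by simpa using hx.2) (by
        simp only [add_im, ofReal_im, mul_im, ofReal_re, I_im, mul_one, I_re, mul_zero, add_zero,
          zero_add, hs]
        exact hS.trans (le_abs_self _))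
    refine hb.trans_lt ?_
    rw [abs_of_nonneg (by linarith), div_mul_eq_mul_div, div_lt_iff₀ (by linarith)]
    nlinarith
  have hv : ∀ σ : ℝ, Integrable (fun t : ℝ ↦ f (σ + t * I)) →
      Tendsto (fun T : ℝ ↦ ∫ y : ℝ in (-T)..T, f (σ + y * I)) atTop
        (𝓝 (∫ t : ℝ, f (σ + t * I))) := fun σ hσ ↦
    intervalIntegral_tendsto_integral hσ tendsto_neg_atTop_atBot tendsto_id
  have hlim := (((hhor (fun T ↦ -T) (by simp)).sub (hhor id (by simp))).add
    ((hv σ₂ h₂).const_mul I)).sub ((hv σ₁ h₁).const_mul I)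
  have h0 := tendsto_nhds_unique hlim (tendsto_const_nhds.congr fun T ↦ (hrect T).symm)
  have : I * ((∫ t : ℝ, f (σ₂ + t * I)) - ∫ t : ℝ, f (σ₁ + t * I)) = 0 := by
    linear_combination h0
  simpa [sub_eq_zero] using this

/-- A function with a single simple pole at `0` in the half-plane `-R < Re z`, integrable on
vertical lines. -/
noncomputable def simplePole (R : ℝ) (z : ℂ) : ℂ := z⁻¹ - (z + R)⁻¹

theorem simplePole_eq {R : ℝ} {z : ℂ} (hz : z ≠ 0) (hz' : z + R ≠ 0) :
    simplePole R z = R * (z * (z + R))⁻¹ := by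
  unfold simplePole; field_simp; ring

theorem norm_simplePole_le {R : ℝ} {z : ℂ} (hz : z.im ≠ 0) :
    ‖simplePole R z‖ ≤ |R| * (z.im ^ 2)⁻¹ := by
  have h0 : z ≠ 0 := fun h ↦ hz (by simp [h])
  have h1 : z + R ≠ 0 := fun h ↦ hz (by simpa using congrArg im h)
  rw [simplePole_eq h0 h1, norm_mul, norm_real, Real.norm_eq_abs, norm_inv, norm_mul]
  have a0 : |z.im| ≤ ‖z‖ := abs_im_le_norm z
  have a1 : |z.im| ≤ ‖z + R‖ := by simpa using abs_im_le_norm (z + R)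
  have : 0 < |z.im| := abs_pos.mpr hz
  rw [← sq_abs, sq]
  gcongr

theorem integrable_simplePole {R σ : ℝ} (hσ : σ ≠ 0) (hR : σ + R ≠ 0) (v : ℝ) :
    Integrable fun t : ℝ ↦ simplePole R (σ + (t - v : ℝ) * I) := by
  suffices Integrable fun t : ℝ ↦ simplePole R (σ + t * I) from this.comp_sub_right v
  have h0 : ∀ t : ℝ, (σ + t * I : ℂ) ≠ 0 := fun t h ↦ hσ (by simpa using congrArg re h)
  have h1 : ∀ t : ℝ, (σ + t * I + R : ℂ) ≠ 0 := fun t h ↦ hR (by simpa using congrArg re h)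
  have hc : Continuous fun t : ℝ ↦ simplePole R (σ + t * I) := by
    unfold simplePole
    refine Continuous.sub (Continuous.inv₀ (by fun_prop) h0) (Continuous.inv₀ (by fun_prop) h1)
  set δ := min (min |σ| |σ + R|) 1 with hδ
  have hδ0 : 0 < δ := lt_min (lt_min (abs_pos.mpr hσ) (abs_pos.mpr hR)) one_pos
  refine Integrable.mono' ((integrable_inv_one_add_sq).const_mul (|R| * (4 / δ ^ 2)))
    hc.aestronglyMeasurable (Eventually.of_forall fun t ↦ ?_)
  have key : ∀ u : ℝ, δ ≤ |u| → δ / 2 * (1 + |t|) ≤ ‖(u + t * I : ℂ)‖ := by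
    intro u hu
    have b0 : |u| ≤ ‖(u + t * I : ℂ)‖ := by simpa using abs_re_le_norm (u + t * I)
    have b1 : |t| ≤ ‖(u + t * I : ℂ)‖ := by simpa using abs_im_le_norm (u + t * I)
    have : δ ≤ 1 := min_le_right _ _
    nlinarith [abs_nonneg t]
  have e0 := key σ ((min_le_left _ _).trans (min_le_left _ _))
  have e1 := key (σ + R) ((min_le_left _ _).trans (min_le_right _ _))
  rw [simplePole_eq (h0 t) (h1 t), norm_mul, norm_real, Real.norm_eq_abs, norm_inv, norm_mul,
    mul_assoc]
  gcongr
  rw [show (σ + t * I + R : ℂ) = ((σ + R : ℝ) : ℂ) + t * I by push_cast; ring]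
  calc (‖(σ + t * I : ℂ)‖ * ‖(((σ + R : ℝ) : ℂ) + t * I : ℂ)‖)⁻¹
      ≤ ((δ / 2 * (1 + |t|)) * (δ / 2 * (1 + |t|)))⁻¹ := by gcongr
    _ = 4 / δ ^ 2 * ((1 + |t|) ^ 2)⁻¹ := by field_simp; norm_num
    _ ≤ 4 / δ ^ 2 * (1 + t ^ 2)⁻¹ := by
      gcongr
      nlinarith [abs_nonneg t, sq_abs t]

theorem integral_re_inv (σ : ℝ) (hσ : 0 < σ) : ∫ t : ℝ, σ / (σ ^ 2 + t ^ 2) = Real.pi := by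
  have h : ∀ t : ℝ, σ / (σ ^ 2 + t ^ 2) = σ⁻¹ * (1 + (σ⁻¹ * t) ^ 2)⁻¹ := fun t ↦ by field_simp
  simp_rw [h]
  rw [integral_const_mul, Measure.integral_comp_mul_left (fun t : ℝ ↦ (1 + t ^ 2)⁻¹),
    integral_univ_inv_one_add_sq, abs_of_pos (by positivity)]
  simp; field_simp

/-- The real part is a difference of two Cauchy densities, each of mass `±π` according to the side
of its pole, and the imaginary part is odd. So the integral vanishes when both poles lie left of the
line and is `-2π` when the line separates them. -/
theorem integral_simplePole {R σ : ℝ} (hσ : σ ≠ 0) (hR : 0 < σ + R) (v : ℝ) :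
    ∫ t : ℝ, simplePole R (σ + (t - v : ℝ) * I) = if 0 < σ then 0 else -(2 * Real.pi : ℂ) := by
  rw [integral_sub_right_eq_self (fun t : ℝ ↦ simplePole R (σ + t * I)) v]
  have hint₀ := integrable_simplePole hσ hR.ne' 0
  simp only [sub_zero] at hint₀
  have hre : ∀ t : ℝ, (simplePole R (σ + t * I)).re =
      σ / (σ ^ 2 + t ^ 2) - (σ + R) / ((σ + R) ^ 2 + t ^ 2) := by
    intro t
    simp [simplePole, inv_re, normSq_apply, sq]
  have him : ∀ t : ℝ, (simplePole R (σ + t * I)).im =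
      -(simplePole R (σ + (-t : ℝ) * I)).im := by
    intro t
    simp [simplePole, inv_im, normSq_apply]
    ring
  have hnice : ∀ u : ℝ, 0 < u → Integrable fun t : ℝ ↦ u / (u ^ 2 + t ^ 2) := by
    intro u hu
    by_contra hn
    have := integral_re_inv u hu
    rw [integral_undef hn] at this
    exact Real.pi_ne_zero this.symm
  apply Complex.ext
  · have e1 : (∫ t : ℝ, simplePole R (σ + t * I)).re =
        ∫ t : ℝ, (σ / (σ ^ 2 + t ^ 2) - (σ + R) / ((σ + R) ^ 2 + t ^ 2)) := by
      simp_rw [← hre]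
      exact (reCLM.integral_comp_comm hint₀).symm
    rw [e1]
    rcases hσ.lt_or_gt with h | h
    · have h' : ∀ t : ℝ, σ / (σ ^ 2 + t ^ 2) = -((-σ) / ((-σ) ^ 2 + t ^ 2)) := fun t ↦ by
        rw [neg_sq]; ring
      simp_rw [h']
      have hn : Integrable fun t : ℝ ↦ -((-σ) / ((-σ) ^ 2 + t ^ 2)) :=
        (hnice (-σ) (by linarith)).neg
      rw [integral_sub hn (hnice _ hR), integral_neg,
        integral_re_inv _ (by linarith), integral_re_inv _ hR, if_neg (by linarith)]
      simp; ring
    · rw [integral_sub (hnice _ h) (hnice _ hR), integral_re_inv _ h, integral_re_inv _ hR,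
        if_pos h]
      simp
  · have e1 : (∫ t : ℝ, simplePole R (σ + t * I)).im =
        ∫ t : ℝ, (simplePole R (σ + t * I)).im := (imCLM.integral_comp_comm hint₀).symm
    have e2 : ∫ t : ℝ, (simplePole R (σ + t * I)).im =
        -∫ t : ℝ, (simplePole R (σ + t * I)).im := by
      conv_lhs => enter [2, t]; rw [him t]
      rw [integral_neg, integral_neg_eq_self (fun t : ℝ ↦ (simplePole R (σ + t * I)).im)]
    rw [e1, show (∫ t : ℝ, (simplePole R (σ + t * I)).im) = 0 by linarith]
    split_ifs <;> simp

/-- Moving a vertical line of integration to the right across the simple poles in `P`. -/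
theorem integral_vertical_sub_eq_sum_residues {σ₁ σ₂ : ℝ} (h : σ₁ ≤ σ₂) (P : Finset ℂ)
    (r : ℂ → ℂ) :
    ∀ f : ℂ → ℂ, (∀ p ∈ P, σ₁ < p.re ∧ p.re < σ₂) →
    (∀ z : ℂ, σ₁ ≤ z.re → z.re ≤ σ₂ → z ∉ P → DifferentiableAt ℂ f z) →
    (∀ p ∈ P, Tendsto (fun z ↦ (z - p) * f z) (𝓝[≠] p) (𝓝 (r p))) →
    (∀ ε > 0, ∃ T : ℝ, ∀ z : ℂ, σ₁ ≤ z.re → z.re ≤ σ₂ → T ≤ |z.im| → ‖f z‖ ≤ ε) →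
    (Integrable fun t : ℝ ↦ f (σ₁ + t * I)) → (Integrable fun t : ℝ ↦ f (σ₂ + t * I)) →
    (∫ t : ℝ, f (σ₂ + t * I)) - ∫ t : ℝ, f (σ₁ + t * I) = 2 * Real.pi * ∑ p ∈ P, r p := by
  induction P using Finset.induction_on with
  | empty =>
    intro f _ hd _ hdec h1 h2
    rw [integral_vertical_eq_of_differentiable h (fun z a b ↦ hd z a b (by simp)) hdec h1 h2]
    simp
  | insert p P hp ih =>
    intro f hP hd hr hdec h1 h2
    obtain ⟨hp1, hp2⟩ := hP p (by simp)
    -- With this `R` the second pole `p - R` of the correction lies to the left of `σ₁`.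
    set R : ℝ := σ₂ - σ₁ + 1 with hRdef
    set g : ℂ → ℂ := fun z ↦ f z - r p * simplePole R (z - p) with hg
    -- `g` has lost the pole at `p`; `G` fills in the removable singularity, so the induction
    -- hypothesis applies to `G` and the smaller set `P`.
    set G : ℂ → ℂ := Function.update g p (limUnder (𝓝[≠] p) g) with hG
    have hGne : ∀ z, z ≠ p → G z = g z := fun z hz ↦ Function.update_of_ne hz _ _
    have hpole : ∀ z : ℂ, σ₁ ≤ z.re → z ≠ p →
        DifferentiableAt ℂ (fun z ↦ r p * simplePole R (z - p)) z := by
      intro z hz hzp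
      unfold simplePole
      have a : z - p ≠ 0 := sub_ne_zero.mpr hzp
      have b : z - p + R ≠ 0 := by
        intro hb
        have := congrArg re hb
        simp at this
        linarith
      fun_prop (disch := assumption)
    have hgd : ∀ z : ℂ, σ₁ ≤ z.re → z.re ≤ σ₂ → z ∉ insert p P → DifferentiableAt ℂ g z :=
      fun z a b c ↦ (hd z a b c).sub (hpole z a fun hzp ↦ c (by simp [hzp]))
    have hGd : ∀ z : ℂ, σ₁ ≤ z.re → z.re ≤ σ₂ → z ∉ P → DifferentiableAt ℂ G z := by
      intro z a b c
      by_cases hzp : z = p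
      · subst hzp
        set s : Set ℂ := {w : ℂ | σ₁ < w.re ∧ w.re < σ₂} \ P with hs
        have hso : IsOpen s := ((isOpen_lt continuous_const continuous_re).inter
          (isOpen_lt continuous_re continuous_const)).sdiff P.finite_toSet.isClosed
        have hsn : s ∈ 𝓝 z := hso.mem_nhds ⟨⟨hp1, hp2⟩, by simpa using hp⟩
        refine (differentiableOn_update_limUnder_of_isLittleO hsn ?_ ?_).differentiableAt hsn
        · intro w hw
          refine (hgd w hw.1.1.1.le hw.1.1.2.le ?_).differentiableWithinAt
          simp only [Finset.mem_insert, not_or]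
          exact ⟨hw.2, by simpa using hw.1.2⟩
        -- The principal parts of `f` and of the correction cancel, so `(w - z) g(w) → 0`, which is
        -- Riemann's criterion.
        · have ht : Tendsto (fun w ↦ (w - z) * (g w - g z)) (𝓝[≠] z) (𝓝 0) := by
            have t1 := hr z (by simp)
            have t2 : Tendsto (fun w ↦ r z * (1 - (w - z) * (w - z + R)⁻¹)) (𝓝[≠] z)
                (𝓝 (r z)) := by
              have : ContinuousAt (fun w ↦ r z * (1 - (w - z) * (w - z + R)⁻¹)) z := by
                have : z - z + (R : ℂ) ≠ 0 := by
                  simp only [sub_self, zero_add, ne_eq, ofReal_eq_zero]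
                  linarith
                fun_prop (disch := assumption)
              have := this.tendsto
              simp only [sub_self, zero_mul, sub_zero, mul_one] at this
              exact this.mono_left nhdsWithin_le_nhds
            have t3 : Tendsto (fun w ↦ (w - z) * g z) (𝓝[≠] z) (𝓝 0) := by
              have : ContinuousAt (fun w ↦ (w - z) * g z) z := by fun_prop
              have := this.tendsto
              simp only [sub_self, zero_mul] at this
              exact this.mono_left nhdsWithin_le_nhds
            have t4 := (t1.sub t2).sub t3
            simp only [sub_self] at t4
            refine t4.congr' ?_
            filter_upwards [self_mem_nhdsWithin] with w hw
            have hw' : w - z ≠ 0 := sub_ne_zero.mpr hw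
            simp only [hg, simplePole]
            field_simp
          rw [Asymptotics.isLittleO_iff_tendsto']
          · refine ht.congr fun w ↦ ?_
            rw [div_inv_eq_mul, mul_comm]
          · filter_upwards [self_mem_nhdsWithin] with w hw h0
            exact absurd (inv_eq_zero.mp h0) (sub_ne_zero.mpr hw)
      · refine (hgd z a b (by simp [hzp, c])).congr_of_eventuallyEq ?_
        filter_upwards [isOpen_ne.mem_nhds hzp] with w hw using hGne w hw
    have hline : ∀ σ : ℝ, σ ≠ p.re → ∀ t : ℝ, G (σ + t * I) = f (σ + t * I) -
        r p * simplePole R ((σ - p.re : ℝ) + (t - p.im : ℝ) * I) := by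
      intro σ hσ t
      rw [hGne _ (fun h ↦ hσ (by simpa using congrArg re h))]
      simp only [hg]
      congr 3
      apply Complex.ext <;> simp
    have hi1 := integrable_simplePole (R := R) (σ := σ₁ - p.re) (by linarith) (by linarith) p.im
    have hi2 := integrable_simplePole (R := R) (σ := σ₂ - p.re) (by linarith) (by linarith) p.im
    have hG1 : Integrable fun t : ℝ ↦ G (σ₁ + t * I) := by
      simp_rw [hline σ₁ hp1.ne]; exact h1.sub (hi1.const_mul _)
    have hG2 : Integrable fun t : ℝ ↦ G (σ₂ + t * I) := by
      simp_rw [hline σ₂ hp2.ne']; exact h2.sub (hi2.const_mul _)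
    have key := ih G (fun q hq ↦ hP q (by simp [hq])) hGd ?_ ?_ hG1 hG2
    · simp_rw [hline σ₁ hp1.ne, hline σ₂ hp2.ne'] at key
      rw [integral_sub h2 (hi2.const_mul _), integral_sub h1 (hi1.const_mul _),
        integral_const_mul, integral_const_mul, integral_simplePole (by linarith) (by linarith),
        integral_simplePole (by linarith) (by linarith), if_pos (by linarith),
        if_neg (by linarith)] at key
      rw [Finset.sum_insert hp]
      linear_combination key
    · intro q hq
      have hqp : q ≠ p := fun h ↦ hp (h ▸ hq)
      have t1 := hr q (by simp [hq])
      have t2 : Tendsto (fun z ↦ (z - q) * (r p * simplePole R (z - p))) (𝓝[≠] q) (𝓝 0) := by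
        have hc := (hpole q (hP q (by simp [hq])).1.le hqp).continuousAt
        have : ContinuousAt (fun z ↦ (z - q) * (r p * simplePole R (z - p))) q :=
          (by fun_prop : ContinuousAt (fun z ↦ z - q) q).mul hc
        have := this.tendsto
        simp only [sub_self, zero_mul] at this
        exact this.mono_left nhdsWithin_le_nhds
      have t3 := t1.sub t2
      rw [sub_zero] at t3
      refine t3.congr' ?_
      filter_upwards [nhdsWithin_le_nhds (isOpen_ne.mem_nhds hqp)] with w hw
      rw [hGne w hw]
      simp only [hg]
      ring
    · intro ε hε
      obtain ⟨T, hT⟩ := hdec (ε / 2) (by positivity)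
      have hlim : Tendsto (fun x : ℝ ↦ ‖r p‖ * (|R| * (x ^ 2)⁻¹)) atTop (𝓝 0) := by
        have : Tendsto (fun x : ℝ ↦ (x ^ 2)⁻¹) atTop (𝓝 0) :=
          tendsto_inv_atTop_zero.comp (tendsto_pow_atTop two_ne_zero)
        simpa using (this.const_mul |R|).const_mul ‖r p‖
      obtain ⟨S, hS⟩ := ((hlim.eventually (eventually_le_nhds (by positivity : 0 < ε / 2))).and
        (eventually_gt_atTop 0)).exists_forall_of_atTop
      refine ⟨max T (S + |p.im|), fun z a b c ↦ ?_⟩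
      have hz1 : S ≤ |(z - p).im| := by
        have h3 : |z.im| - |p.im| ≤ |z.im - p.im| := abs_sub_abs_le_abs_sub _ _
        have : S + |p.im| ≤ |z.im| := (le_max_right _ _).trans c
        rw [sub_im]
        linarith
      have hS2 := hS _ hz1
      have hne : (z - p).im ≠ 0 := abs_pos.mp hS2.2
      rw [hGne z (fun h ↦ hne (by simp [h]))]
      simp only [hg]
      refine (norm_sub_le _ _).trans ?_
      have e1 := hT z a b ((le_max_left _ _).trans c)
      have e2 := norm_simplePole_le (R := R) hne
      rw [norm_mul]
      have e3 := hS2.1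
      rw [sq_abs] at e3
      have : ‖r p‖ * ‖simplePole R (z - p)‖ ≤ ‖r p‖ * (|R| * ((z - p).im ^ 2)⁻¹) := by gcongr
      linarith

end QuadLambert

/-! ### The Mellin-Barnes kernel -/

namespace QuadLambert

open Complex MeasureTheory

theorem norm_cos_add_mul_I_sq (x y : ℝ) :
    ‖cos (x + y * I)‖ ^ 2 = Real.cos x ^ 2 + Real.sinh y ^ 2 := by
  rw [cos_add_mul_I, ← normSq_eq_norm_sq, normSq_apply]
  simp only [sub_re, sub_im, mul_re, mul_im, I_re, I_im, ← ofReal_cos, ← ofReal_sin,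
    ← ofReal_cosh, ← ofReal_sinh, ofReal_re, ofReal_im]
  have h1 := Real.cosh_sq y
  have h2 := Real.sin_sq_add_cos_sq x
  linear_combination Real.cos x ^ 2 * h1 + Real.sinh y ^ 2 * h2

theorem norm_sin_add_mul_I_sq (x y : ℝ) :
    ‖sin (x + y * I)‖ ^ 2 = Real.sin x ^ 2 + Real.sinh y ^ 2 := by
  have h : sin (x + y * I : ℂ) = cos (((x - Real.pi / 2 : ℝ) : ℂ) + y * I) := by
    rw [show (((x - Real.pi / 2 : ℝ) : ℂ) + y * I) = (x + y * I) - Real.pi / 2 by push_cast; ring,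
      cos_sub_pi_div_two]
  rw [h, norm_cos_add_mul_I_sq, Real.cos_sub_pi_div_two]

theorem exp_abs_le_two_mul_cosh (y : ℝ) : Real.exp |y| ≤ 2 * Real.cosh y := by
  rw [← Real.cosh_abs, Real.cosh_eq]
  have := Real.exp_pos (-|y|)
  linarith

theorem mul_exp_le_norm_cos (x y : ℝ) :
    |Real.cos x| * Real.exp |y| / 2 ≤ ‖cos (x + y * I)‖ := by
  refine le_of_sq_le_sq ?_ (norm_nonneg _)
  rw [norm_cos_add_mul_I_sq]
  have h1 := exp_abs_le_two_mul_cosh y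
  have h2 := Real.cosh_sq y
  have h3 := Real.cos_sq_le_one x
  calc (|Real.cos x| * Real.exp |y| / 2) ^ 2 ≤ (|Real.cos x| * (2 * Real.cosh y) / 2) ^ 2 := by
        gcongr
    _ = Real.cos x ^ 2 * Real.cosh y ^ 2 := by
        rw [mul_div_assoc, mul_pow, sq_abs]; ring
    _ ≤ _ := by rw [h2]; nlinarith [sq_nonneg (Real.sinh y)]

theorem mul_exp_le_norm_sin (x y : ℝ) :
    |Real.sin x| * Real.exp |y| / 2 ≤ ‖sin (x + y * I)‖ := by
  have h : sin (x + y * I : ℂ) = cos (((x - Real.pi / 2 : ℝ) : ℂ) + y * I) := by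
    rw [show (((x - Real.pi / 2 : ℝ) : ℂ) + y * I) = (x + y * I) - Real.pi / 2 by push_cast; ring,
      cos_sub_pi_div_two]
  rw [h, ← Real.cos_sub_pi_div_two]
  exact mul_exp_le_norm_cos _ _

theorem exp_abs_le_four_mul_abs_sinh {y : ℝ} (hy : 1 ≤ |y|) :
    Real.exp |y| / 4 ≤ |Real.sinh y| := by
  rw [Real.abs_sinh, Real.sinh_eq]
  have h1 : Real.exp (-|y|) ≤ 1 := Real.exp_le_one_iff.mpr (by linarith)
  have h2 : 2 ≤ Real.exp |y| := by
    have := Real.add_one_le_exp |y|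
    linarith
  linarith

theorem exp_le_norm_cos {x y : ℝ} (hy : 1 ≤ |y|) : Real.exp |y| / 4 ≤ ‖cos (x + y * I)‖ := by
  refine (exp_abs_le_four_mul_abs_sinh hy).trans ?_
  refine abs_le_of_sq_le_sq ?_ (norm_nonneg _)
  rw [norm_cos_add_mul_I_sq]
  nlinarith [sq_nonneg (Real.cos x)]

theorem exp_le_norm_sin {x y : ℝ} (hy : 1 ≤ |y|) : Real.exp |y| / 4 ≤ ‖sin (x + y * I)‖ := by
  refine (exp_abs_le_four_mul_abs_sinh hy).trans ?_
  refine abs_le_of_sq_le_sq ?_ (norm_nonneg _)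
  rw [norm_sin_add_mul_I_sq]
  nlinarith [sq_nonneg (Real.sin x)]

theorem norm_sin_le_exp (z : ℂ) : ‖sin z‖ ≤ Real.exp |z.im| := by
  have h := norm_sin_add_mul_I_sq z.re z.im
  rw [re_add_im] at h
  refine le_of_sq_le_sq ?_ (Real.exp_pos _).le
  have h1 := Real.cosh_sq z.im
  have h2 := Real.sin_sq_le_one z.re
  have h3 : Real.cosh z.im ≤ Real.exp |z.im| := by
    rw [← Real.cosh_abs, Real.cosh_eq]
    have : Real.exp (-|z.im|) ≤ Real.exp |z.im| := by
      gcongr; linarith [abs_nonneg z.im]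
    linarith
  have h4 := Real.one_le_cosh z.im
  nlinarith

theorem tendsto_pow_mul_exp_neg (m : ℕ) {δ : ℝ} (hδ : 0 < δ) :
    Tendsto (fun t : ℝ ↦ (1 + t) ^ m * Real.exp (-(δ * t))) atTop (𝓝 0) := by
  have h := (Real.tendsto_pow_mul_exp_neg_atTop_nhds_zero m).comp
    (tendsto_atTop_add_const_left atTop δ (tendsto_id.const_mul_atTop hδ))
  have h2 := (h.const_mul (Real.exp δ)).const_mul ((δ⁻¹) ^ m)
  simp only [mul_zero] at h2
  refine h2.congr fun t ↦ ?_
  simp only [Function.comp, id]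
  rw [show -(δ + δ * t) = -(δ * t) + -δ by ring, Real.exp_add, Real.exp_neg δ,
    show δ + δ * t = δ * (1 + t) by ring, mul_pow, inv_pow]
  field_simp

theorem integrable_pow_mul_exp_neg_abs (m : ℕ) {δ : ℝ} (hδ : 0 < δ) :
    Integrable fun t : ℝ ↦ (1 + |t|) ^ m * Real.exp (-(δ * |t|)) := by
  obtain ⟨T, hT⟩ := ((tendsto_pow_mul_exp_neg (m + 2) hδ).eventually
    (eventually_le_nhds one_pos)).exists_forall_of_atTop
  have hcont : Continuous fun t : ℝ ↦ (1 + |t|) ^ (m + 2) * Real.exp (-(δ * |t|)) := by fun_prop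
  obtain ⟨A, hA⟩ := (isCompact_Icc (a := -|T|) (b := |T|)).exists_bound_of_continuousOn
    hcont.continuousOn
  have hb : ∀ t : ℝ, (1 + |t|) ^ (m + 2) * Real.exp (-(δ * |t|)) ≤ |A| + 1 := by
    intro t
    by_cases ht : |t| ≤ |T|
    · have := hA t (abs_le.mp ht)
      have h2 := le_abs_self A
      have h3 := Real.le_norm_self ((1 + |t|) ^ (m + 2) * Real.exp (-(δ * |t|)))
      linarith
    · have := hT |t| ((le_abs_self T).trans (not_le.mp ht).le)
      linarith [abs_nonneg A]
  refine Integrable.mono' (integrable_inv_one_add_sq.const_mul (|A| + 1))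
    (by fun_prop) (Eventually.of_forall fun t ↦ ?_)
  rw [Real.norm_of_nonneg (by positivity)]
  calc (1 + |t|) ^ m * Real.exp (-(δ * |t|))
      = ((1 + |t|) ^ (m + 2) * Real.exp (-(δ * |t|))) * ((1 + |t|) ^ 2)⁻¹ := by
        field_simp; ring
    _ ≤ (|A| + 1) * (1 + t ^ 2)⁻¹ := by
        gcongr
        · exact hb t
        · nlinarith [abs_nonneg t, sq_abs t]

theorem exists_norm_le_of_pow_mul_exp_bound {f : ℂ → ℂ} {σ₁ σ₂ C δ T₀ : ℝ} {m : ℕ} (hδ : 0 < δ)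
    (hf : ∀ z : ℂ, σ₁ ≤ z.re → z.re ≤ σ₂ → T₀ ≤ |z.im| →
      ‖f z‖ ≤ C * ((1 + |z.im|) ^ m * Real.exp (-(δ * |z.im|)))) :
    ∀ ε > 0, ∃ T : ℝ, ∀ z : ℂ, σ₁ ≤ z.re → z.re ≤ σ₂ → T ≤ |z.im| → ‖f z‖ ≤ ε := by
  intro ε hε
  have h := (tendsto_pow_mul_exp_neg m hδ).const_mul C
  rw [mul_zero] at h
  obtain ⟨T, hT⟩ := (h.eventually (eventually_le_nhds hε)).exists_forall_of_atTop
  exact ⟨max T T₀, fun z a b c ↦ (hf z a b ((le_max_right _ _).trans c)).trans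
    (hT _ ((le_max_left _ _).trans c))⟩

theorem norm_cpow_le {ω : ℂ} (hω : ω ≠ 0) (s : ℂ) :
    ‖ω ^ s‖ ≤ ‖ω‖ ^ s.re * Real.exp (|ω.arg| * |s.im|) := by
  rw [norm_cpow_of_ne_zero hω, div_eq_mul_inv, ← Real.exp_neg]
  gcongr
  rw [← abs_mul]
  exact neg_le_abs _

/-- The residue of `1 / g` at a simple zero of `g`, to be applied to the cosine and the sine in the
kernel. -/
theorem tendsto_sub_mul_inv {g : ℂ → ℂ} {g' p : ℂ} (hg : HasDerivAt g g' p) (h0 : g p = 0)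
    (h1 : g' ≠ 0) : Tendsto (fun z ↦ (z - p) * (g z)⁻¹) (𝓝[≠] p) (𝓝 g'⁻¹) := by
  have h := (hasDerivAt_iff_tendsto_slope.mp hg).inv₀ h1
  refine h.congr fun z ↦ ?_
  rw [slope_def_field, h0, sub_zero, inv_div, div_eq_mul_inv]

end QuadLambert

/-! ### Growth, poles and residues of the Mellin–Barnes kernel -/

namespace QuadLambert

open Complex MeasureTheory

theorem cos_natCast_mul_pi (k : ℕ) : cos (k * Real.pi) = (-1) ^ k := by
  rw [← ofReal_natCast, ← ofReal_mul, ← ofReal_cos, Real.cos_nat_mul_pi]; simp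

theorem sin_add_natCast_mul_pi (x : ℂ) (k : ℕ) : sin (x + k * Real.pi) = (-1) ^ k * sin x := by
  rw [sin_add, cos_natCast_mul_pi, sin_nat_mul_pi]; ring

/-- The reflection formula solved for `1 / Γ`. It survives at the poles of `Γ`, where `Gamma` has
the default value `0` and the sine vanishes too. -/
theorem inv_Gamma_eq {w : ℂ} (hw : w.re < 1) :
    (Gamma w)⁻¹ = Gamma (1 - w) * sin (Real.pi * w) / Real.pi := by
  have h := Gamma_mul_Gamma_one_sub w
  have hπ : (Real.pi : ℂ) ≠ 0 := ofReal_ne_zero.mpr Real.pi_ne_zero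
  have h1 : Gamma (1 - w) ≠ 0 := Gamma_ne_zero_of_re_pos (by simpa using hw)
  by_cases hs : sin (Real.pi * w) = 0
  · rw [hs, div_zero, mul_eq_zero] at h
    rw [hs, h.resolve_right h1]
    simp
  · have hG : Gamma w ≠ 0 := fun h0 ↦ by
      rw [h0, zero_mul] at h
      exact div_ne_zero hπ hs h.symm
    rw [eq_div_iff hs] at h
    refine inv_eq_of_mul_eq_one_right ?_
    rw [mul_div_assoc', ← mul_assoc, h, div_self hπ]

/-- By reflection the quotient is `Γ(1 - w)² sin(πw) / π`, in which the decay `exp(-π|Im w|)` of the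
square cancels the growth of the sine. Only a power of `|Im w|` remains, so the decay of the kernel
has to come from the cosine. -/
theorem exists_norm_Gamma_quot_le (σ₁ : ℝ) {σ₂ : ℝ} (hσ₂ : σ₂ < 1) :
    ∃ C : ℝ, 0 ≤ C ∧ ∃ m : ℕ, ∀ w : ℂ, σ₁ ≤ w.re → w.re ≤ σ₂ →
      ‖Gamma (1 - w) * (Gamma w)⁻¹‖ ≤ C * (1 + |w.im|) ^ m := by
  obtain ⟨C, hC, m, h⟩ := exists_norm_Gamma_le (σ₁ := 1 - σ₂) (by linarith) (1 - σ₁)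
  refine ⟨C ^ 2, by positivity, 2 * m, fun w h1 h2 ↦ ?_⟩
  have hG := h (1 - w) (by simp; linarith) (by simp; linarith)
  simp only [sub_im, one_im, zero_sub, abs_neg] at hG
  have hs := norm_sin_le_exp (Real.pi * w)
  rw [show ((Real.pi : ℂ) * w).im = Real.pi * w.im by simp, abs_mul, abs_of_pos Real.pi_pos] at hs
  rw [inv_Gamma_eq (by linarith)]
  rw [norm_mul, norm_div, norm_mul, norm_real, Real.norm_of_nonneg Real.pi_pos.le]
  have hπ : (1 : ℝ) ≤ Real.pi := by linarith [Real.pi_gt_three]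
  calc ‖Gamma (1 - w)‖ * (‖Gamma (1 - w)‖ * ‖sin (Real.pi * w)‖ / Real.pi)
      ≤ ‖Gamma (1 - w)‖ * (‖Gamma (1 - w)‖ * ‖sin (Real.pi * w)‖) := by
        gcongr
        exact div_le_self (by positivity) hπ
    _ ≤ (C * (1 + |w.im|) ^ m * Real.exp (-(Real.pi / 2 * |w.im|))) *
        ((C * (1 + |w.im|) ^ m * Real.exp (-(Real.pi / 2 * |w.im|))) *
          Real.exp (Real.pi * |w.im|)) := by gcongr
    _ = (C * (1 + |w.im|) ^ m) ^ 2 * (Real.exp (-(Real.pi / 2 * |w.im|)) *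
        Real.exp (-(Real.pi / 2 * |w.im|)) * Real.exp (Real.pi * |w.im|)) := by ring
    _ = _ := by
        rw [← Real.exp_add, ← Real.exp_add, mul_pow, ← pow_mul, mul_comm m 2]
        rw [show -(Real.pi / 2 * |w.im|) + -(Real.pi / 2 * |w.im|) + Real.pi * |w.im| = 0 by ring]
        simp

/-- The integrand of the Mellin-Barnes integral for the kernel of the transformed series. -/
noncomputable def barnesKernel (a ω s : ℂ) : ℂ :=
  ω ^ s * (Gamma (1 - (s - a)) * (Gamma (s - a))⁻¹) * (2 * cos (Real.pi * s / 2))⁻¹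

theorem norm_inv_cos_line_le {c : ℝ} (h0 : Real.cos (Real.pi * c / 2) ≠ 0) (t : ℝ) :
    ‖(2 * cos (Real.pi * (c + t * I) / 2))⁻¹‖ ≤
      |Real.cos (Real.pi * c / 2)|⁻¹ * Real.exp (-(Real.pi / 2 * |t|)) := by
  have h := mul_exp_le_norm_cos (Real.pi * c / 2) (Real.pi / 2 * t)
  rw [show (((Real.pi * c / 2 : ℝ) : ℂ) + ((Real.pi / 2 * t : ℝ) : ℂ) * I) =
    Real.pi * (c + t * I) / 2 by push_cast; ring, abs_mul, abs_of_pos (half_pos Real.pi_pos)] at h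
  have hp : 0 < |Real.cos (Real.pi * c / 2)| := abs_pos.mpr h0
  rw [norm_inv, norm_mul, norm_ofNat, Real.exp_neg, ← mul_inv]
  refine inv_anti₀ (by positivity) ?_
  linarith

/-- Bound for the Mellin-Barnes integrand on a vertical line, uniform in `a`. -/
theorem exists_norm_barnesKernel_le {c : ℝ} (hc : -1 < c) (hc0 : c < 0) {A₁ : ℝ} (hA : c < A₁)
    (A₂ A₃ : ℝ) :
    ∃ C : ℝ, 0 ≤ C ∧ ∃ m : ℕ, ∀ a : ℂ, A₁ ≤ a.re → a.re ≤ A₂ → |a.im| ≤ A₃ →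
      ∀ ω : ℂ, ω ≠ 0 → ∀ t : ℝ, ‖barnesKernel a ω (c + t * I)‖ ≤
        C * ‖ω‖ ^ c * ((1 + |t|) ^ m * Real.exp (-((Real.pi / 2 - |ω.arg|) * |t|))) := by
  obtain ⟨C, hC, m, h⟩ := exists_norm_Gamma_quot_le (c - A₂) (σ₂ := c - A₁) (by linarith)
  refine ⟨C * (1 + |A₃|) ^ m * |Real.cos (Real.pi * c / 2)|⁻¹, by positivity, m,
    fun a h1 h2 h3 ω hω t ↦ ?_⟩
  have e1 := norm_cpow_le hω (c + t * I)
  simp only [add_re, ofReal_re, mul_re, I_re, mul_zero, ofReal_im, I_im, mul_one, sub_self,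
    add_zero, add_im, mul_im, zero_add] at e1
  have e2 := h (c + t * I - a) (by simp; linarith) (by simp; linarith)
  have e3 : (1 + |((c : ℂ) + t * I - a).im|) ≤ (1 + |A₃|) * (1 + |t|) := by
    have : |((c : ℂ) + t * I - a).im| ≤ |t| + |a.im| := by simpa using abs_sub t a.im
    have h4 := h3.trans (le_abs_self A₃)
    nlinarith [abs_nonneg t, abs_nonneg A₃]
  have hcos : Real.cos (Real.pi * c / 2) ≠ 0 :=
    (Real.cos_pos_of_mem_Ioo ⟨by nlinarith [Real.pi_pos], by nlinarith [Real.pi_pos]⟩).ne'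
  have e4 := norm_inv_cos_line_le hcos t
  rw [barnesKernel, norm_mul, norm_mul]
  calc _ ≤ (‖ω‖ ^ c * Real.exp (|ω.arg| * |t|)) * (C * ((1 + |A₃|) * (1 + |t|)) ^ m) *
        (|Real.cos (Real.pi * c / 2)|⁻¹ * Real.exp (-(Real.pi / 2 * |t|))) := by
        gcongr
        exact e2.trans (by gcongr)
    _ = C * (1 + |A₃|) ^ m * |Real.cos (Real.pi * c / 2)|⁻¹ * ‖ω‖ ^ c * ((1 + |t|) ^ m *
        (Real.exp (|ω.arg| * |t|) * Real.exp (-(Real.pi / 2 * |t|)))) := by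
        rw [mul_pow]; ring
    _ = _ := by
        rw [← Real.exp_add]; congr 4; ring

theorem cos_pi_mul_half_ne_zero {s : ℂ} (h : ∀ k : ℤ, s ≠ 2 * k + 1) :
    cos (Real.pi * s / 2) ≠ 0 := by
  rw [cos_ne_zero_iff]
  intro k hk
  apply h k
  have : (Real.pi : ℂ) ≠ 0 := ofReal_ne_zero.mpr Real.pi_ne_zero
  field_simp at hk
  linear_combination hk

theorem differentiableAt_barnesKernel {a ω s : ℂ} (hω : ω ≠ 0) (h : ∀ k : ℤ, s ≠ 2 * k + 1)
    (h' : ∀ j : ℕ, s ≠ a + 1 + j) : DifferentiableAt ℂ (barnesKernel a ω) s := by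
  have h1 : DifferentiableAt ℂ (fun s : ℂ ↦ Gamma (1 - (s - a))) s :=
    (differentiableAt_Gamma _ fun j hj ↦ h' j (by linear_combination -hj)).comp s (by fun_prop)
  have h2 : DifferentiableAt ℂ (fun s : ℂ ↦ (Gamma (s - a))⁻¹) s :=
    (differentiable_one_div_Gamma (s - a)).comp s (f := fun s ↦ s - a) (by fun_prop)
  have h3 : DifferentiableAt ℂ (fun s : ℂ ↦ (2 * cos (Real.pi * s / 2))⁻¹) s :=
    DifferentiableAt.inv (by fun_prop) (mul_ne_zero two_ne_zero (cos_pi_mul_half_ne_zero h))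
  have h4 : DifferentiableAt ℂ (fun s : ℂ ↦ ω ^ s) s :=
    differentiableAt_id.const_cpow (Or.inl hω)
  exact (h4.mul (h1.mul h2)).mul h3

/-- Reflection again: the factor `1 / Γ(s - a)²` gives the decay far to the right, and the sine
displays the poles at `a + 1 + j`. -/
theorem barnesKernel_eq {a s : ℂ} (ω : ℂ) (h : Gamma (s - a) ≠ 0) :
    barnesKernel a ω s = ω ^ s * Real.pi * ((Gamma (s - a))⁻¹) ^ 2 *
      (2 * cos (Real.pi * s / 2))⁻¹ * (sin (Real.pi * (s - a)))⁻¹ := by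
  have h1 := Gamma_mul_Gamma_one_sub (s - a)
  have h2 : Gamma (1 - (s - a)) = Real.pi * (sin (Real.pi * (s - a)))⁻¹ * (Gamma (s - a))⁻¹ := by
    rw [← div_eq_mul_inv (Real.pi : ℂ), ← h1]; field_simp
  rw [barnesKernel, h2]; ring

theorem continuous_barnesKernel_line {a ω : ℂ} {c : ℝ} (hω : ω ≠ 0) (hc : -1 < c) (hc0 : c < 0)
    (hca : c < a.re) : Continuous fun t : ℝ ↦ barnesKernel a ω (c + t * I) := by
  rw [continuous_iff_continuousAt]
  intro t
  have hd : DifferentiableAt ℂ (barnesKernel a ω) (c + t * I) := by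
    refine differentiableAt_barnesKernel hω (fun k hk ↦ ?_) fun j hj ↦ ?_
    · have := congrArg re hk
      simp at this
      have h1 : (-1 : ℝ) < 2 * k + 1 := by linarith
      have h2 : (2 * k + 1 : ℝ) < 0 := by linarith
      have h1' : -1 < 2 * k + 1 := by exact_mod_cast h1
      have h2' : 2 * k + 1 < 0 := by exact_mod_cast h2
      omega
    · have := congrArg re hj
      simp at this
      have : (0 : ℝ) ≤ j := j.cast_nonneg
      linarith
  exact ContinuousAt.comp (f := fun t : ℝ ↦ (c : ℂ) + t * I) hd.continuousAt (by fun_prop)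

theorem abs_arg_lt {ω : ℂ} (hω : 0 < ω.re) : 0 < Real.pi / 2 - |ω.arg| := by
  have := abs_arg_lt_pi_div_two_iff.mpr (Or.inl hω)
  linarith

theorem integrable_barnesKernel_line {a ω : ℂ} {c : ℝ} (hω : 0 < ω.re) (hc : -1 < c) (hc0 : c < 0)
    (hca : c < a.re) : Integrable fun t : ℝ ↦ barnesKernel a ω (c + t * I) := by
  have hω0 : ω ≠ 0 := fun h ↦ by simp [h] at hω
  obtain ⟨C, hC, m, h⟩ := exists_norm_barnesKernel_le hc hc0 hca a.re |a.im|
  exact Integrable.mono' ((integrable_pow_mul_exp_neg_abs m (abs_arg_lt hω)).const_mul _)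
    (continuous_barnesKernel_line hω0 hc hc0 hca).aestronglyMeasurable
    (Eventually.of_forall fun t ↦ h a le_rfl le_rfl le_rfl ω hω0 t)

/-- The cosine has a simple zero at `2k + 1`, while `a ∉ ℤ` keeps `Γ(1 - (s - a))` regular there.
Reflection turns the Gamma quotient into `1 / Γ²` and produces the `sin(πa)`. -/
theorem tendsto_barnesKernel_residue_odd {a ω : ℂ} (hω : ω ≠ 0) (ha : ∀ n : ℤ, a ≠ n) (k : ℕ) :
    Tendsto (fun z ↦ (z - (2 * k + 1)) * barnesKernel a ω z) (𝓝[≠] (2 * k + 1 : ℂ))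
      (𝓝 (-(ω * ((-1) ^ k * ω ^ (2 * k) * ((Gamma (1 - a + 2 * k))⁻¹) ^ 2)) /
        sin (Real.pi * a))) := by
  have hπ : (Real.pi : ℂ) ≠ 0 := ofReal_ne_zero.mpr Real.pi_ne_zero
  set p : ℂ := 2 * k + 1 with hp
  have hcosk : cos (k * Real.pi) = (-1) ^ k := cos_natCast_mul_pi k
  have harg : (Real.pi * p / 2 : ℂ) = k * Real.pi + Real.pi / 2 := by rw [hp]; ring
  have hd : HasDerivAt (fun z : ℂ ↦ 2 * cos (Real.pi * z / 2)) (-(Real.pi * (-1) ^ k)) p := by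
    have h1 : HasDerivAt (fun z : ℂ ↦ Real.pi * z / 2) (Real.pi / 2) p := by
      simpa using ((hasDerivAt_id p).const_mul (Real.pi : ℂ)).div_const 2
    have h2 := (h1.ccos).const_mul (2 : ℂ)
    rw [harg, sin_add_pi_div_two, hcosk] at h2
    convert! h2 using 1
    ring
  have h0 : 2 * cos (Real.pi * p / 2) = 0 := by
    rw [harg, cos_add_pi_div_two, sin_nat_mul_pi]; simp
  have ht := tendsto_sub_mul_inv hd h0 (neg_ne_zero.mpr (mul_ne_zero hπ (pow_ne_zero _ (by simp))))
  have hF : ContinuousAt (fun z : ℂ ↦ ω ^ z * (Gamma (1 - (z - a)) * (Gamma (z - a))⁻¹)) p := by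
    have h1 : DifferentiableAt ℂ (fun s : ℂ ↦ Gamma (1 - (s - a))) p :=
      (differentiableAt_Gamma _ fun j hj ↦ ha (2 * k - j) (by
        push_cast; rw [hp] at hj; linear_combination hj)).comp p (by fun_prop)
    have h2 : DifferentiableAt ℂ (fun s : ℂ ↦ (Gamma (s - a))⁻¹) p :=
      (differentiable_one_div_Gamma (p - a)).comp p (f := fun s ↦ s - a) (by fun_prop)
    have h4 : DifferentiableAt ℂ (fun s : ℂ ↦ ω ^ s) p :=
      differentiableAt_id.const_cpow (Or.inl hω)
    exact (h4.mul (h1.mul h2)).continuousAt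
  have := (hF.tendsto.mono_left (nhdsWithin_le_nhds (s := {p}ᶜ))).mul ht
  have hval : -(ω * ((-1) ^ k * ω ^ (2 * k) * ((Gamma (1 - a + 2 * k))⁻¹) ^ 2)) /
        sin (Real.pi * a) =
      ω ^ p * (Gamma (1 - (p - a)) * (Gamma (p - a))⁻¹) * (-((Real.pi : ℂ) * (-1) ^ k))⁻¹ := by
    have hpw : ω ^ p = ω * ω ^ (2 * k) := by
      rw [hp, show (2 * k + 1 : ℂ) = ((2 * k + 1 : ℕ) : ℂ) by push_cast; ring, cpow_natCast,
        pow_succ]; ring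
    have hGne : Gamma (p - a) ≠ 0 := Gamma_ne_zero fun m hm ↦ ha (2 * k + 1 + m) (by
      push_cast; rw [hp] at hm; linear_combination -hm)
    have hsin : sin (Real.pi * (p - a)) = sin (Real.pi * a) := by
      rw [hp, show (Real.pi * (2 * k + 1 - a) : ℂ) = (Real.pi - Real.pi * a) + k * (2 * Real.pi)
        by ring, sin_add_nat_mul_two_pi, sin_pi_sub]
    have hG := Gamma_mul_Gamma_one_sub (p - a)
    rw [hsin] at hG
    have hG2 : Gamma (1 - (p - a)) = Real.pi / sin (Real.pi * a) * (Gamma (p - a))⁻¹ := by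
      rw [← hG]; field_simp
    rw [hG2, hpw, show (1 - a + 2 * k : ℂ) = p - a by rw [hp]; ring]
    have hone : ((-1 : ℂ) ^ k) * (-1) ^ k = 1 := by rw [← mul_pow]; simp
    have hinv : (-(Real.pi * (-1 : ℂ) ^ k))⁻¹ = -(-1) ^ k * (Real.pi : ℂ)⁻¹ := by
      rw [inv_eq_iff_eq_inv]
      refine eq_inv_of_mul_eq_one_left ?_
      field_simp
      linear_combination hone
    rw [hinv]
    field_simp
  rw [hval]
  refine this.congr fun z ↦ ?_
  rw [barnesKernel]; ring

/-- Here the pole is that of `Γ(1 - (s - a))`, and the cosine is nonzero because `a ∉ ℤ`. The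
duplication `sin(πa) = ±2 sin(π(a+j)/2) cos(π(a+j)/2)` brings the factor `1 / cos(πp/2)` over the
same denominator `sin(πa)` as the other family. -/
theorem tendsto_barnesKernel_residue_shift {a ω : ℂ} (hω : ω ≠ 0) (ha : ∀ n : ℤ, a ≠ n) (j : ℕ) :
    Tendsto (fun z ↦ (z - (a + 1 + j)) * barnesKernel a ω z) (𝓝[≠] (a + 1 + j : ℂ))
      (𝓝 (ω * ω ^ a * (ω ^ j * cos (Real.pi * (a + j) / 2) / (j.factorial : ℂ) ^ 2) /
        sin (Real.pi * a))) := by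
  have hπ : (Real.pi : ℂ) ≠ 0 := ofReal_ne_zero.mpr Real.pi_ne_zero
  set p : ℂ := a + 1 + j with hp
  have hpa : p - a = j + 1 := by rw [hp]; ring
  have hsgn : cos (Real.pi * (p - a)) = -(-1) ^ j := by
    rw [hpa, show (Real.pi * (j + 1) : ℂ) = j * Real.pi + Real.pi by ring, cos_add_pi,
      cos_natCast_mul_pi]
  have hd : HasDerivAt (fun z : ℂ ↦ sin (Real.pi * (z - a))) (-(Real.pi * (-1) ^ j)) p := by
    have h1 : HasDerivAt (fun z : ℂ ↦ Real.pi * (z - a)) Real.pi p := by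
      simpa using ((hasDerivAt_id p).sub_const a).const_mul (Real.pi : ℂ)
    have h2 := h1.csin
    rw [hsgn] at h2
    convert! h2 using 1
    ring
  have h0 : sin (Real.pi * (p - a)) = 0 := by
    rw [hpa, show (Real.pi * (j + 1) : ℂ) = ((j + 1 : ℕ) : ℂ) * Real.pi by push_cast; ring,
      sin_nat_mul_pi]
  have hone : ((-1 : ℂ) ^ j) * (-1) ^ j = 1 := by rw [← mul_pow]; simp
  have ht := tendsto_sub_mul_inv hd h0 (neg_ne_zero.mpr (mul_ne_zero hπ (pow_ne_zero _ (by simp))))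
  have hcos : cos (Real.pi * p / 2) ≠ 0 := cos_pi_mul_half_ne_zero fun k hk ↦
    ha (2 * k - j) (by push_cast; rw [hp] at hk; linear_combination hk)
  have hΓ : ContinuousAt (fun z ↦ (Gamma (z - a))⁻¹) p :=
    ((differentiable_one_div_Gamma (p - a)).comp p (f := fun s ↦ s - a)
      (by fun_prop)).continuousAt
  have hF : ContinuousAt (fun z : ℂ ↦ ω ^ z * Real.pi * ((Gamma (z - a))⁻¹) ^ 2 *
      (2 * cos (Real.pi * z / 2))⁻¹) p := by
    have h4 : ContinuousAt (fun s : ℂ ↦ ω ^ s) p :=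
      (differentiableAt_id.const_cpow (Or.inl hω)).continuousAt
    have h3 : ContinuousAt (fun s : ℂ ↦ (2 * cos (Real.pi * s / 2))⁻¹) p :=
      ContinuousAt.inv₀ (by fun_prop) (mul_ne_zero two_ne_zero hcos)
    exact ((h4.mul continuousAt_const).mul (hΓ.pow 2)).mul h3
  have hGp : Gamma (p - a) = (j.factorial : ℂ) := by rw [hpa, Gamma_nat_eq_factorial]
  have hfac : (j.factorial : ℂ) ≠ 0 := Nat.cast_ne_zero.mpr j.factorial_ne_zero
  have := (hF.tendsto.mono_left (nhdsWithin_le_nhds (s := {p}ᶜ))).mul ht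
  have hval : ω * ω ^ a * (ω ^ j * cos (Real.pi * (a + j) / 2) / (j.factorial : ℂ) ^ 2) /
        sin (Real.pi * a) =
      ω ^ p * Real.pi * ((Gamma (p - a))⁻¹) ^ 2 * (2 * cos (Real.pi * p / 2))⁻¹ *
        (-((Real.pi : ℂ) * (-1) ^ j))⁻¹ := by
    have hpw : ω ^ p = ω * ω ^ a * ω ^ j := by
      rw [hp, cpow_add _ _ hω, cpow_add _ _ hω, cpow_natCast, cpow_one]; ring
    have hcp : cos (Real.pi * p / 2) = -sin (Real.pi * (a + j) / 2) := by
      rw [hp, show (Real.pi * (a + 1 + j) / 2 : ℂ) = Real.pi * (a + j) / 2 + Real.pi / 2 by ring,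
        cos_add_pi_div_two]
    have hs2 : sin (Real.pi * a) =
        (-1) ^ j * (2 * sin (Real.pi * (a + j) / 2) * cos (Real.pi * (a + j) / 2)) := by
      rw [← sin_two_mul, show (2 * (Real.pi * (a + j) / 2) : ℂ) = Real.pi * a + j * Real.pi by
        ring, sin_add_natCast_mul_pi]
      linear_combination -sin (Real.pi * a) * hone
    have hsa : sin (Real.pi * a) ≠ 0 := by
      rw [sin_ne_zero_iff]
      intro n hn
      exact ha n (mul_left_cancel₀ hπ (by rw [hn]; ring))
    rw [hcp] at hcos ⊢
    have hsne : sin (Real.pi * (a + j) / 2) ≠ 0 := neg_ne_zero.mp hcos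
    have hcne : cos (Real.pi * (a + j) / 2) ≠ 0 := fun h ↦ hsa (by rw [hs2, h]; ring)
    have hj1 : ((-1 : ℂ) ^ j) ≠ 0 := pow_ne_zero _ (by simp)
    rw [hs2, hGp, hpw]
    field_simp
  rw [hval]
  refine this.congr' ?_
  have hev : ∀ᶠ z in 𝓝[≠] p, (Gamma (z - a))⁻¹ ≠ 0 :=
    (hΓ.eventually_ne (by rw [hGp]; exact inv_ne_zero hfac)).filter_mono nhdsWithin_le_nhds
  filter_upwards [hev] with z hz
  rw [barnesKernel_eq ω fun h0 ↦ hz (by simp [h0])]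
  ring

end QuadLambert

/-! ### Convergence of the residue series and bounds for moving the contour -/

namespace QuadLambert

open Complex MeasureTheory

theorem summable_pow_mul_inv_Gamma_sq (ω : ℂ) {b : ℂ} (hb : ∀ n : ℤ, b ≠ n) :
    Summable fun k : ℕ ↦ (-1) ^ k * ω ^ (2 * k) * ((Gamma (b + 2 * k))⁻¹) ^ 2 := by
  by_cases hω : ω = 0
  · refine summable_of_ne_finset_zero (s := {0}) fun k hk ↦ ?_
    have : 2 * k ≠ 0 := by simpa using hk
    simp [hω, this]
  have hne : ∀ k : ℕ, Gamma (b + 2 * k) ≠ 0 := fun k ↦ Gamma_ne_zero fun m hm ↦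
    hb (-m - 2 * k) (by push_cast; linear_combination hm)
  have hb0 : ∀ k : ℕ, b + k ≠ 0 := fun k h ↦ hb (-k) (by push_cast; linear_combination h)
  refine summable_of_ratio_test_tendsto_lt_one (l := 0) one_pos
    (Eventually.of_forall fun k ↦ ?_) ?_
  · exact mul_ne_zero (mul_ne_zero (pow_ne_zero _ (by simp)) (pow_ne_zero _ hω))
      (pow_ne_zero _ (inv_ne_zero (hne k)))
  · have hlim : Tendsto (fun k : ℕ ↦ ‖ω‖ ^ 2 * ((‖b + (2 * k : ℕ)‖⁻¹) *
        (‖b + (2 * k + 1 : ℕ)‖⁻¹)) ^ 2) atTop (𝓝 0) := by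
      have h1 : Tendsto (fun k : ℕ ↦ ‖b + (k : ℕ)‖⁻¹) atTop (𝓝 0) := by
        refine tendsto_inv_atTop_zero.comp ?_
        refine tendsto_atTop_mono (f := fun k : ℕ ↦ (k : ℝ) - ‖b‖) (fun k ↦ ?_)
          (tendsto_atTop_add_const_right _ _ tendsto_natCast_atTop_atTop)
        have h2 := norm_sub_le (b + k) b
        rw [show b + (k : ℂ) - b = k by ring, Complex.norm_natCast] at h2
        linarith
      have h2 : Tendsto (fun k : ℕ ↦ ‖b + (2 * k : ℕ)‖⁻¹) atTop (𝓝 0) :=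
        h1.comp (tendsto_atTop_mono (fun k : ℕ ↦ (by omega : k ≤ 2 * k)) tendsto_id)
      have h3 : Tendsto (fun k : ℕ ↦ ‖b + (2 * k + 1 : ℕ)‖⁻¹) atTop (𝓝 0) :=
        h1.comp (tendsto_atTop_mono (fun k : ℕ ↦ (by omega : k ≤ 2 * k + 1)) tendsto_id)
      simpa using ((h2.mul h3).pow 2).const_mul (‖ω‖ ^ 2)
    refine hlim.congr fun k ↦ ?_
    have e : Gamma (b + 2 * (k + 1 : ℕ)) =
        (b + (2 * k + 1 : ℕ)) * ((b + (2 * k : ℕ)) * Gamma (b + 2 * k)) := by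
      rw [show b + 2 * (k + 1 : ℕ) = (b + (2 * k + 1 : ℕ)) + 1 by push_cast; ring,
        Gamma_add_one _ (hb0 _), show b + ((2 * k + 1 : ℕ) : ℂ) = (b + (2 * k : ℕ)) + 1 by
          push_cast; ring, Gamma_add_one _ (hb0 _)]
      push_cast
      ring
    rw [e]
    have p1 : ‖b + (2 * k : ℕ)‖ ≠ 0 := norm_ne_zero_iff.mpr (hb0 _)
    have p2 : ‖b + (2 * k + 1 : ℕ)‖ ≠ 0 := norm_ne_zero_iff.mpr (hb0 _)
    have p3 : ‖Gamma (b + 2 * k)‖ ≠ 0 := norm_ne_zero_iff.mpr (hne k)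
    have p4 : ‖ω‖ ≠ 0 := norm_ne_zero_iff.mpr hω
    simp only [norm_mul, norm_pow, norm_neg, norm_one, one_pow, one_mul, norm_inv]
    rw [show 2 * (k + 1) = 2 * k + 2 by ring, pow_add]
    field_simp

theorem norm_cos_le_exp (z : ℂ) : ‖cos z‖ ≤ Real.exp |z.im| := by
  rw [← sin_add_pi_div_two]
  refine (norm_sin_le_exp _).trans (le_of_eq ?_)
  have : (Real.pi / 2 : ℂ).im = 0 := by
    rw [show (Real.pi / 2 : ℂ) = ((Real.pi / 2 : ℝ) : ℂ) by push_cast; ring, ofReal_im]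
  rw [add_im, this, add_zero]

theorem summable_pow_mul_cos_div_factorial_sq (ω a : ℂ) :
    Summable fun j : ℕ ↦ ω ^ j * cos (Real.pi * (a + j) / 2) / (j.factorial : ℂ) ^ 2 := by
  refine Summable.of_norm_bounded
    (g := fun j : ℕ ↦ Real.exp |(Real.pi * a / 2).im| * (‖ω‖ ^ j / j.factorial))
    ((Real.summable_pow_div_factorial ‖ω‖).mul_left _) fun j ↦ ?_
  have h := norm_cos_le_exp (Real.pi * (a + j) / 2)
  have him : (Real.pi * (a + j) / 2 : ℂ).im = (Real.pi * a / 2 : ℂ).im := by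
    rw [show (Real.pi * (a + j) / 2 : ℂ) = Real.pi * a / 2 + ((Real.pi * j / 2 : ℝ) : ℂ) by
      push_cast; ring, add_im, ofReal_im, add_zero]
  rw [him] at h
  have hf : (1 : ℝ) ≤ j.factorial := by exact_mod_cast j.factorial_pos
  rw [norm_div, norm_mul, norm_pow, norm_pow, norm_natCast]
  calc ‖ω‖ ^ j * ‖cos (Real.pi * (a + j) / 2)‖ / (j.factorial : ℝ) ^ 2
      ≤ ‖ω‖ ^ j * Real.exp |(Real.pi * a / 2 : ℂ).im| / (j.factorial : ℝ) ^ 2 := by gcongr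
    _ ≤ ‖ω‖ ^ j * Real.exp |(Real.pi * a / 2 : ℂ).im| / (j.factorial : ℝ) := by
        gcongr
        nlinarith
    _ = _ := by ring

/-- A shift by the even integer `2L` changes neither `|cos(πc/2)|` nor `sin(π(c - Re a))`. The
growth `exp(π|t - Im a|)` of the bound for `1 / Γ²` is cancelled by `1 / sin`. So `L` enters only
through `‖ω‖^(2L) / Γ(c - Re a + 2L)²`. -/
theorem norm_barnesKernel_far_line_le {a ω : ℂ} {c : ℝ} (hω : ω ≠ 0)
    (hcos : Real.cos (Real.pi * c / 2) ≠ 0) (hsin : Real.sin (Real.pi * (c - a.re)) ≠ 0) (L : ℕ)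
    (hL : 1 / 2 ≤ c - a.re + 2 * L) (t : ℝ) :
    ‖barnesKernel a ω ((c + 2 * L : ℝ) + t * I)‖ ≤
      2 * Real.pi * |Real.cos (Real.pi * c / 2)|⁻¹ * |Real.sin (Real.pi * (c - a.re))|⁻¹ *
        ‖ω‖ ^ c * (‖ω‖ ^ (2 * L) * ((Real.Gamma (c - a.re + 2 * L))⁻¹) ^ 2) *
        ((1 + |t|) ^ 0 * Real.exp (-((Real.pi / 2 - |ω.arg|) * |t|))) := by
  set s : ℂ := (c + 2 * L : ℝ) + t * I with hs
  have hre : (s - a).re = c - a.re + 2 * L := by simp [hs]; ring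
  have him : (s - a).im = t - a.im := by simp [hs]
  have hΓ0 : 0 < Real.Gamma (c - a.re + 2 * L) := Real.Gamma_pos_of_pos (by linarith)
  have hΓ : Gamma (s - a) ≠ 0 := Gamma_ne_zero_of_re_pos (by rw [hre]; linarith)
  have e1 := norm_cpow_le hω s
  have e2 := norm_inv_Gamma_le 0 (z := s - a) (by rw [hre]; simpa using hL)
  simp only [pow_zero, one_mul, CharP.cast_eq_zero, add_zero, hre, him] at e2
  have e3 : ‖(2 * cos (Real.pi * s / 2))⁻¹‖ ≤
      |Real.cos (Real.pi * c / 2)|⁻¹ * Real.exp (-(Real.pi / 2 * |t|)) := by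
    have hc2 : |Real.cos (Real.pi * (c + 2 * L : ℝ) / 2)| = |Real.cos (Real.pi * c / 2)| := by
      rw [show Real.pi * (c + 2 * L : ℝ) / 2 = Real.pi * c / 2 + L * Real.pi by ring,
        Real.cos_add_nat_mul_pi, abs_mul]
      simp
    have := norm_inv_cos_line_le (c := c + 2 * L) (by
      rw [← abs_pos, hc2]; exact abs_pos.mpr hcos) t
    rwa [hc2] at this
  have e4 : ‖(sin (Real.pi * (s - a)))⁻¹‖ ≤
      2 * |Real.sin (Real.pi * (c - a.re))|⁻¹ * Real.exp (-(Real.pi * |t - a.im|)) := by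
    have h := mul_exp_le_norm_sin (Real.pi * (c - a.re + 2 * L)) (Real.pi * (t - a.im))
    have hs2 : Real.sin (Real.pi * (c - a.re + 2 * L)) = Real.sin (Real.pi * (c - a.re)) := by
      rw [show Real.pi * (c - a.re + 2 * L) = Real.pi * (c - a.re) + L * (2 * Real.pi) by ring,
        Real.sin_add_nat_mul_two_pi]
    rw [hs2, abs_mul, abs_of_pos Real.pi_pos, show
      (((Real.pi * (c - a.re + 2 * L) : ℝ) : ℂ) + ((Real.pi * (t - a.im) : ℝ) : ℂ) * I) =
      Real.pi * (s - a) by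
        rw [← hre, ← him]
        conv_rhs => rw [← re_add_im (s - a)]
        push_cast; ring] at h
    have hp : 0 < |Real.sin (Real.pi * (c - a.re))| := abs_pos.mpr hsin
    rw [norm_inv, Real.exp_neg, ← inv_inv (2 : ℝ), ← mul_inv, ← mul_inv]
    refine inv_anti₀ (by positivity) ?_
    linarith
  rw [barnesKernel_eq ω hΓ]
  simp only [norm_mul, norm_pow]
  have hsre : s.re = c + 2 * L := by simp [hs]
  have hsim : s.im = t := by simp [hs]
  rw [hsre, hsim] at e1
  rw [norm_real, Real.norm_of_nonneg Real.pi_pos.le]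
  have hω' : 0 < ‖ω‖ := norm_pos_iff.mpr hω
  calc _ ≤ (‖ω‖ ^ (c + 2 * L : ℝ) * Real.exp (|ω.arg| * |t|)) * Real.pi *
        (Real.exp (Real.pi / 2 * |t - a.im|) / Real.Gamma (c - a.re + 2 * L)) ^ 2 *
        (|Real.cos (Real.pi * c / 2)|⁻¹ * Real.exp (-(Real.pi / 2 * |t|))) *
        (2 * |Real.sin (Real.pi * (c - a.re))|⁻¹ * Real.exp (-(Real.pi * |t - a.im|))) := by
        gcongr
    _ = 2 * Real.pi * |Real.cos (Real.pi * c / 2)|⁻¹ * |Real.sin (Real.pi * (c - a.re))|⁻¹ *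
        (‖ω‖ ^ (c + 2 * L : ℝ) * ((Real.Gamma (c - a.re + 2 * L))⁻¹) ^ 2) *
        (Real.exp (|ω.arg| * |t|) * Real.exp (-(Real.pi / 2 * |t|)) *
          (Real.exp (Real.pi / 2 * |t - a.im|) * Real.exp (Real.pi / 2 * |t - a.im|) *
            Real.exp (-(Real.pi * |t - a.im|)))) := by ring
    _ = _ := by
        rw [← Real.exp_add, ← Real.exp_add, ← Real.exp_add, ← Real.exp_add,
          show |ω.arg| * |t| + -(Real.pi / 2 * |t|) + (Real.pi / 2 * |t - a.im| +
            Real.pi / 2 * |t - a.im| + -(Real.pi * |t - a.im|)) =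
            -((Real.pi / 2 - |ω.arg|) * |t|) by ring,
          Real.rpow_add hω', show (2 * L : ℝ) = ((2 * L : ℕ) : ℝ) by push_cast; ring,
          Real.rpow_natCast]
        ring

/-- The same cancellation for the horizontal sides. The restriction on `|Im z|` stays clear of all
poles, so cosine and sine are bounded below by the hyperbolic sine of their imaginary parts. -/
theorem exists_norm_barnesKernel_strip_le (a : ℂ) {ω : ℂ} (hω : ω ≠ 0) (σ₁ σ₂ : ℝ) :
    ∃ C : ℝ, ∃ m : ℕ, ∀ z : ℂ, σ₁ ≤ z.re → z.re ≤ σ₂ → 1 + |a.im| ≤ |z.im| →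
      ‖barnesKernel a ω z‖ ≤
        C * ((1 + |z.im|) ^ m * Real.exp (-((Real.pi / 2 - |ω.arg|) * |z.im|))) := by
  obtain ⟨C, hC, m, h⟩ := exists_norm_inv_Gamma_le (σ₁ - a.re) (σ₂ - a.re)
  have hω' : 0 < ‖ω‖ := norm_pos_iff.mpr hω
  have hcont : ContinuousOn (fun x : ℝ ↦ ‖ω‖ ^ x) (Set.Icc σ₁ σ₂) :=
    (Real.continuous_const_rpow hω'.ne').continuousOn
  obtain ⟨A, hA⟩ := isCompact_Icc.exists_bound_of_continuousOn hcont
  refine ⟨|A| * Real.pi * (C * (1 + |a.im|) ^ m) ^ 2 * 8, 2 * m, fun z h1 h2 h3 ↦ ?_⟩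
  have him : 1 ≤ |z.im - a.im| := by
    have := abs_sub_abs_le_abs_sub z.im a.im
    linarith
  have hπ := Real.pi_gt_three
  have hΓ : Gamma (z - a) ≠ 0 := Gamma_ne_zero fun n hn ↦ by
    have := congrArg im hn
    simp at this
    rw [this] at him
    norm_num at him
  have e1 := norm_cpow_le hω z
  have e1' : ‖ω‖ ^ z.re ≤ |A| :=
    (Real.le_norm_self _).trans ((hA z.re ⟨h1, h2⟩).trans (le_abs_self _))
  have e2 := h (z - a) (by simpa using h1) (by simpa using h2)
  rw [sub_im] at e2
  have e2' : 1 + |z.im - a.im| ≤ (1 + |a.im|) * (1 + |z.im|) := by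
    have := abs_sub z.im a.im
    nlinarith [abs_nonneg z.im, abs_nonneg a.im]
  have e3 : ‖(2 * cos (Real.pi * z / 2))⁻¹‖ ≤ 2 * Real.exp (-(Real.pi / 2 * |z.im|)) := by
    have := exp_le_norm_cos (x := Real.pi / 2 * z.re) (y := Real.pi / 2 * z.im) (by
      rw [abs_mul, abs_of_pos (half_pos Real.pi_pos)]
      nlinarith [abs_nonneg a.im])
    rw [show (((Real.pi / 2 * z.re : ℝ) : ℂ) + ((Real.pi / 2 * z.im : ℝ) : ℂ) * I) =
      Real.pi * z / 2 by
        conv_rhs => rw [← re_add_im z]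
        push_cast; ring, abs_mul, abs_of_pos (half_pos Real.pi_pos)] at this
    rw [norm_inv, norm_mul, norm_ofNat, Real.exp_neg, ← inv_inv (2 : ℝ), ← mul_inv]
    refine inv_anti₀ (by positivity) ?_
    rw [inv_inv]
    linarith
  have e4 : ‖(sin (Real.pi * (z - a)))⁻¹‖ ≤ 4 * Real.exp (-(Real.pi * |z.im - a.im|)) := by
    have := exp_le_norm_sin (x := Real.pi * (z - a).re) (y := Real.pi * (z - a).im) (by
      rw [abs_mul, abs_of_pos Real.pi_pos, sub_im]
      nlinarith)
    rw [show (((Real.pi * (z - a).re : ℝ) : ℂ) + ((Real.pi * (z - a).im : ℝ) : ℂ) * I) =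
      Real.pi * (z - a) by
        conv_rhs => rw [← re_add_im (z - a)]
        push_cast; ring, abs_mul, abs_of_pos Real.pi_pos, sub_im] at this
    rw [norm_inv, Real.exp_neg, ← inv_inv (4 : ℝ), ← mul_inv]
    refine inv_anti₀ (by positivity) ?_
    linarith
  rw [barnesKernel_eq ω hΓ]
  simp only [norm_mul, norm_pow]
  rw [norm_real, Real.norm_of_nonneg Real.pi_pos.le]
  calc _ ≤ (|A| * Real.exp (|ω.arg| * |z.im|)) * Real.pi *
        (C * ((1 + |a.im|) * (1 + |z.im|)) ^ m * Real.exp (Real.pi / 2 * |z.im - a.im|)) ^ 2 *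
        (2 * Real.exp (-(Real.pi / 2 * |z.im|))) *
        (4 * Real.exp (-(Real.pi * |z.im - a.im|))) := by
        gcongr
        · exact e1.trans (by gcongr)
        · exact e2.trans (by gcongr)
    _ = |A| * Real.pi * (C * (1 + |a.im|) ^ m) ^ 2 * 8 * ((1 + |z.im|) ^ (2 * m) *
        (Real.exp (|ω.arg| * |z.im|) * Real.exp (-(Real.pi / 2 * |z.im|)) *
          (Real.exp (Real.pi / 2 * |z.im - a.im|) * Real.exp (Real.pi / 2 * |z.im - a.im|) *
            Real.exp (-(Real.pi * |z.im - a.im|))))) := by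
        rw [mul_pow (1 + |a.im|)]; ring
    _ = _ := by
        rw [← Real.exp_add, ← Real.exp_add, ← Real.exp_add, ← Real.exp_add,
          show |ω.arg| * |z.im| + -(Real.pi / 2 * |z.im|) + (Real.pi / 2 * |z.im - a.im| +
            Real.pi / 2 * |z.im - a.im| + -(Real.pi * |z.im - a.im|)) =
            -((Real.pi / 2 - |ω.arg|) * |z.im|) by ring]

end QuadLambert

/-! ### Closing the Mellin–Barnes contour -/

namespace QuadLambert

open Complex MeasureTheory

/-- The Mellin-Barnes integral of the kernel, evaluated by closing the contour to the right. -/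
theorem integral_barnesKernel {a ω : ℂ} {c : ℝ} (hω : 0 < ω.re) (hc : -1 < c) (hc0 : c < 0)
    (hca : c < a.re) (ha : ∀ n : ℤ, a ≠ n) (hint₀ : ∀ n : ℤ, c - a.re ≠ n) :
    ∫ t : ℝ, barnesKernel a ω (c + t * I) = 2 * Real.pi * (ω *
      ((∑' k : ℕ, (-1) ^ k * ω ^ (2 * k) * ((Gamma (1 - a + 2 * k))⁻¹) ^ 2) - ω ^ a *
        ∑' j : ℕ, ω ^ j * cos (Real.pi * (a + j) / 2) / (j.factorial : ℂ) ^ 2) /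
          sin (Real.pi * a)) := by
  have hω0 : ω ≠ 0 := fun h ↦ by simp [h] at hω
  have hδ := abs_arg_lt hω
  set S : ℕ → ℂ := fun k ↦ (-1) ^ k * ω ^ (2 * k) * ((Gamma (1 - a + 2 * k))⁻¹) ^ 2 with hS
  set B : ℕ → ℂ := fun j ↦ ω ^ j * cos (Real.pi * (a + j) / 2) / (j.factorial : ℂ) ^ 2 with hB
  have hSsum : Summable S := summable_pow_mul_inv_Gamma_sq ω fun n hn ↦
    ha (1 - n) (by push_cast; linear_combination -hn)
  have hBsum : Summable B := summable_pow_mul_cos_div_factorial_sq ω a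
  have hcos : Real.cos (Real.pi * c / 2) ≠ 0 :=
    (Real.cos_pos_of_mem_Ioo ⟨by nlinarith [Real.pi_pos], by nlinarith [Real.pi_pos]⟩).ne'
  have hsin : Real.sin (Real.pi * (c - a.re)) ≠ 0 := by
    rw [Real.sin_ne_zero_iff]
    intro n hn
    exact hint₀ n (mul_left_cancel₀ Real.pi_ne_zero (by rw [← hn]; ring))
  -- The number of poles `a + 1 + j` left of `Re s = c + 2L`; the hypothesis on `c - Re a` ensures
  -- that none lies on that line.
  set J : ℕ → ℕ := fun L ↦ ⌈2 * L + c - a.re - 1⌉₊ with hJ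
  have hJlim : Tendsto J atTop atTop := by
    refine tendsto_nat_ceil_atTop.comp ?_
    have : Tendsto (fun L : ℕ ↦ 2 * (L : ℝ) + (c - a.re - 1)) atTop atTop :=
      tendsto_atTop_add_const_right _ _ (tendsto_natCast_atTop_atTop.const_mul_atTop two_pos)
    exact this.congr fun L ↦ by ring
  -- the contribution of the far line tends to zero
  have hfar : Tendsto (fun L : ℕ ↦ ∫ t : ℝ, barnesKernel a ω ((c + 2 * L : ℝ) + t * I)) atTop
      (𝓝 0) := by
    -- Up to sign these are the terms of the convergent first residue series, taken at the real
    -- arguments `‖ω‖` and `c - Re a`.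
    have h1 : Tendsto (fun L : ℕ ↦ ‖ω‖ ^ (2 * L) * ((Real.Gamma (c - a.re + 2 * L))⁻¹) ^ 2) atTop
        (𝓝 0) := by
      have := (summable_pow_mul_inv_Gamma_sq (‖ω‖ : ℂ) (b := ((c - a.re : ℝ) : ℂ)) (fun n hn ↦
        hint₀ n (by exact_mod_cast hn))).tendsto_atTop_zero.norm
      rw [norm_zero] at this
      refine this.congr fun L ↦ ?_
      rw [show (((c - a.re : ℝ) : ℂ) + 2 * L) = ((c - a.re + 2 * L : ℝ) : ℂ) by push_cast; ring,
        Gamma_ofReal]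
      simp only [norm_mul, norm_pow, norm_neg, norm_one, one_pow, one_mul, norm_inv, norm_real,
        Real.norm_eq_abs]
      rw [inv_pow, inv_pow, sq_abs, abs_norm]
    set E : ℝ := 2 * Real.pi * |Real.cos (Real.pi * c / 2)|⁻¹ *
      |Real.sin (Real.pi * (c - a.re))|⁻¹ * ‖ω‖ ^ c with hE
    set Q : ℝ := ∫ t : ℝ, (1 + |t|) ^ 0 * Real.exp (-((Real.pi / 2 - |ω.arg|) * |t|)) with hQ
    have h2 := (h1.const_mul E).mul_const Q
    rw [mul_zero, zero_mul] at h2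
    refine squeeze_zero_norm' ?_ h2
    obtain ⟨N, hN⟩ := exists_nat_gt (a.re - c + 1 / 2)
    filter_upwards [eventually_ge_atTop N] with L hL
    have hL' : (N : ℝ) ≤ L := by exact_mod_cast hL
    have hL0 : (0 : ℝ) ≤ L := L.cast_nonneg
    rw [hQ, ← integral_const_mul]
    exact norm_integral_le_of_norm_le
      ((integrable_pow_mul_exp_neg_abs 0 hδ).const_mul _)
      (Eventually.of_forall fun t ↦
        norm_barnesKernel_far_line_le hω0 hcos hsin L (by linarith) t)
  -- the residues between the two lines
  have hres : ∀ᶠ L : ℕ in atTop, (∫ t : ℝ, barnesKernel a ω ((c + 2 * L : ℝ) + t * I)) -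
      ∫ t : ℝ, barnesKernel a ω (c + t * I) = 2 * Real.pi *
        ((∑ k ∈ Finset.range L, -(ω * S k) / sin (Real.pi * a)) +
          ∑ j ∈ Finset.range (J L), ω * ω ^ a * B j / sin (Real.pi * a)) := by
    obtain ⟨N, hN⟩ := exists_nat_gt (a.re - c + 1 / 2)
    filter_upwards [eventually_ge_atTop N] with L hL
    have hL' : (N : ℝ) ≤ L := by exact_mod_cast hL
    have hL0 : (0 : ℝ) ≤ L := L.cast_nonneg
    set P₁ : Finset ℂ := (Finset.range L).image fun k : ℕ ↦ (2 * k + 1 : ℂ) with hP₁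
    set P₂ : Finset ℂ := (Finset.range (J L)).image fun j : ℕ ↦ (a + 1 + j : ℂ) with hP₂
    -- Defining the residue as a limit avoids deciding to which of the two families `p` belongs.
    set r : ℂ → ℂ := fun p ↦ limUnder (𝓝[≠] p) fun z ↦ (z - p) * barnesKernel a ω z with hr
    have t1 := fun k ↦ tendsto_barnesKernel_residue_odd hω0 ha k
    have t2 := fun j ↦ tendsto_barnesKernel_residue_shift hω0 ha j
    have hdisj : Disjoint P₁ P₂ := by
      rw [Finset.disjoint_left]
      intro p hp1 hp2
      simp only [hP₁, hP₂, Finset.mem_image] at hp1 hp2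
      obtain ⟨k, -, hk⟩ := hp1
      obtain ⟨j, -, hj⟩ := hp2
      exact ha (2 * k - j) (by push_cast; linear_combination hj - hk)
    have hdiff : ∀ z : ℂ, c ≤ z.re → z.re ≤ c + 2 * L → z ∉ P₁ ∪ P₂ →
        DifferentiableAt ℂ (barnesKernel a ω) z := by
      intro z h1 h2 h3
      rw [Finset.mem_union, not_or] at h3
      refine differentiableAt_barnesKernel hω0 (fun k hk ↦ h3.1 ?_) fun j hj ↦ h3.2 ?_
      · have hre : z.re = 2 * k + 1 := by rw [hk]; simp
        have a1 : (-1 : ℝ) < 2 * k + 1 := by linarith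
        have a2 : (2 * k + 1 : ℝ) < 2 * L := by linarith
        have a1' : -1 < 2 * k + 1 := by exact_mod_cast a1
        have a2' : 2 * k + 1 < 2 * L := by exact_mod_cast a2
        lift k to ℕ using by omega
        exact Finset.mem_image.mpr ⟨k, Finset.mem_range.mpr (by omega), by rw [hk]; push_cast; rfl⟩
      · have hre : z.re = a.re + 1 + j := by rw [hj]; simp
        refine Finset.mem_image.mpr ⟨j, Finset.mem_range.mpr (Nat.lt_ceil.mpr ?_), hj.symm⟩
        have hne : z.re ≠ c + 2 * L := fun h ↦ hint₀ (1 + j - 2 * L) (by push_cast; linarith)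
        have := lt_of_le_of_ne h2 hne
        linarith
    have key := integral_vertical_sub_eq_sum_residues (σ₁ := c) (σ₂ := c + 2 * L) (by linarith)
      (P₁ ∪ P₂) r (barnesKernel a ω) ?_ hdiff ?_ ?_ (integrable_barnesKernel_line hω hc hc0 hca) ?_
    · rw [key, Finset.sum_union hdisj, hP₁, hP₂, Finset.sum_image, Finset.sum_image]
      · congr 2
        · exact Finset.sum_congr rfl fun k _ ↦ (t1 k).limUnder_eq
        · exact Finset.sum_congr rfl fun j _ ↦ (t2 j).limUnder_eq
      · intro i _ j _ hij
        simpa using hij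
      · intro i _ j _ hij
        simpa using hij
    · intro p hp
      simp only [hP₁, hP₂, Finset.mem_union, Finset.mem_image, Finset.mem_range] at hp
      rcases hp with ⟨k, hk, rfl⟩ | ⟨j, hj, rfl⟩
      · have : ((k + 1 : ℕ) : ℝ) ≤ L := by exact_mod_cast hk
        have hk0 : (0 : ℝ) ≤ k := k.cast_nonneg
        push_cast at this
        constructor <;> simp <;> linarith
      · have := Nat.lt_ceil.mp hj
        have hj0 : (0 : ℝ) ≤ j := j.cast_nonneg
        constructor <;> simp <;> linarith
    · intro p hp
      simp only [hP₁, hP₂, Finset.mem_union, Finset.mem_image, Finset.mem_range] at hp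
      rcases hp with ⟨k, hk, rfl⟩ | ⟨j, hj, rfl⟩
      · exact tendsto_nhds_limUnder ⟨_, t1 k⟩
      · exact tendsto_nhds_limUnder ⟨_, t2 j⟩
    · obtain ⟨C, m, h⟩ := exists_norm_barnesKernel_strip_le a hω0 c (c + 2 * L)
      exact exists_norm_le_of_pow_mul_exp_bound hδ h
    · refine Integrable.mono' ((integrable_pow_mul_exp_neg_abs 0 hδ).const_mul _) ?_
        (Eventually.of_forall fun t ↦
          norm_barnesKernel_far_line_le hω0 hcos hsin L (by linarith) t)
      refine Continuous.aestronglyMeasurable (continuous_iff_continuousAt.mpr fun t ↦ ?_)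
      refine ContinuousAt.comp (f := fun t : ℝ ↦ ((c + 2 * L : ℝ) : ℂ) + t * I)
        (hdiff _ (by simp) (by simp) fun hmem ↦ ?_).continuousAt (by fun_prop)
      simp only [hP₁, hP₂, Finset.mem_union, Finset.mem_image, Finset.mem_range] at hmem
      rcases hmem with ⟨k, hk, h⟩ | ⟨j, hj, h⟩
      · have h' := congrArg re h
        have : ((k + 1 : ℕ) : ℝ) ≤ L := by exact_mod_cast hk
        push_cast at this
        simp at h'
        linarith
      · have h' := congrArg re h
        simp at h'
        exact hint₀ (1 + j - 2 * L) (by push_cast; linarith)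
  have hlim1 := hfar.congr' (hres.mono fun L hL ↦ eq_add_of_sub_eq hL)
  have hsS := (((hSsum.hasSum.mul_left ω).neg.div_const (sin (Real.pi * a))).tendsto_sum_nat)
  have hsB := ((hBsum.hasSum.mul_left (ω * ω ^ a)).div_const
    (sin (Real.pi * a))).tendsto_sum_nat.comp hJlim
  -- The far integrals tend to `0` and also to the near integral plus all the residues; comparing
  -- the two limits evaluates the near integral.
  have hlim2 := ((hsS.add hsB).const_mul (2 * Real.pi : ℂ)).add_const
    (∫ t : ℝ, barnesKernel a ω (c + t * I))
  have := tendsto_nhds_unique hlim1 hlim2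
  linear_combination -this

end QuadLambert

/-! ### Recognizing the hypergeometric and Kelvin functions -/

namespace QuadLambert

open Complex

/-- The duplication `(b)_{2k} = 4^k (b/2)_k ((b+1)/2)_k`. Squared, with `b = 1 - a`, it is the
source of the four lower parameters of `₁F₄`. -/
theorem Gamma_add_two_mul {b : ℂ} (hb : ∀ n : ℤ, b ≠ n) (k : ℕ) :
    Gamma (b + 2 * k) = Gamma b * 4 ^ k * (ascPochhammer ℂ k).eval (b / 2) *
      (ascPochhammer ℂ k).eval ((b + 1) / 2) := by
  induction k with
  | zero => simp
  | succ k ih =>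
    have hb0 : ∀ k : ℕ, b + k ≠ 0 := fun k h ↦ hb (-k) (by push_cast; linear_combination h)
    rw [ascPochhammer_succ_eval, ascPochhammer_succ_eval,
      show b + 2 * (k + 1 : ℕ) = (b + (2 * k + 1 : ℕ)) + 1 by push_cast; ring,
      Gamma_add_one _ (hb0 _), show b + ((2 * k + 1 : ℕ) : ℂ) = (b + (2 * k : ℕ)) + 1 by
        push_cast; ring, Gamma_add_one _ (hb0 _), show b + ((2 * k : ℕ) : ℂ) = b + 2 * k by
        push_cast; ring, ih]
    ring

/-- The upper parameter `1` contributes `k!` and cancels the factorial in the series; the powers of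
`4` from duplication are absorbed in the argument `-(ω/4)²`. -/
theorem hypergeom_eq_tsum {a : ℂ} (ha : ∀ n : ℤ, a ≠ n) (ω : ℂ) :
    1 / Gamma (1 - a) ^ 2 * hypergeom [1] [1 - a / 2, 1 - a / 2, (1 - a) / 2, (1 - a) / 2]
      (-(ω / 4) ^ 2) =
    ∑' k : ℕ, (-1) ^ k * ω ^ (2 * k) * ((Gamma (1 - a + 2 * k))⁻¹) ^ 2 := by
  have hb : ∀ n : ℤ, 1 - a ≠ n := fun n hn ↦ ha (1 - n) (by push_cast; linear_combination -hn)
  rw [hypergeom, ← tsum_mul_left]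
  refine tsum_congr fun k ↦ ?_
  have hfac : (k.factorial : ℂ) ≠ 0 := Nat.cast_ne_zero.mpr k.factorial_ne_zero
  rw [Gamma_add_two_mul hb k, show (1 - a + 1) / 2 = 1 - a / 2 by ring]
  simp only [List.map_cons, List.map_nil, List.prod_cons, List.prod_nil, mul_one,
    ascPochhammer_eval_one]
  rw [show (-(ω / 4) ^ 2) ^ k = (-1) ^ k * ω ^ (2 * k) * ((4 : ℂ) ^ k)⁻¹ ^ 2 by
    rw [neg_pow, ← pow_mul, div_pow, mul_comm 2 k, pow_mul (4 : ℂ), div_eq_mul_inv, inv_pow]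
    ring]
  simp only [mul_inv, div_eq_mul_inv, mul_pow, inv_pow]
  rw [show (k.factorial : ℂ) = ((1 : ℂ) * k.factorial) by ring]
  field_simp

theorem exp_three_pi_div_four_sq :
    exp (3 * Real.pi * I / 4) ^ 2 = -I ∧ exp (-(3 * Real.pi * I / 4)) ^ 2 = I := by
  have h : exp (3 * Real.pi * I / 4) ^ 2 = -I := by
    rw [← exp_nat_mul, show ((2 : ℕ) : ℂ) * (3 * Real.pi * I / 4) =
      Real.pi * I + Real.pi / 2 * I by push_cast; ring, exp_add, exp_pi_mul_I, exp_pi_div_two_mul_I]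
    ring
  refine ⟨h, ?_⟩
  rw [exp_neg, inv_pow, h, inv_neg, inv_I]; ring

theorem besselJ_zero_eq_tsum (z : ℂ) :
    besselJ 0 z = ∑' m : ℕ, (-(z ^ 2 / 4)) ^ m / (m.factorial : ℂ) ^ 2 := by
  refine tsum_congr fun m ↦ ?_
  rw [show (2 * (m : ℂ) + 0) = ((2 * m : ℕ) : ℂ) by push_cast; ring, cpow_natCast, add_zero,
    Gamma_nat_eq_factorial, pow_mul, ← mul_pow, sq (m.factorial : ℂ)]
  congr 2
  ring

theorem summable_pow_div_factorial_sq (x : ℂ) :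
    Summable fun m : ℕ ↦ x ^ m / (m.factorial : ℂ) ^ 2 := by
  refine Summable.of_norm_bounded (Real.summable_pow_div_factorial ‖x‖) fun j ↦ ?_
  have hf : (1 : ℝ) ≤ j.factorial := by exact_mod_cast j.factorial_pos
  rw [norm_div, norm_pow, norm_pow, Complex.norm_natCast]
  gcongr
  nlinarith

/-- The left side is the mean of `e^{iπa/2} J₀(x e^{3πi/4})` and `e^{-iπa/2} J₀(x e^{-3πi/4})`. As
the arguments square to `∓i x²`, the `m`-th coefficients carry `i^m` and `(-i)^m`, and the phases
combine into `cos(π(a + m)/2)`. -/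
theorem cos_mul_ber_sub_sin_mul_bei (a x : ℂ) :
    cos (Real.pi * a / 2) * ber x - sin (Real.pi * a / 2) * bei x =
      ∑' j : ℕ, (x ^ 2 / 4) ^ j * cos (Real.pi * (a + j) / 2) / (j.factorial : ℂ) ^ 2 := by
  obtain ⟨e1, e2⟩ := exp_three_pi_div_four_sq
  have h1 : besselJ 0 (x * exp (3 * Real.pi * I / 4)) =
      ∑' m : ℕ, (I * (x ^ 2 / 4)) ^ m / (m.factorial : ℂ) ^ 2 := by
    rw [besselJ_zero_eq_tsum, mul_pow, e1]
    refine tsum_congr fun m ↦ ?_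
    congr 2; ring
  have h2 : besselJ 0 (x * exp (-(3 * Real.pi * I / 4))) =
      ∑' m : ℕ, (-I * (x ^ 2 / 4)) ^ m / (m.factorial : ℂ) ^ 2 := by
    rw [besselJ_zero_eq_tsum, mul_pow, e2]
    refine tsum_congr fun m ↦ ?_
    congr 2; ring
  have hI : I * I = -1 := I_mul_I
  have hcomb : cos (Real.pi * a / 2) * ber x - sin (Real.pi * a / 2) * bei x =
      exp (Real.pi * a / 2 * I) / 2 * besselJ 0 (x * exp (3 * Real.pi * I / 4)) +
      exp (-(Real.pi * a / 2 * I)) / 2 * besselJ 0 (x * exp (-(3 * Real.pi * I / 4))) := by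
    rw [ber, bei, ← neg_mul, exp_mul_I, exp_mul_I, cos_neg, sin_neg, div_eq_mul_inv _ (2 * I),
      mul_inv, inv_I]
    ring
  rw [hcomb, h1, h2, ← tsum_mul_left, ← tsum_mul_left, ← Summable.tsum_add
    ((summable_pow_div_factorial_sq _).mul_left _) ((summable_pow_div_factorial_sq _).mul_left _)]
  refine tsum_congr fun m ↦ ?_
  have p1 : (I : ℂ) ^ m = exp (Real.pi * m / 2 * I) := by
    rw [show (Real.pi * m / 2 * I : ℂ) = m * (Real.pi / 2 * I) by ring, exp_nat_mul,
      exp_pi_div_two_mul_I]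
  have p2 : (-I : ℂ) ^ m = exp (-(Real.pi * m / 2 * I)) := by
    rw [show (-(Real.pi * m / 2 * I) : ℂ) = m * (-(Real.pi / 2 * I)) by ring, exp_nat_mul,
      exp_neg, exp_pi_div_two_mul_I, inv_I]
  rw [mul_pow, mul_pow, p1, p2, cos, show (Real.pi * (a + m) / 2 * I : ℂ) =
    Real.pi * a / 2 * I + Real.pi * m / 2 * I by ring, show (-(Real.pi * (a + m) / 2) * I : ℂ) =
    -(Real.pi * a / 2 * I) + -(Real.pi * m / 2 * I) by ring, exp_add, exp_add]
  ring

section field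

variable (K : Type*) [Field K] [NumberField K]

/-- The argument `8π³n / (y D_K)` of the kernel. -/
noncomputable def kernelArg (y : ℂ) (n : ℕ) : ℂ := 8 * (Real.pi : ℂ) ^ 3 * n / (y * absDiscr K)

theorem absDiscr_pos : 0 < ((NumberField.discr K).natAbs : ℝ) := by
  exact_mod_cast Int.natAbs_pos.mpr (NumberField.discr_ne_zero K)

theorem absDiscr_ne_zero : absDiscr K ≠ 0 := by
  rw [absDiscr]; exact_mod_cast (absDiscr_pos K).ne'

theorem kernelArg_eq (y : ℂ) (n : ℕ) :
    kernelArg K y n = ((8 * Real.pi ^ 3 * n / (NumberField.discr K).natAbs : ℝ) : ℂ) * y⁻¹ := by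
  rw [kernelArg, absDiscr]; push_cast; rw [mul_comm y, ← div_div]; rw [div_eq_mul_inv _ y]

theorem re_inv_pos {y : ℂ} (hy : 0 < y.re) : 0 < (y⁻¹).re := by
  rw [inv_re]
  exact div_pos hy (normSq_pos.mpr fun h ↦ by simp [h] at hy)

theorem re_kernelArg_pos {y : ℂ} (hy : 0 < y.re) {n : ℕ} (hn : 0 < n) :
    0 < (kernelArg K y n).re := by
  have hD := absDiscr_pos K
  have hn' : (0 : ℝ) < n := by exact_mod_cast hn
  rw [kernelArg_eq, re_ofReal_mul]
  exact mul_pos (by positivity) (re_inv_pos hy)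

theorem zArg_eq (y : ℂ) (n : ℕ) : zArg K y n = (kernelArg K y n / 4) ^ 2 := by
  rw [zArg, kernelArg]; ring

theorem kelvinArg_sq (y : ℂ) (n : ℕ) : kelvinArg K y n ^ 2 / 4 = kernelArg K y n := by
  rw [kelvinArg, kernelArg, mul_pow, ← cpow_nat_mul]
  norm_num
  ring

theorem ofReal_mul_cpow {r : ℝ} (hr : 0 < r) {z : ℂ} (hz : z ≠ 0) (s : ℂ) :
    ((r : ℂ) * z) ^ s = (r : ℂ) ^ s * z ^ s := by
  have hr0 : (r : ℂ) ≠ 0 := ofReal_ne_zero.mpr hr.ne'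
  rw [cpow_def_of_ne_zero (mul_ne_zero hr0 hz), cpow_def_of_ne_zero hr0, cpow_def_of_ne_zero hz,
    log_ofReal_mul hr hz, ← exp_add, ofReal_log hr.le, add_mul]

/-- `|arg w| < π/2` keeps `2 arg w` in the principal range. This is how a power `a/2` of the squared
argument becomes a power `a` of the kernel argument. -/
theorem sq_cpow_half {w : ℂ} (hw : 0 < w.re) (a : ℂ) : (w ^ 2) ^ (a / 2) = w ^ a := by
  have h := abs_lt.mp (abs_arg_lt_pi_div_two_iff.mpr (Or.inl hw))
  rw [← cpow_ofNat_mul' (by linarith [h.1]) (by linarith [h.2])]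
  congr 1; ring

/-- Rewrites the term of the theorem in the variable `ω = kernelArg K y n`, using `zArg = (ω/4)²`
and `kelvinArg² / 4 = ω`, so that it matches the evaluated contour integral. -/
theorem prefactor_mul_transTerm {a y : ℂ} (ha : ∀ n : ℤ, a ≠ n) (hy : 0 < y.re) {n : ℕ}
    (hn : 0 < n) :
    prefactor K a y * transTerm K a y n = sigmaK K (-a) n *
      (absDiscr K ^ (a + 1 / 2) * (2 * Real.pi : ℂ) ^ (-2 * a - 1) * (n : ℂ)⁻¹) *
      (kernelArg K y n * ((∑' k : ℕ, (-1) ^ k * kernelArg K y n ^ (2 * k) *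
          ((Gamma (1 - a + 2 * k))⁻¹) ^ 2) - kernelArg K y n ^ a *
        ∑' j : ℕ, kernelArg K y n ^ j * cos (Real.pi * (a + j) / 2) / (j.factorial : ℂ) ^ 2) /
          sin (Real.pi * a)) := by
  have hπ : (Real.pi : ℂ) ≠ 0 := ofReal_ne_zero.mpr Real.pi_ne_zero
  have hD := absDiscr_ne_zero K
  have hy0 : y ≠ 0 := fun h ↦ by simp [h] at hy
  have hn0 : (n : ℂ) ≠ 0 := Nat.cast_ne_zero.mpr hn.ne'
  have hω := re_kernelArg_pos K hy hn
  rw [← hypergeom_eq_tsum ha, transTerm]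
  have hk := cos_mul_ber_sub_sin_mul_bei a (kelvinArg K y n)
  rw [kelvinArg_sq] at hk
  rw [hk, zArg_eq, sq_cpow_half (by
    rw [show kernelArg K y n / 4 = ((1 / 4 : ℝ) : ℂ) * kernelArg K y n by push_cast; ring,
      re_ofReal_mul]; linarith)]
  have h4 : (kernelArg K y n / 4) ^ a = kernelArg K y n ^ a * (2 : ℂ) ^ (-2 * a) := by
    rw [show kernelArg K y n / 4 = ((1 / 4 : ℝ) : ℂ) * kernelArg K y n by push_cast; ring,
      ofReal_mul_cpow (by norm_num) (fun h ↦ by simp [h] at hω), mul_comm]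
    congr 1
    rw [show (((1 / 4 : ℝ) : ℝ) : ℂ) = (2 : ℂ) ^ (-2 : ℂ) by
      rw [cpow_neg, cpow_ofNat]; norm_num, show (2 : ℂ) = ((2 : ℝ) : ℂ) by norm_num]
    rw [show (-((2 : ℝ) : ℂ)) = ((-2 : ℝ) : ℂ) by push_cast; ring,
      cpow_mul_ofReal_nonneg (by norm_num), ofReal_cpow (by norm_num)]
  rw [h4, prefactor]
  have h5 : (2 * Real.pi : ℂ) ^ (-2 * a - 1) =
      (2 : ℂ) ^ (-2 * a) * (Real.pi : ℂ) ^ (2 - 2 * a) / (2 * Real.pi ^ 3) := by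
    rw [show (2 * Real.pi : ℂ) = ((2 : ℝ) : ℂ) * ((Real.pi : ℝ) : ℂ) by push_cast; ring,
      mul_cpow_ofReal_nonneg (by norm_num) Real.pi_pos.le,
      show ((2 : ℝ) : ℂ) = 2 by norm_num, cpow_sub _ _ two_ne_zero, cpow_one,
      show -2 * a - 1 = (2 - 2 * a) - (3 : ℕ) by push_cast; ring, cpow_sub _ _ hπ, cpow_natCast]
    ring
  have h6 : absDiscr K ^ (a + 1 / 2) = absDiscr K ^ (a - 1 / 2) * absDiscr K := by
    rw [show a + 1 / 2 = (a - 1 / 2) + 1 by ring, cpow_add _ _ hD, cpow_one]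
  rw [h5, h6]
  set H := hypergeom [1] [1 - a / 2, 1 - a / 2, (1 - a) / 2, (1 - a) / 2]
      (-(kernelArg K y n / 4) ^ 2)
  set B := ∑' j : ℕ, kernelArg K y n ^ j * cos (Real.pi * (a + j) / 2) / (j.factorial : ℂ) ^ 2
  set W := kernelArg K y n ^ a
  rw [show kernelArg K y n = 8 * (Real.pi : ℂ) ^ 3 * n / (y * absDiscr K) from rfl]
  field_simp
  ring

end field

end QuadLambert

/-! ### The theta function of a binary quadratic form -/

namespace QuadLambert

open Complex

theorem summable_exp_neg_mul_int_sq {r : ℝ} (hr : 0 < r) :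
    Summable fun n : ℤ ↦ Real.exp (-(r * n ^ 2)) := by
  have h := ((summable_jacobiTheta₂_term_iff 0 (((r / Real.pi : ℝ) : ℂ) * I)).mpr (by
    have : (0 : ℝ) < r / Real.pi := by positivity
    simpa using this)).norm
  refine h.congr fun n ↦ ?_
  rw [jacobiTheta₂_term, norm_exp]
  congr 1
  have : (2 * Real.pi * I * n * 0 + Real.pi * I * n ^ 2 * (((r / Real.pi : ℝ) : ℂ) * I) : ℂ) =
      ((-(r * n ^ 2) : ℝ) : ℂ) := by
    have hπ : (Real.pi : ℂ) ≠ 0 := ofReal_ne_zero.mpr Real.pi_ne_zero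
    push_cast
    field_simp
    linear_combination (n : ℂ) ^ 2 * r * I_sq
  rw [this, ofReal_re]

theorem summable_exp_neg_int_sq_add {r s : ℝ} (hr : 0 < r) (hs : 0 < s) :
    Summable fun p : ℤ × ℤ ↦ Real.exp (-(r * p.1 ^ 2 + s * p.2 ^ 2)) := by
  refine ((summable_exp_neg_mul_int_sq hr).mul_of_nonneg (summable_exp_neg_mul_int_sq hs)
    (fun _ ↦ (Real.exp_pos _).le) (fun _ ↦ (Real.exp_pos _).le)).congr fun p ↦ ?_
  rw [← Real.exp_add]
  congr 1
  ring

section form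

variable {A B C : ℝ}

/-- The symmetric matrix `M` of the form has determinant `1`, so Cayley–Hamilton gives `tr(M) ⟨Mv,
v⟩ - |v|² = |Mv|²`. The two squares supplied are the components of `Mv`. -/
theorem sq_add_sq_le_form (hdet : 4 * A * C - B ^ 2 = 4) (x y : ℝ) :
    x ^ 2 + y ^ 2 ≤ (A + C) * (A * x ^ 2 + B * x * y + C * y ^ 2) := by
  nlinarith [sq_nonneg (A * x + B * y / 2), sq_nonneg (B * x / 2 + C * y)]

theorem summable_exp_neg_form (hA : 0 < A) (hdet : 4 * A * C - B ^ 2 = 4) {r : ℝ} (hr : 0 < r) :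
    Summable fun p : ℤ × ℤ ↦
      Real.exp (-(r * (A * p.2 ^ 2 + B * p.2 * p.1 + C * p.1 ^ 2))) := by
  have hC : 0 < C := by
    have : 0 < 4 * A * C := by nlinarith [sq_nonneg B]
    exact pos_of_mul_pos_right this (by positivity)
  have hAC : 0 < A + C := by positivity
  refine Summable.of_nonneg_of_le (fun _ ↦ (Real.exp_pos _).le) (fun p ↦ ?_)
    (summable_exp_neg_int_sq_add (r := r / (A + C)) (s := r / (A + C)) (by positivity)
      (by positivity))
  gcongr
  have h := sq_add_sq_le_form hdet (p.2 : ℝ) (p.1 : ℝ)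
  rw [← mul_add, div_mul_eq_mul_div, div_le_iff₀ hAC, mul_assoc]
  refine mul_le_mul_of_nonneg_left ?_ hr.le
  linarith

/-- Poisson summation in one variable turns the theta series into a symmetric double series. -/
theorem tsum_exp_neg_form_eq (hA : 0 < A) (hdet : 4 * A * C - B ^ 2 = 4) {t : ℝ} (ht : 0 < t) :
    ∑' p : ℤ × ℤ, cexp (-(Real.pi * t * (A * p.2 ^ 2 + B * p.2 * p.1 + C * p.1 ^ 2))) =
      1 / ((t * A : ℝ) : ℂ) ^ (1 / 2 : ℂ) * ∑' p : ℤ × ℤ,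
        cexp (-(Real.pi * t / A * p.1 ^ 2) - Real.pi / (t * A) * p.2 ^ 2 +
          Real.pi * I * B / A * p.1 * p.2) := by
  have hA0 : (A : ℂ) ≠ 0 := ofReal_ne_zero.mpr hA.ne'
  have ht0 : (t : ℂ) ≠ 0 := ofReal_ne_zero.mpr ht.ne'
  have hdet' : (4 * A * C - B ^ 2 : ℂ) = 4 := by exact_mod_cast hdet
  have hs1 : Summable fun p : ℤ × ℤ ↦
      cexp (-(Real.pi * t * (A * p.2 ^ 2 + B * p.2 * p.1 + C * p.1 ^ 2))) := by
    refine Summable.of_norm ((summable_exp_neg_form hA hdet (r := Real.pi * t)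
      (by positivity)).congr fun p ↦ ?_)
    rw [norm_exp]
    congr 1
    rw [← ofReal_re (-(Real.pi * t * (A * p.2 ^ 2 + B * p.2 * p.1 + C * p.1 ^ 2)))]
    push_cast
    rfl
  have hs2 : Summable fun p : ℤ × ℤ ↦
      cexp (-(Real.pi * t / A * p.1 ^ 2) - Real.pi / (t * A) * p.2 ^ 2 +
          Real.pi * I * B / A * p.1 * p.2) := by
    refine Summable.of_norm ((summable_exp_neg_int_sq_add (r := Real.pi * t / A)
      (s := Real.pi / (t * A)) (by positivity) (by positivity)).congr fun p ↦ ?_)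
    rw [norm_exp]
    congr 1
    rw [show (-(Real.pi * t / A * p.1 ^ 2) - Real.pi / (t * A) * p.2 ^ 2 +
          Real.pi * I * B / A * p.1 * p.2 : ℂ) =
        ((-(Real.pi * t / A * p.1 ^ 2 + Real.pi / (t * A) * p.2 ^ 2) : ℝ) : ℂ) +
          ((Real.pi * B / A * p.1 * p.2 : ℝ) : ℂ) * I by push_cast; ring, add_re,
      ofReal_re, re_ofReal_mul, I_re, mul_zero, add_zero]
  rw [hs1.tsum_prod, hs2.tsum_prod, ← tsum_mul_left]
  refine tsum_congr fun y ↦ ?_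
  have key := Complex.tsum_exp_neg_quadratic (a := ((t * A : ℝ) : ℂ)) (by simpa using mul_pos ht hA)
    (-(t * B * y / 2))
  have e1 : ∀ x : ℤ, cexp (-(Real.pi * t * (A * x ^ 2 + B * x * y + C * y ^ 2))) =
      cexp (-(Real.pi * t * C * y ^ 2)) *
        cexp (-Real.pi * ((t * A : ℝ) : ℂ) * x ^ 2 + 2 * Real.pi * (-(t * B * y / 2)) * x) := by
    intro x
    rw [← exp_add]
    congr 1
    push_cast
    ring
  have e2 : ∀ x : ℤ, cexp (-(Real.pi * t / A * y ^ 2) - Real.pi / (t * A) * x ^ 2 +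
          Real.pi * I * B / A * y * x) = cexp (-(Real.pi * t * C * y ^ 2)) *
        cexp (-Real.pi / ((t * A : ℝ) : ℂ) * (x + I * (-(t * B * y / 2))) ^ 2) := by
    intro x
    rw [← exp_add]
    congr 1
    -- Eliminating `C` by the determinant condition leaves `-πt/A` as the coefficient of `y²` in the
    -- exponent, which makes it symmetric under exchanging the variables and inverting `t`.
    have hC : (C : ℂ) = (4 + B ^ 2) / (4 * A) := by
      rw [eq_div_iff (by simpa using hA0)]; linear_combination hdet'
    rw [hC]
    push_cast
    field_simp
    ring_nf
    rw [I_sq]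
    ring
  simp_rw [e1, e2]
  rw [tsum_mul_left, tsum_mul_left, key]
  ring

/-- In the symmetric double series, `t ↦ 1/t` only exchanges the two summation variables; the factor
`t` is the ratio of the two square roots in front. -/
theorem tsum_exp_neg_form_inv (hA : 0 < A) (hdet : 4 * A * C - B ^ 2 = 4) {t : ℝ} (ht : 0 < t) :
    ∑' p : ℤ × ℤ, cexp (-(Real.pi * (t⁻¹ : ℝ) * (A * p.2 ^ 2 + B * p.2 * p.1 + C * p.1 ^ 2))) =
      t * ∑' p : ℤ × ℤ, cexp (-(Real.pi * t * (A * p.2 ^ 2 + B * p.2 * p.1 + C * p.1 ^ 2))) := by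
  have hA0 : (A : ℂ) ≠ 0 := ofReal_ne_zero.mpr hA.ne'
  have ht0 : (t : ℂ) ≠ 0 := ofReal_ne_zero.mpr ht.ne'
  rw [tsum_exp_neg_form_eq hA hdet ht, tsum_exp_neg_form_eq hA hdet (inv_pos.mpr ht),
    ← (Equiv.prodComm ℤ ℤ).tsum_eq]
  rw [← mul_assoc]
  congr 1
  · rw [show (1 / 2 : ℂ) = ((1 / 2 : ℝ) : ℂ) by push_cast; rfl, ← ofReal_cpow (by positivity),
      ← ofReal_cpow (by positivity), ← Real.sqrt_eq_rpow, ← Real.sqrt_eq_rpow]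
    have h : Real.sqrt (t * A) = t * Real.sqrt (t⁻¹ * A) := by
      rw [show t * A = t ^ 2 * (t⁻¹ * A) by field_simp, Real.sqrt_mul (by positivity),
        Real.sqrt_sq ht.le]
    have h0 : ((Real.sqrt (t⁻¹ * A) : ℝ) : ℂ) ≠ 0 :=
      ofReal_ne_zero.mpr (Real.sqrt_pos.mpr (by positivity)).ne'
    rw [h]
    push_cast at h0 ⊢
    field_simp
  · refine tsum_congr fun p ↦ ?_
    simp only [Equiv.prodComm_apply, Prod.fst_swap, Prod.snd_swap]
    congr 1
    push_cast
    field_simp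
    ring

end form

end QuadLambert

/-! ### The ring of integers of a quadratic field -/

namespace QuadLambert

open NumberField Module

section field

variable (K : Type*) [Field K] [NumberField K]

/-- The ring of integers of a quadratic field has a `ℤ`-basis `1, θ`. -/
theorem exists_basis_one (hK : finrank ℚ K = 2) :
    ∃ b : Basis (Fin 2) ℤ (𝓞 K), b 0 = 1 := by
  have hr : finrank ℤ (𝓞 K) = 2 := by rw [RingOfIntegers.rank, hK]
  let c : Basis (Fin 2) ℤ (𝓞 K) := (finBasis ℤ (𝓞 K)).reindex (finCongr hr)
  set m : ℤ := c.repr 1 0 with hm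
  set k : ℤ := c.repr 1 1 with hk
  have h1 : (1 : 𝓞 K) = m • c 0 + k • c 1 := by
    conv_lhs => rw [← c.sum_repr 1]
    rw [Fin.sum_univ_two]
  -- If a prime `p` divided both coordinates of `1`, then `p` would divide `1` in `𝓞 K` and be a
  -- unit, although its norm is `p²`. A Bézout relation then completes `1` to a basis.
  have hg : IsCoprime m k := by
    rw [Int.isCoprime_iff_gcd_eq_one]
    by_contra hne
    obtain ⟨p, hp, hpd⟩ := Nat.exists_prime_and_dvd hne
    have hpm : (p : ℤ) ∣ m := (Int.natCast_dvd_natCast.mpr hpd).trans (Int.gcd_dvd_left ..)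
    have hpk : (p : ℤ) ∣ k := (Int.natCast_dvd_natCast.mpr hpd).trans (Int.gcd_dvd_right ..)
    obtain ⟨m', hm'⟩ := hpm
    obtain ⟨k', hk'⟩ := hpk
    have hdvd : ((p : ℤ) : 𝓞 K) * (m' • c 0 + k' • c 1) = 1 := by
      rw [h1, hm', hk']
      simp only [zsmul_eq_mul]
      push_cast
      ring
    have hu : IsUnit (p : ℤ) := by
      have h2 : IsUnit (Algebra.norm ℤ ((p : ℤ) : 𝓞 K)) := (IsUnit.of_mul_eq_one _ hdvd).map _
      have h3 : Algebra.norm ℤ ((p : ℤ) : 𝓞 K) = (p : ℤ) ^ 2 := by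
        have := Algebra.norm_algebraMap_of_basis c (p : ℤ)
        simpa using this
      rw [h3] at h2
      exact (isUnit_pow_iff two_ne_zero).mp h2
    rw [Int.isUnit_iff] at hu
    have := hp.two_le
    omega
  obtain ⟨u, v, huv⟩ := hg
  -- the new basis is `1, -v c₀ + u c₁`
  let e : Fin 2 → 𝓞 K := ![1, (-v) • c 0 + u • c 1]
  have hdet : c.det e = 1 := by
    have e0 : c.repr (e 0) = m • Finsupp.single 0 1 + k • Finsupp.single 1 1 := by
      rw [show e 0 = m • c 0 + k • c 1 from h1, map_add, map_zsmul, map_zsmul,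
        c.repr_self, c.repr_self]
    have e1 : c.repr (e 1) = (-v) • Finsupp.single 0 1 + u • Finsupp.single 1 1 := by
      rw [show e 1 = (-v) • c 0 + u • c 1 from rfl, map_add, map_zsmul, map_zsmul,
        c.repr_self, c.repr_self]
    rw [Basis.det_apply, Matrix.det_fin_two]
    simp only [Basis.toMatrix_apply, e0, e1]
    simp
    linear_combination huv
  obtain ⟨hli, hsp⟩ := (Basis.is_basis_iff_det c).mpr (by rw [hdet]; exact isUnit_one)
  refine ⟨Basis.mk hli hsp.ge, ?_⟩
  rw [Basis.mk_apply]
  rfl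

variable {K}

theorem quadratic_relation {F : Type*} [Field F] (b : Basis (Fin 2) ℤ (𝓞 F)) (hb : b 0 = 1) :
    b 1 ^ 2 = (b.repr (b 1 ^ 2) 1 : ℤ) * b 1 + (b.repr (b 1 ^ 2) 0 : ℤ) := by
  conv_lhs => rw [← b.sum_repr (b 1 ^ 2)]
  rw [Fin.sum_univ_two, hb]
  simp only [zsmul_eq_mul]
  ring

/-- With `θ² = tθ - n`, the discriminant is `t² - 4n`. -/
theorem discr_eq_of_basis (b : Basis (Fin 2) ℤ (𝓞 K)) (hb : b 0 = 1) {t n : ℤ}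
    (hθ : b 1 ^ 2 = t * b 1 - n) : discr K = t ^ 2 - 4 * n := by
  have htr : ∀ x : 𝓞 K, Algebra.trace ℤ (𝓞 K) x = b.repr (x * b 0) 0 + b.repr (x * b 1) 1 := by
    intro x
    rw [Algebra.trace_eq_matrix_trace b, Matrix.trace_fin_two, Algebra.leftMulMatrix_eq_repr_mul,
      Algebra.leftMulMatrix_eq_repr_mul]
  have r0 : b.repr (1 : 𝓞 K) = Finsupp.single 0 1 := by rw [← hb, b.repr_self]
  have r1 : b.repr (b 1) = Finsupp.single 1 1 := b.repr_self 1
  have r2 : b.repr (b 1 * b 1) = t • Finsupp.single 1 1 - n • Finsupp.single 0 1 := by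
    rw [← sq, hθ, show (t : 𝓞 K) * b 1 - n = t • b 1 - n • (1 : 𝓞 K) by
      simp [zsmul_eq_mul], map_sub, map_zsmul, map_zsmul, r0, r1]
  have r3 : b.repr (b 1 * b 1 * b 1) =
      t • (t • Finsupp.single 1 1 - n • Finsupp.single 0 1) - n • Finsupp.single 1 1 := by
    rw [show b 1 * b 1 * b 1 = t • (b 1 * b 1) - n • b 1 by
      rw [← sq, hθ]; simp only [zsmul_eq_mul]; linear_combination (t : 𝓞 K) * hθ,
      map_sub, map_zsmul, map_zsmul, r2, r1]
  rw [← discr_eq_discr K b, Algebra.discr_def, Matrix.det_fin_two]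
  simp only [Algebra.traceMatrix_apply, Algebra.traceForm_apply, htr, hb, one_mul, mul_one,
    r0, r1, r2, r3]
  simp
  ring

/-- Ring homomorphisms from `𝓞 K` to `ZMod p` correspond to the roots of `X² - tX + n`. -/
noncomputable def homEquivRoots (b : Basis (Fin 2) ℤ (𝓞 K)) (hb : b 0 = 1) {t n : ℤ}
    (hθ : b 1 ^ 2 = t * b 1 - n) (p : ℕ) :
    (𝓞 K →ₐ[ℤ] ZMod p) ≃ {c : ZMod p // c ^ 2 - t * c + n = 0} := by
  let pb : PowerBasis ℤ (𝓞 K) :=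
    { gen := b 1
      dim := 2
      basis := b
      basis_eq_pow := by
        intro i
        fin_cases i
        · simpa using hb
        · simp }
  have hmin : minpoly ℤ (b 1) = .X ^ 2 - .C t * .X + .C n := by
    open Polynomial in
    have hmon : (X ^ 2 - C t * X + C n : ℤ[X]).Monic := by monicity!
    have hdeg : (X ^ 2 - C t * X + C n : ℤ[X]).natDegree = 2 := by compute_degree!
    have hdvd : minpoly ℤ (b 1) ∣ (X ^ 2 - C t * X + C n : ℤ[X]) := by
      refine minpoly.isIntegrallyClosed_dvd (RingOfIntegers.isIntegral _) ?_
      simp [hθ]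
    have hd2 : (minpoly ℤ (b 1)).natDegree = 2 := pb.natDegree_minpoly
    exact (Polynomial.eq_of_monic_of_dvd_of_natDegree_le
      (minpoly.monic (RingOfIntegers.isIntegral _)) hmon hdvd (by rw [hdeg, hd2])).symm
  exact pb.liftEquiv.trans (Equiv.subtypeEquivRight fun c ↦ by
    rw [show pb.gen = b 1 from rfl, hmin]
    simp)

/-- Ideals of prime norm `p` correspond to ring homomorphisms to `ZMod p`. -/
noncomputable def idealEquivHom (p : ℕ) [Fact p.Prime] :
    {I : Ideal (𝓞 K) // Ideal.absNorm I = p} ≃ (𝓞 K →ₐ[ℤ] ZMod p) := by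
  refine (Equiv.ofBijective (fun φ : 𝓞 K →ₐ[ℤ] ZMod p ↦
    (⟨RingHom.ker φ, ?_⟩ : {I : Ideal (𝓞 K) // Ideal.absNorm I = p})) ⟨?_, ?_⟩).symm
  · have hs : Function.Surjective φ := fun c ↦ ⟨(c.val : 𝓞 K), by rw [map_natCast, ZMod.natCast_zmod_val]⟩
    have e := RingHom.quotientKerEquivOfSurjective (f := (φ : 𝓞 K →+* ZMod p)) hs
    rw [Ideal.absNorm_apply, Submodule.cardQuot_apply]
    exact (Nat.card_congr e.toEquiv).trans (Nat.card_zmod p)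
  -- A map to `ZMod p` is determined by its kernel: `x` minus an integer representing `φ x` lies in
  -- it.
  · intro φ ψ h
    have hk : RingHom.ker φ = RingHom.ker ψ := congrArg Subtype.val h
    ext x
    have h1 : x - ((φ x).val : 𝓞 K) ∈ RingHom.ker φ := by
      rw [RingHom.mem_ker, map_sub, map_natCast, ZMod.natCast_zmod_val, sub_self]
    rw [hk, RingHom.mem_ker, map_sub, map_natCast, ZMod.natCast_zmod_val, sub_eq_zero] at h1
    exact h1.symm
  · rintro ⟨I, hI⟩
    have hcard : Nat.card (𝓞 K ⧸ I) = p := by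
      rw [← Submodule.cardQuot_apply, ← Ideal.absNorm_apply, hI]
    have : Finite (𝓞 K ⧸ I) := Nat.finite_of_card_ne_zero (by
      rw [hcard]; exact (Fact.out : p.Prime).ne_zero)
    have : Fintype (𝓞 K ⧸ I) := Fintype.ofFinite _
    let e : ZMod p ≃+* (𝓞 K ⧸ I) :=
      ZMod.ringEquivOfPrime _ Fact.out (by rw [← Nat.card_eq_fintype_card, hcard])
    refine ⟨((e.symm : (𝓞 K ⧸ I) →+* ZMod p).comp (Ideal.Quotient.mk I)).toIntAlgHom, ?_⟩
    apply Subtype.ext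
    ext x
    simp [RingHom.mem_ker, Ideal.Quotient.eq_zero_iff_mem]

end field

end QuadLambert

/-! ### Counting ideals: multiplicativity and the splitting law -/

namespace QuadLambert

open NumberField Module

theorem kroneckerSym_mul (D : ℤ) {m n : ℕ} (hm : m ≠ 0) (hn : n ≠ 0) :
    kroneckerSym D (m * n) = kroneckerSym D m * kroneckerSym D n := by
  have h2 : Nat.Prime 2 := Nat.prime_two
  have hdm : 2 ^ padicValNat 2 m ∣ m := pow_padicValNat_dvd
  have hdn : 2 ^ padicValNat 2 n ∣ n := pow_padicValNat_dvd
  rw [kroneckerSym, kroneckerSym, kroneckerSym, padicValNat.mul hm hn, pow_add, pow_add,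
    Nat.mul_div_mul_comm hdm hdn, jacobiSym.mul_right']
  · ring
  · exact (Nat.div_pos (Nat.le_of_dvd (Nat.pos_of_ne_zero hm) hdm) (by positivity)).ne'
  · exact (Nat.div_pos (Nat.le_of_dvd (Nat.pos_of_ne_zero hn) hdn) (by positivity)).ne'

theorem kroneckerSym_one (D : ℤ) : kroneckerSym D 1 = 1 := by simp [kroneckerSym]

theorem kroneckerSym_of_odd (D : ℤ) {n : ℕ} (hn : Odd n) : kroneckerSym D n = jacobiSym D n := by
  have : padicValNat 2 n = 0 := padicValNat.eq_zero_of_not_dvd (by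
    rw [← even_iff_two_dvd]; exact Nat.not_even_iff_odd.mpr hn)
  simp [kroneckerSym, this]

theorem kroneckerSym_two (D : ℤ) : kroneckerSym D 2 = ZMod.χ₈ (D : ZMod 8) := by
  simp [kroneckerSym]

theorem kroneckerSym_pow (D : ℤ) {m : ℕ} (hm : m ≠ 0) (k : ℕ) :
    kroneckerSym D (m ^ k) = kroneckerSym D m ^ k := by
  induction k with
  | zero => simp [kroneckerSym_one]
  | succ k ih => rw [pow_succ, kroneckerSym_mul D (pow_ne_zero _ hm) hm, ih, pow_succ]

/-- The roots depend on `t` and `n` modulo `2` only, but the symbol at `2` sees `t² - 4n` modulo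
`8`, so the check runs over all residues modulo `8`. -/
theorem card_roots_two : ∀ t n : ZMod 8, (Fintype.card {c : ZMod 2 // c ^ 2 -
    (ZMod.castHom (show 2 ∣ 8 by norm_num) (ZMod 2) t) * c +
    (ZMod.castHom (show 2 ∣ 8 by norm_num) (ZMod 2) n) = 0} : ℤ) =
    1 + ZMod.χ₈ (t ^ 2 - 4 * n) := by
  decide

/-- The number of roots of `X² - tX + n` modulo `p` is `1 + (D / p)`. -/
theorem card_roots_eq (t n : ℤ) (p : ℕ) [hp : Fact p.Prime] :
    (Nat.card {c : ZMod p // c ^ 2 - t * c + n = 0} : ℤ) =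
      1 + kroneckerSym (t ^ 2 - 4 * n) p := by
  rcases hp.out.eq_two_or_odd' with rfl | hodd
  · rw [kroneckerSym_two]
    have := card_roots_two t n
    rw [← Nat.card_eq_fintype_card] at this
    simpa using this
  · rw [kroneckerSym_of_odd _ hodd, ← jacobiSym.legendreSym.to_jacobiSym,
      add_comm, ← legendreSym.card_sqrts p (by rintro rfl; exact absurd hodd (by decide))]
    have h2 : (2 : ZMod p) ≠ 0 := by
      intro h
      have : (p : ℕ) ∣ 2 := (ZMod.natCast_eq_zero_iff 2 p).mp (by exact_mod_cast h)
      have h3 := (Nat.prime_dvd_prime_iff_eq hp.out Nat.prime_two).mp this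
      rw [h3] at hodd
      exact absurd hodd (by decide)
    -- For odd `p`, completing the square turns roots into square roots of the discriminant.
    have e : {c : ZMod p // c ^ 2 - t * c + n = 0} ≃
        {x : ZMod p // x ^ 2 = ((t ^ 2 - 4 * n : ℤ) : ZMod p)} :=
      { toFun := fun c ↦ ⟨2 * c.1 - t, by push_cast; linear_combination 4 * c.2⟩
        invFun := fun x ↦ ⟨(x.1 + t) / 2, by
          have := x.2
          push_cast at this
          field_simp
          linear_combination this⟩
        left_inv := fun c ↦ by ext; field_simp; ring
        right_inv := fun x ↦ by ext; field_simp; ring }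
    rw [Nat.card_congr e]
    exact congrArg _ (Nat.card_eq_card_toFinset
      {x : ZMod p | x ^ 2 = ((t ^ 2 - 4 * n : ℤ) : ZMod p)})

section field

variable (K : Type*) [Field K] [NumberField K]

theorem idealCount_one : idealCount K 1 = 1 := by
  rw [idealCount, Nat.card_eq_one_iff_unique]
  refine ⟨⟨fun I J ↦ ?_⟩, ⟨⟨⊤, Ideal.absNorm_top⟩⟩⟩
  apply Subtype.ext
  rw [Ideal.absNorm_eq_one_iff.mp I.2, Ideal.absNorm_eq_one_iff.mp J.2]

theorem idealCount_prime (hK : finrank ℚ K = 2) (p : ℕ) [Fact p.Prime] :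
    (idealCount K p : ℤ) = 1 + kroneckerSym (discr K) p := by
  obtain ⟨b, hb⟩ := exists_basis_one K hK
  have hθ := quadratic_relation b hb
  set t := b.repr (b 1 ^ 2) 1
  set n := -b.repr (b 1 ^ 2) 0 with hn
  have hθ' : b 1 ^ 2 = t * b 1 - n := by rw [hθ, hn]; push_cast; ring
  rw [discr_eq_of_basis b hb hθ', ← card_roots_eq, idealCount,
    Nat.card_congr ((idealEquivHom p).trans (homEquivRoots b hb hθ' p))]

variable {K}

/-- The factors are `gcd(A, m)` and `gcd(A, n)`. Their product lies in `A` because `mn = N(A) ∈ A`,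
and contains `A` by a Bézout relation between `m` and `n`. -/
theorem absNorm_coprime_mul_sup {m n : ℕ} (hmn : m.Coprime n) {A : Ideal (𝓞 K)}
    (hA : Ideal.absNorm A = m * n) :
    (A ⊔ Ideal.span {(m : 𝓞 K)}) * (A ⊔ Ideal.span {(n : 𝓞 K)}) = A := by
  have hmem : ((m : 𝓞 K) * n) ∈ A := by
    have := Ideal.absNorm_mem A
    rw [hA] at this
    exact_mod_cast this
  apply le_antisymm
  · rw [Ideal.sup_mul, Ideal.mul_sup, Ideal.mul_sup]
    refine sup_le (sup_le Ideal.mul_le_left Ideal.mul_le_left) (sup_le Ideal.mul_le_right ?_)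
    rw [Ideal.span_singleton_mul_span_singleton, Ideal.span_singleton_le_iff_mem]
    exact hmem
  · obtain ⟨u, v, huv⟩ := Nat.isCoprime_iff_coprime.mpr hmn
    have huv' : (u : 𝓞 K) * m + v * n = 1 := by exact_mod_cast congrArg (Int.cast : ℤ → 𝓞 K) huv
    intro x hx
    have hx2 : x = (u * m) * x + x * (v * n) := by linear_combination -x * huv'
    rw [hx2]
    refine Ideal.add_mem _ (Ideal.mul_mem_mul ?_ ?_) (Ideal.mul_mem_mul ?_ ?_)
    · exact Ideal.mem_sup_right (Ideal.mul_mem_left _ _ (Ideal.mem_span_singleton_self _))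
    · exact Ideal.mem_sup_left hx
    · exact Ideal.mem_sup_left hx
    · exact Ideal.mem_sup_right (Ideal.mul_mem_left _ _ (Ideal.mem_span_singleton_self _))

theorem absNorm_dvd_pow_of_natCast_mem {I : Ideal (𝓞 K)} {m : ℕ} (h : (m : 𝓞 K) ∈ I) :
    Ideal.absNorm I ∣ m ^ finrank ℤ (𝓞 K) := by
  have := Ideal.absNorm_dvd_absNorm_of_le ((Ideal.span_singleton_le_iff_mem I).mpr h)
  rwa [Ideal.absNorm_span_natCast] at this

theorem isCoprime_of_absNorm {I J : Ideal (𝓞 K)} {m n : ℕ} (hmn : m.Coprime n)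
    (hI : Ideal.absNorm I = m) (hJ : Ideal.absNorm J = n) : IsCoprime I J := by
  rw [Ideal.isCoprime_iff_exists]
  obtain ⟨u, v, huv⟩ := Nat.isCoprime_iff_coprime.mpr hmn
  refine ⟨u * m, Ideal.mul_mem_left _ _ ?_, v * n, Ideal.mul_mem_left _ _ ?_, ?_⟩
  · rw [← hI]; exact Ideal.absNorm_mem I
  · rw [← hJ]; exact Ideal.absNorm_mem J
  · exact_mod_cast congrArg (Int.cast : ℤ → 𝓞 K) huv

variable (K)

/-- Multiplication maps pairs of ideals of norms `m` and `n` to ideals of norm `mn`. It is injective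
because ideals of coprime norms are coprime, and surjective by splitting `A` into its gcds with `m`
and `n`. -/
theorem idealCount_mul {m n : ℕ} (hmn : m.Coprime n) (hm : m ≠ 0) (hn : n ≠ 0) :
    idealCount K (m * n) = idealCount K m * idealCount K n := by
  rw [idealCount, idealCount, idealCount, ← Nat.card_prod]
  symm
  refine Nat.card_congr (Equiv.ofBijective (fun q ↦ ⟨q.1.1 * q.2.1, by
    rw [map_mul, q.1.2, q.2.2]⟩) ⟨?_, ?_⟩)
  · rintro ⟨⟨I, hI⟩, ⟨J, hJ⟩⟩ ⟨⟨I', hI'⟩, ⟨J', hJ'⟩⟩ h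
    have h' : I * J = I' * J' := congrArg Subtype.val h
    have d1 : I ∣ I' := (isCoprime_of_absNorm hmn hI hJ').dvd_of_dvd_mul_right
      (h' ▸ dvd_mul_right I J)
    have d2 : I' ∣ I := (isCoprime_of_absNorm hmn hI' hJ).dvd_of_dvd_mul_right
      (h' ▸ dvd_mul_right I' J')
    have hII : I = I' := dvd_antisymm d1 d2
    have hI0 : I ≠ ⊥ := by rintro rfl; rw [Ideal.absNorm_bot] at hI; exact hm hI.symm
    subst hII
    have hJJ : J = J' := mul_left_cancel₀ hI0 h'
    subst hJJ
    rfl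
  · rintro ⟨A, hA⟩
    set I := A ⊔ Ideal.span {(m : 𝓞 K)} with hI
    set J := A ⊔ Ideal.span {(n : 𝓞 K)} with hJ
    have hIJ : I * J = A := absNorm_coprime_mul_sup hmn hA
    have hN : Ideal.absNorm I * Ideal.absNorm J = m * n := by rw [← map_mul, hIJ, hA]
    -- `I` contains `m`, so its norm divides a power of `m` and is prime to `n`; with `N(I) N(J) =
    -- mn` this forces the two norms.
    have c1 : (Ideal.absNorm I).Coprime n := Nat.Coprime.coprime_dvd_left
      (absNorm_dvd_pow_of_natCast_mem
        (Ideal.mem_sup_right (Ideal.mem_span_singleton_self _))) (hmn.pow_left _)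
    have c2 : (Ideal.absNorm J).Coprime m := Nat.Coprime.coprime_dvd_left
      (absNorm_dvd_pow_of_natCast_mem
        (Ideal.mem_sup_right (Ideal.mem_span_singleton_self _))) (hmn.symm.pow_left _)
    have d1 : Ideal.absNorm I ∣ m := c1.dvd_of_dvd_mul_right (hN ▸ dvd_mul_right _ _)
    have d2 : Ideal.absNorm J ∣ n := c2.dvd_of_dvd_mul_left (hN ▸ dvd_mul_left _ _)
    have l1 := Nat.le_of_dvd (Nat.pos_of_ne_zero hm) d1
    have l2 := Nat.le_of_dvd (Nat.pos_of_ne_zero hn) d2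
    have e1 : Ideal.absNorm I = m := by
      by_contra hne
      have : Ideal.absNorm I < m := lt_of_le_of_ne l1 hne
      have h3 : Ideal.absNorm I * Ideal.absNorm J < m * n :=
        Nat.mul_lt_mul_of_lt_of_le this l2 (Nat.pos_of_ne_zero hn)
      omega
    have e2 : Ideal.absNorm J = n := by
      rw [e1] at hN
      exact Nat.eq_of_mul_eq_mul_left (Nat.pos_of_ne_zero hm) hN
    exact ⟨⟨⟨I, e1⟩, ⟨J, e2⟩⟩, Subtype.ext hIJ⟩

variable {K}

theorem ne_bot_of_absNorm_eq_pow {p : ℕ} [hp : Fact p.Prime] {k : ℕ} {I : Ideal (𝓞 K)}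
    (hI : Ideal.absNorm I = p ^ k) : I ≠ ⊥ := by
  rintro rfl
  rw [Ideal.absNorm_bot] at hI
  exact pow_ne_zero k hp.out.ne_zero hI.symm

theorem isMaximal_of_absNorm_prime {p : ℕ} [hp : Fact p.Prime] {I : Ideal (𝓞 K)}
    (hI : Ideal.absNorm I = p) : I.IsMaximal := by
  have := Ideal.isPrime_of_irreducible_absNorm (I := I) (by rw [hI]; exact hp.out.prime.irreducible)
  exact this.isMaximal (ne_bot_of_absNorm_eq_pow (k := 1) (by rw [hI, pow_one]))

/-- A maximal ideal above an ideal of norm a power of `p` contains `p`. -/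
theorem exists_maximal_of_absNorm_eq_pow {p : ℕ} [hp : Fact p.Prime] {k : ℕ} {I : Ideal (𝓞 K)}
    (hI : Ideal.absNorm I = p ^ (k + 1)) : ∃ Q : Ideal (𝓞 K), Q.IsMaximal ∧ (p : 𝓞 K) ∈ Q ∧ Q ∣ I := by
  obtain ⟨Q, hQ, hle⟩ := Ideal.exists_le_maximal I (by
    rintro rfl
    rw [Ideal.absNorm_top] at hI
    exact (Nat.one_lt_pow (Nat.succ_ne_zero k) hp.out.one_lt).ne hI)
  refine ⟨Q, hQ, ?_, Ideal.dvd_iff_le.mpr hle⟩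
  have h := hle (Ideal.absNorm_mem I)
  rw [hI] at h
  push_cast at h
  exact hQ.isPrime.mem_of_pow_mem _ h

variable (K)

/-- Without ideals of norm `p`, the ideal `(p)` of norm `p²` is the only prime above `p`, and it
divides every ideal of norm `p^(k+2)`. Cancelling it is a bijection. -/
theorem idealCount_pow_of_inert (hK : finrank ℚ K = 2) (p : ℕ) [hp : Fact p.Prime]
    (h0 : idealCount K p = 0) (k : ℕ) :
    idealCount K (p ^ (k + 2)) = idealCount K (p ^ k) := by
  have hr : finrank ℤ (𝓞 K) = 2 := by rw [RingOfIntegers.rank, hK]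
  have hfin : Finite {I : Ideal (𝓞 K) // Ideal.absNorm I = p} :=
    (Ideal.finite_setOfPred_absNorm_eq p).to_subtype
  have hempty : ∀ I : Ideal (𝓞 K), Ideal.absNorm I ≠ p := by
    intro I hI
    have : IsEmpty {I : Ideal (𝓞 K) // Ideal.absNorm I = p} := Finite.card_eq_zero_iff.mp h0
    exact this.false ⟨I, hI⟩
  set P : Ideal (𝓞 K) := Ideal.span {(p : 𝓞 K)} with hP
  have hNP : Ideal.absNorm P = p ^ 2 := by rw [hP, Ideal.absNorm_span_natCast, hr]
  have hP0 : P ≠ ⊥ := ne_bot_of_absNorm_eq_pow hNP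
  symm
  refine Nat.card_congr (Equiv.ofBijective (fun q ↦ ⟨P * q.1, by
    rw [map_mul, q.2, hNP, ← pow_add, add_comm]⟩) ⟨?_, ?_⟩)
  · rintro ⟨I, hI⟩ ⟨J, hJ⟩ h
    exact Subtype.ext (mul_left_cancel₀ hP0 (congrArg Subtype.val h))
  · rintro ⟨I, hI⟩
    obtain ⟨Q, hQ, hpQ, hQI⟩ := exists_maximal_of_absNorm_eq_pow hI
    have hQP : Q = P := by
      have hle : P ≤ Q := (Ideal.span_singleton_le_iff_mem Q).mpr hpQ
      obtain ⟨R, hR⟩ := Ideal.dvd_iff_le.mpr hle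
      have hN : Ideal.absNorm Q * Ideal.absNorm R = p ^ 2 := by rw [← map_mul, ← hR, hNP]
      obtain ⟨i, hi, hiQ⟩ := (Nat.dvd_prime_pow hp.out).mp (Dvd.intro _ hN)
      have hQ1 : Ideal.absNorm Q ≠ 1 := fun h ↦ hQ.ne_top (Ideal.absNorm_eq_one_iff.mp h)
      have hi2 : i = 2 := by
        interval_cases i
        · exact absurd (by simpa using hiQ) hQ1
        · exact absurd (by simpa using hiQ) (hempty Q)
        · rfl
      rw [hiQ, hi2] at hN
      have hR1 : Ideal.absNorm R = 1 := by
        have := pow_pos hp.out.pos 2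
        exact Nat.eq_of_mul_eq_mul_left this (by rw [hN, mul_one])
      rw [Ideal.absNorm_eq_one_iff.mp hR1, Ideal.mul_top] at hR
      exact hR.symm
    obtain ⟨J, hJ⟩ := hQI
    rw [hQP] at hJ
    refine ⟨⟨J, ?_⟩, Subtype.ext hJ.symm⟩
    rw [hJ, map_mul, hNP, add_comm, pow_add] at hI
    exact Nat.eq_of_mul_eq_mul_left (pow_pos hp.out.pos 2) hI

theorem idealCount_eq_ncard (m : ℕ) :
    idealCount K m = {I : Ideal (𝓞 K) | Ideal.absNorm I = m}.ncard := rfl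

/-- Here `(p) = P P'` with both factors of norm `p`. The ideals of norm `p^(k+1)` are the multiples
by `P` of those of norm `p^k`, together with `P'^(k+1)`, which is new exactly when `P' ≠ P`. So the
count grows by the same `0` or `1` at each step, and the step from `1` to `p` identifies it as
`v_K(p) - 1`. -/
theorem idealCount_pow_of_not_inert (hK : finrank ℚ K = 2) (p : ℕ) [hp : Fact p.Prime]
    (h0 : idealCount K p ≠ 0) (k : ℕ) :
    idealCount K (p ^ (k + 1)) + 1 = idealCount K (p ^ k) + idealCount K p := by
  have hr : finrank ℤ (𝓞 K) = 2 := by rw [RingOfIntegers.rank, hK]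
  have hfin (m : ℕ) (hm : m ≠ 0) : {I : Ideal (𝓞 K) | Ideal.absNorm I = m}.Finite :=
    Ideal.finite_setOfPred_absNorm_eq m
  obtain ⟨⟨P, hNP⟩⟩ : Nonempty {I : Ideal (𝓞 K) // Ideal.absNorm I = p} := by
    by_contra h
    rw [not_nonempty_iff] at h
    exact h0 Nat.card_of_isEmpty
  have hPmax := isMaximal_of_absNorm_prime hNP
  have hP0 : P ≠ ⊥ := ne_bot_of_absNorm_eq_pow (k := 1) (by rw [hNP, pow_one])
  obtain ⟨P', hPP'⟩ : P ∣ Ideal.span {(p : 𝓞 K)} := by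
    rw [Ideal.dvd_iff_le, Ideal.span_singleton_le_iff_mem]
    have := Ideal.absNorm_mem P
    rwa [hNP] at this
  have hNP' : Ideal.absNorm P' = p := by
    have h := congrArg Ideal.absNorm hPP'
    rw [Ideal.absNorm_span_natCast, hr, map_mul, hNP, sq] at h
    exact (Nat.eq_of_mul_eq_mul_left hp.out.pos h).symm
  have hPmax' := isMaximal_of_absNorm_prime hNP'
  have honly : ∀ Q : Ideal (𝓞 K), Q.IsMaximal → (p : 𝓞 K) ∈ Q → Q = P ∨ Q = P' := by
    intro Q hQ hpQ
    have hle : P * P' ≤ Q := by rw [← hPP']; exact (Ideal.span_singleton_le_iff_mem Q).mpr hpQ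
    rcases hQ.isPrime.mul_le.mp hle with h | h
    · exact Or.inl (hPmax.eq_of_le hQ.ne_top h).symm
    · exact Or.inr (hPmax'.eq_of_le hQ.ne_top h).symm
  have hdvd : ∀ (j : ℕ) (I : Ideal (𝓞 K)), Ideal.absNorm I = p ^ j → P ∣ I ∨ I = P' ^ j := by
    intro j
    induction j with
    | zero =>
      intro I hI
      right
      rw [pow_zero, Ideal.absNorm_eq_one_iff] at hI
      rw [hI, pow_zero, Ideal.one_eq_top]
    | succ j ih =>
      intro I hI
      obtain ⟨Q, hQ, hpQ, hQI⟩ := exists_maximal_of_absNorm_eq_pow hI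
      rcases honly Q hQ hpQ with rfl | rfl
      · exact Or.inl hQI
      · obtain ⟨J, rfl⟩ := hQI
        rw [map_mul, hNP', pow_succ'] at hI
        rcases ih J (Nat.eq_of_mul_eq_mul_left hp.out.pos hI) with h | h
        · exact Or.inl (h.mul_left _)
        · right; rw [h, pow_succ']
  have hstep : ∀ j : ℕ, {I : Ideal (𝓞 K) | Ideal.absNorm I = p ^ (j + 1)} =
      insert (P' ^ (j + 1)) ((P * ·) '' {I : Ideal (𝓞 K) | Ideal.absNorm I = p ^ j}) := by
    intro j
    ext I
    simp only [Set.mem_ofPred_eq, Set.mem_insert_iff, Set.mem_image]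
    constructor
    · intro hI
      rcases hdvd _ I hI with ⟨J, rfl⟩ | h
      · right
        rw [map_mul, hNP, pow_succ'] at hI
        exact ⟨J, Nat.eq_of_mul_eq_mul_left hp.out.pos hI, rfl⟩
      · exact Or.inl h
    · rintro (rfl | ⟨J, hJ, rfl⟩)
      · rw [map_pow, hNP']
      · rw [map_mul, hNP, hJ, pow_succ']
  have hinj : Function.Injective (P * · : Ideal (𝓞 K) → Ideal (𝓞 K)) :=
    fun I J h ↦ mul_left_cancel₀ hP0 h
  have hmem : ∀ j : ℕ, P' ^ (j + 1) ∈ (P * ·) '' {I : Ideal (𝓞 K) | Ideal.absNorm I = p ^ j} ↔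
      P' = P := by
    intro j
    constructor
    · rintro ⟨J, hJ, h⟩
      have h1 : P' ^ (j + 1) ≤ P := Ideal.dvd_iff_le.mp (Dvd.intro _ h)
      have h2 : P' ≤ P := hPmax.isPrime.le_of_pow_le h1
      exact hPmax'.eq_of_le hPmax.ne_top h2
    · intro h
      exact ⟨P ^ j, by simp [hNP], by simp only [h]; rw [pow_succ']⟩
  -- The cardinality on the right encodes the increment `0` (ramified) or `1` (split).
  have hcount : ∀ j : ℕ, idealCount K (p ^ (j + 1)) =
      idealCount K (p ^ j) + Set.ncard (if P' = P then (∅ : Set ℕ) else {0}) := by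
    intro j
    rw [idealCount_eq_ncard, hstep j]
    split_ifs with h
    · rw [Set.insert_eq_of_mem ((hmem j).mpr h), Set.ncard_image_of_injective _ hinj,
        idealCount_eq_ncard]
      simp
    · rw [Set.ncard_insert_of_notMem (fun hm ↦ h ((hmem j).mp hm))
        ((hfin _ (pow_ne_zero j hp.out.ne_zero)).image _), Set.ncard_image_of_injective _ hinj,
        idealCount_eq_ncard]
      simp
  have hc0 := hcount 0
  rw [pow_zero, idealCount_one, zero_add, pow_one] at hc0
  rw [hcount k, hc0]
  ring

theorem kroneckerSym_prime_cases (D : ℤ) (p : ℕ) [hp : Fact p.Prime] :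
    kroneckerSym D p = 0 ∨ kroneckerSym D p = 1 ∨ kroneckerSym D p = -1 := by
  rcases hp.out.eq_two_or_odd' with rfl | hodd
  · rw [kroneckerSym_two]
    generalize (D : ZMod 8) = x
    revert x
    decide
  · rw [kroneckerSym_of_odd _ hodd]
    exact jacobiSym.trichotomy D p

theorem idealCount_prime_pow (hK : finrank ℚ K = 2) (p : ℕ) [hp : Fact p.Prime] (k : ℕ) :
    (idealCount K (p ^ k) : ℤ) = ∑ i ∈ Finset.range (k + 1), kroneckerSym (discr K) p ^ i := by
  have h1 := idealCount_prime K hK p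
  rcases eq_or_ne (idealCount K p) 0 with h0 | h0
  · have hχ : kroneckerSym (discr K) p = -1 := by rw [h0] at h1; push_cast at h1; linarith
    rw [hχ]
    induction k using Nat.twoStepInduction with
    | zero => simp [idealCount_one]
    | one => simp [h0, Finset.sum_range_succ]
    | more k ih _ =>
      rw [idealCount_pow_of_inert K hK p h0, ih, Finset.sum_range_succ _ (k + 2),
        Finset.sum_range_succ _ (k + 1)]
      ring
  · have hχ : ∀ i : ℕ, kroneckerSym (discr K) p ^ (i + 1) = kroneckerSym (discr K) p := by
      have : kroneckerSym (discr K) p ≠ -1 := by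
        intro h
        rw [h] at h1
        apply h0
        have : (idealCount K p : ℤ) = 0 := by rw [h1]; norm_num
        exact_mod_cast this
      intro i
      rcases kroneckerSym_prime_cases (discr K) p with h | h | h
      · simp [h]
      · simp [h]
      · exact absurd h this
    induction k with
    | zero => simp [idealCount_one]
    | succ k ih =>
      have h2 := idealCount_pow_of_not_inert K hK p h0 k
      zify at h2
      rw [Finset.sum_range_succ, hχ, ← ih]
      linarith

/-- The number of ideals of norm `n` in a quadratic field is `∑_{d ∣ n} χ_D(d)`. -/
theorem idealCount_eq_sum (hK : finrank ℚ K = 2) {n : ℕ} (hn : n ≠ 0) :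
    (idealCount K n : ℤ) = ∑ d ∈ n.divisors, kroneckerSym (discr K) d := by
  let χ : ArithmeticFunction ℤ := ⟨fun n ↦ if n = 0 then 0 else kroneckerSym (discr K) n, by simp⟩
  have hχ : ∀ {n : ℕ}, n ≠ 0 → χ n = kroneckerSym (discr K) n := fun {n} h ↦ if_neg h
  let v : ArithmeticFunction ℤ := ⟨fun n ↦ if n = 0 then 0 else idealCount K n, by simp⟩
  have hv : ∀ {n : ℕ}, n ≠ 0 → v n = idealCount K n := fun {n} h ↦ if_neg h
  have mχ : χ.IsMultiplicative := by
    refine ArithmeticFunction.IsMultiplicative.iff_ne_zero.mpr ⟨?_, fun {m n} hm hn _ ↦ ?_⟩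
    · rw [hχ one_ne_zero, kroneckerSym_one]
    · rw [hχ hm, hχ hn, hχ (mul_ne_zero hm hn), kroneckerSym_mul _ hm hn]
  have mv : v.IsMultiplicative := by
    refine ArithmeticFunction.IsMultiplicative.iff_ne_zero.mpr ⟨?_, fun {m n} hm hn h ↦ ?_⟩
    · rw [hv one_ne_zero, idealCount_one]; rfl
    · rw [hv hm, hv hn, hv (mul_ne_zero hm hn), idealCount_mul K h hm hn]
      push_cast
      rfl
  have mζ : ((ArithmeticFunction.zeta : ArithmeticFunction ℤ) * χ).IsMultiplicative :=
    ArithmeticFunction.isMultiplicative_zeta.natCast.mul mχ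
  -- Both sides are multiplicative, so prime powers suffice, where the divisor sum is the geometric
  -- sum already found.
  have key : v = (ArithmeticFunction.zeta : ArithmeticFunction ℤ) * χ := by
    rw [ArithmeticFunction.IsMultiplicative.eq_iff_eq_on_prime_powers _ mv _ mζ]
    intro p k hp
    have : Fact p.Prime := ⟨hp⟩
    rw [hv (pow_ne_zero k hp.ne_zero), idealCount_prime_pow K hK,
      ArithmeticFunction.coe_zeta_mul_apply, Nat.sum_divisors_prime_pow hp]
    refine Finset.sum_congr rfl fun i _ ↦ ?_
    rw [hχ (pow_ne_zero i hp.ne_zero), kroneckerSym_pow _ hp.ne_zero]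
  rw [← hv hn, key, ArithmeticFunction.coe_zeta_mul_apply]
  refine Finset.sum_congr rfl fun d hd ↦ ?_
  rw [hχ (Nat.pos_of_mem_divisors hd).ne']

end field

end QuadLambert

/-! ### Theta series of the ideals of an imaginary quadratic field -/

namespace QuadLambert

open NumberField Module

section field

variable (K : Type*) [Field K] [NumberField K]

/-- `√|D|` as a real number. -/
noncomputable def sqrtDiscr : ℝ := √((discr K).natAbs : ℝ)

theorem sqrtDiscr_pos : 0 < sqrtDiscr K :=
  Real.sqrt_pos.mpr (Nat.cast_pos.mpr (Int.natAbs_pos.mpr (discr_ne_zero K)))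

variable [IsTotallyComplex K]

theorem card_infinitePlace (hK : finrank ℚ K = 2) : Fintype.card (InfinitePlace K) = 1 := by
  have h1 := IsTotallyComplex.finrank (K := K)
  rw [InfinitePlace.card_eq_nrRealPlaces_add_nrComplexPlaces,
    IsTotallyComplex.nrRealPlaces_eq_zero]
  omega

variable {K}

/-- A totally complex field of degree `2` has one infinite place, of multiplicity `2`, so the
product formula for the norm has a single factor. -/
theorem norm_embedding_sq (hK : finrank ℚ K = 2) (σ : K →+* ℂ) (x : 𝓞 K) :
    ‖σ x‖ ^ 2 = Ideal.absNorm (Ideal.span {x}) := by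
  have hs : Subsingleton (InfinitePlace K) :=
    Fintype.card_le_one_iff_subsingleton.mp (card_infinitePlace K hK).le
  have h := InfinitePlace.prod_eq_abs_norm (x : K)
  rw [Fintype.prod_subsingleton _ (InfinitePlace.mk σ), IsTotallyComplex.mult_eq,
    InfinitePlace.apply] at h
  rw [h, Ideal.absNorm_span_singleton, ← Algebra.coe_norm_int]
  rw [Nat.cast_natAbs]
  push_cast
  rfl

/-- A unit has absolute value `1` at the only infinite place, hence is a root of unity. -/
theorem finite_units (hK : finrank ℚ K = 2) : Finite (𝓞 K)ˣ := by
  have hs : Subsingleton (InfinitePlace K) :=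
    Fintype.card_le_one_iff_subsingleton.mp (card_infinitePlace K hK).le
  have htop : ∀ x : (𝓞 K)ˣ, x ∈ Units.torsion K := by
    intro x
    rw [Units.mem_torsion]
    intro w
    have h := norm_embedding_sq hK w.embedding (x : 𝓞 K)
    rw [InfinitePlace.norm_embedding_eq, Ideal.span_singleton_eq_top.mpr x.isUnit,
      Ideal.absNorm_top, Nat.cast_one] at h
    exact (pow_eq_one_iff_of_nonneg (apply_nonneg w _) two_ne_zero).mp h
  exact Finite.of_injective (fun x : (𝓞 K)ˣ ↦ (⟨x, htop x⟩ : Units.torsion K))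
    fun x y h ↦ congrArg Subtype.val h

/-- The image of `θ` is a nonreal root of `X² - tX + n`, so `t` is twice its real part and `t² - 4n`
is `-4` times the square of its imaginary part. -/
theorem im_embedding_sq (b : Basis (Fin 2) ℤ (𝓞 K)) (hb : b 0 = 1) (σ : K →+* ℂ) :
    4 * (σ (b 1)).im ^ 2 = (discr K).natAbs := by
  have hθ := quadratic_relation b hb
  set t := b.repr (b 1 ^ 2) 1
  set n := -b.repr (b 1 ^ 2) 0 with hn
  have hθ' : b 1 ^ 2 = t * b 1 - n := by rw [hθ, hn]; push_cast; ring
  have him : (σ (b 1)).im ≠ 0 := by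
    intro h0
    refine IsTotallyComplex.complexEmbedding_not_isReal σ ?_
    -- If `σ θ` were real, `σ` would be real on `𝓞 K = ℤ + ℤθ` and then on its fraction field,
    -- against `K` being totally complex.
    have hint₀ : ∀ x : 𝓞 K, (starRingEnd ℂ) (σ x) = σ x := by
      intro x
      have hx : (x : K) = (b.repr x 0 : ℤ) + (b.repr x 1 : ℤ) * (b 1 : 𝓞 K) := by
        conv_lhs => rw [← b.sum_repr x, Fin.sum_univ_two, hb]
        simp [zsmul_eq_mul]
      rw [hx, map_add, map_mul, map_intCast, map_intCast, map_add, map_mul,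
        Complex.conj_eq_iff_im.mpr h0]
      simp
    ext x
    obtain ⟨p, q, _, rfl⟩ := IsFractionRing.div_surjective (A := 𝓞 K) x
    rw [ComplexEmbedding.conjugate_coe_eq, map_div₀, map_div₀]
    exact congrArg₂ (· / ·) (hint₀ p) (hint₀ q)
  have hu : σ (b 1) ^ 2 = t * σ (b 1) - n := by
    have : ((b 1 : 𝓞 K) : K) ^ 2 = t * (b 1 : 𝓞 K) - n := by
      simpa using congrArg (algebraMap (𝓞 K) K) hθ'
    rw [← map_pow, this]
    simp
  have h1 := congrArg Complex.im hu
  have h2 := congrArg Complex.re hu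
  simp [sq] at h1 h2
  set x := (σ (b 1)).re
  set z := (σ (b 1)).im
  have hx : 2 * x = t := by
    apply mul_right_cancel₀ him
    linarith
  have hD : ((discr K : ℤ) : ℝ) = -(4 * z ^ 2) := by
    rw [discr_eq_of_basis b hb hθ']
    push_cast
    rw [← hx] at h2 ⊢
    linear_combination (-4) * h2
  rw [Nat.cast_natAbs, Int.cast_abs, hD, abs_neg, abs_of_nonneg (by positivity)]

/-- The theta series `∑_{α ∈ J} exp(-2πt N(α) / (√|D| N(J)))` of an ideal `J`. -/
noncomputable def idealTheta (J : Ideal (𝓞 K)) (t : ℝ) : ℂ :=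
  ∑' α : J, ((Real.exp (-(2 * Real.pi * t / (sqrtDiscr K * Ideal.absNorm J) *
    Ideal.absNorm (Ideal.span {(α : 𝓞 K)}))) : ℝ) : ℂ)

/-- The norm form of an ideal, in coordinates. -/
theorem exists_form (hK : finrank ℚ K = 2) {J : Ideal (𝓞 K)} (hJ : J ≠ ⊥) :
    ∃ (e : ℤ × ℤ ≃ J) (A B C : ℝ), 0 < A ∧ 4 * A * C - B ^ 2 = 4 ∧ ∀ p : ℤ × ℤ,
      2 / (sqrtDiscr K * Ideal.absNorm J) * Ideal.absNorm (Ideal.span {(e p : 𝓞 K)}) =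
        A * p.2 ^ 2 + B * p.2 * p.1 + C * p.1 ^ 2 := by
  obtain ⟨b, hb⟩ := exists_basis_one K hK
  let β : Basis (Fin 2) ℤ J := Ideal.selfBasis b J hJ
  obtain ⟨σ⟩ : Nonempty (K →+* ℂ) := inferInstance
  set z₀ := σ (β 0 : 𝓞 K) with hz₀
  set z₁ := σ (β 1 : 𝓞 K) with hz₁
  -- The inverse covolume of the lattice `σ(J)`; scaling by it gives the norm form determinant `1`,
  -- which makes its theta series self-dual.
  set κ : ℝ := 2 / (sqrtDiscr K * Ideal.absNorm J) with hκ
  have hN : (0 : ℝ) < Ideal.absNorm J := by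
    exact_mod_cast Nat.pos_of_ne_zero (Ideal.absNorm_eq_zero_iff.not.mpr hJ)
  have hs := sqrtDiscr_pos K
  have hκ0 : 0 < κ := by positivity
  have hcoord : ∀ x : 𝓞 K, σ x = (b.repr x 0 : ℝ) + (b.repr x 1 : ℝ) * σ (b 1) := by
    intro x
    have hx : (x : K) = (b.repr x 0 : ℤ) + (b.repr x 1 : ℤ) * (b 1 : 𝓞 K) := by
      conv_lhs => rw [← b.sum_repr x, Fin.sum_univ_two, hb]
      simp [zsmul_eq_mul]
    rw [hx]
    simp
  have hdet : 4 * (z₀.re * z₁.im - z₀.im * z₁.re) ^ 2 =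
      (sqrtDiscr K * Ideal.absNorm J) ^ 2 := by
    have h1 := Ideal.natAbs_det_basis_change b J β
    rw [Basis.det_apply, Matrix.det_fin_two] at h1
    simp only [Basis.toMatrix_apply, Function.comp_apply] at h1
    rw [mul_pow, sqrtDiscr, Real.sq_sqrt (Nat.cast_nonneg _), ← im_embedding_sq b hb σ, ← h1,
      hz₀, hz₁, hcoord (β 0), hcoord (β 1), Nat.cast_natAbs, Int.cast_abs, sq_abs]
    push_cast
    simp
    ring
  let e : ℤ × ℤ ≃ J := ((finTwoArrowEquiv ℤ).symm.trans β.equivFun.symm.toEquiv)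
  have he : ∀ p : ℤ × ℤ, σ (e p : 𝓞 K) = (p.1 : ℝ) * z₀ + (p.2 : ℝ) * z₁ := by
    intro p
    have : (e p : 𝓞 K) = p.1 • (β 0 : 𝓞 K) + p.2 • (β 1 : 𝓞 K) := by
      simp [e, Basis.equivFun_symm_apply, Fin.sum_univ_two]
    rw [this]
    simp [zsmul_eq_mul, hz₀, hz₁]
  have hz1 : z₁ ≠ 0 := by
    intro h
    have h2 : 0 < (sqrtDiscr K * Ideal.absNorm J) ^ 2 := by positivity
    rw [← hdet, h] at h2
    simp at h2
  refine ⟨e, κ * Complex.normSq z₁, κ * (2 * (z₀.re * z₁.re + z₀.im * z₁.im)),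
    κ * Complex.normSq z₀, mul_pos hκ0 (Complex.normSq_pos.mpr hz1), ?_, ?_⟩
  · have : κ ^ 2 * (sqrtDiscr K * Ideal.absNorm J) ^ 2 = 4 := by
      rw [hκ]; field_simp; norm_num
    rw [← hdet] at this
    rw [Complex.normSq_apply, Complex.normSq_apply]
    linear_combination this
  · intro p
    rw [← norm_embedding_sq hK σ, he, ← Complex.normSq_eq_norm_sq, Complex.normSq_apply,
      Complex.normSq_apply, Complex.normSq_apply]
    simp
    ring

theorem summable_idealTheta (hK : finrank ℚ K = 2) {J : Ideal (𝓞 K)} (hJ : J ≠ ⊥) {t : ℝ}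
    (ht : 0 < t) :
    Summable fun α : J ↦ Real.exp (-(2 * Real.pi * t / (sqrtDiscr K * Ideal.absNorm J) *
      Ideal.absNorm (Ideal.span {(α : 𝓞 K)}))) := by
  obtain ⟨e, A, B, C, hA, hdet, h⟩ := exists_form hK hJ
  rw [← e.summable_iff]
  refine (summable_exp_neg_form hA hdet (mul_pos Real.pi_pos ht)).congr fun p ↦ ?_
  rw [← h p, Function.comp_apply]
  congr 1
  ring

/-- The inversion formula of the theta series of an ideal. -/
theorem idealTheta_inv (hK : finrank ℚ K = 2) {J : Ideal (𝓞 K)} (hJ : J ≠ ⊥) {t : ℝ}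
    (ht : 0 < t) : idealTheta J t⁻¹ = t * idealTheta J t := by
  obtain ⟨e, A, B, C, hA, hdet, h⟩ := exists_form hK hJ
  have key : ∀ t : ℝ, idealTheta J t = ∑' p : ℤ × ℤ,
      Complex.exp (-(Real.pi * t * (A * p.2 ^ 2 + B * p.2 * p.1 + C * p.1 ^ 2))) := by
    intro t
    rw [idealTheta, ← e.tsum_eq]
    refine tsum_congr fun p ↦ ?_
    have := h p
    rw [show (Real.pi * t * (A * p.2 ^ 2 + B * p.2 * p.1 + C * p.1 ^ 2) : ℂ) =
      ((Real.pi * t * (A * p.2 ^ 2 + B * p.2 * p.1 + C * p.1 ^ 2) : ℝ) : ℂ) by push_cast; rfl,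
      ← h p, ← Complex.ofReal_neg, ← Complex.ofReal_exp]
    congr 3
    ring
  rw [key, key, tsum_exp_neg_form_inv hA hdet ht]

end field

end QuadLambert

/-! ### The theta series of an imaginary quadratic field -/

namespace QuadLambert

open NumberField Module nonZeroDivisors

theorem hasSum_ne_zero {A : Type*} [Zero A] {f : A → ℂ} {a : ℂ} (h : HasSum f a) :
    HasSum (fun x : {x : A // x ≠ 0} ↦ f x) (a - f 0) := by
  classical
  refine (hasSum_subtype_iff_indicator (s := {x : A | x ≠ 0})).mpr ?_
  have e : {x : A | x ≠ 0}.indicator f = fun n ↦ if n = 0 then 0 else f n := by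
    funext x
    by_cases hx : x = 0 <;> simp [hx]
  rw [e]
  exact hasSum_ite_sub_hasSum h 0

section field

variable {K : Type*} [Field K] [NumberField K]

/-- An ideal in the inverse of a given class. -/
noncomputable def invRep (C : ClassGroup (𝓞 K)) : (Ideal (𝓞 K))⁰ :=
  (ClassGroup.mk0_surjective C⁻¹).choose

theorem mk0_invRep (C : ClassGroup (𝓞 K)) : ClassGroup.mk0 (invRep C) = C⁻¹ :=
  (ClassGroup.mk0_surjective C⁻¹).choose_spec

theorem invRep_ne_bot (C : ClassGroup (𝓞 K)) : (invRep C : Ideal (𝓞 K)) ≠ ⊥ :=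
  nonZeroDivisors.coe_ne_zero _

theorem exists_span_eq_mul_invRep (I : (Ideal (𝓞 K))⁰) :
    ∃ α : 𝓞 K, Ideal.span {α} = (I : Ideal (𝓞 K)) * invRep (ClassGroup.mk0 I) := by
  have h : ClassGroup.mk0 (I * invRep (ClassGroup.mk0 I)) = 1 := by
    rw [map_mul, mk0_invRep, mul_inv_cancel]
  have h2 := (ClassGroup.mk0_eq_one_iff (I * invRep (ClassGroup.mk0 I)).2).mp h
  obtain ⟨α, hα⟩ := h2.principal
  exact ⟨α, hα.symm⟩

/-- A generator of `I · J`, where `J` is the chosen ideal in the inverse class of `I`. -/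
noncomputable def idealGen (I : (Ideal (𝓞 K))⁰) : 𝓞 K := (exists_span_eq_mul_invRep I).choose

theorem span_idealGen (I : (Ideal (𝓞 K))⁰) :
    Ideal.span {idealGen I} = (I : Ideal (𝓞 K)) * invRep (ClassGroup.mk0 I) :=
  (exists_span_eq_mul_invRep I).choose_spec

theorem span_unit_mul {R : Type*} [CommRing R] (u : Rˣ) (α : R) :
    Ideal.span {(u : R) * α} = Ideal.span {α} := by
  rw [mul_comm]
  exact Ideal.span_singleton_mul_right_unit u.isUnit α

/-- Nonzero elements of the chosen ideals correspond to pairs of a unit and a nonzero ideal. -/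
noncomputable def unitIdealEquiv : (𝓞 K)ˣ × (Ideal (𝓞 K))⁰ ≃
    Σ C : ClassGroup (𝓞 K), {α : (invRep C : Ideal (𝓞 K)) // α ≠ 0} := by
  have hne : ∀ (u : (𝓞 K)ˣ) (I : (Ideal (𝓞 K))⁰), (u : 𝓞 K) * idealGen I ≠ 0 := by
    intro u I h
    have h2 := span_idealGen I
    rw [← span_unit_mul u, h, Ideal.span_singleton_zero] at h2
    exact mul_ne_zero (nonZeroDivisors.coe_ne_zero I) (invRep_ne_bot _) h2.symm
  have hmem : ∀ (u : (𝓞 K)ˣ) (I : (Ideal (𝓞 K))⁰),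
      (u : 𝓞 K) * idealGen I ∈ (invRep (ClassGroup.mk0 I) : Ideal (𝓞 K)) := by
    intro u I
    rw [← Ideal.span_singleton_le_iff_mem, span_unit_mul, span_idealGen]
    exact Ideal.mul_le_right
  refine Equiv.ofBijective (fun q ↦ ⟨ClassGroup.mk0 q.2, ⟨⟨q.1 * idealGen q.2, hmem q.1 q.2⟩,
    fun h ↦ hne q.1 q.2 (congrArg Subtype.val h)⟩⟩) ⟨?_, ?_⟩
  · rintro ⟨u, I⟩ ⟨v, J⟩ h
    have hC : ClassGroup.mk0 I = ClassGroup.mk0 J := congrArg Sigma.fst h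
    have hval : (u : 𝓞 K) * idealGen I = v * idealGen J :=
      congrArg (fun x : Σ C : ClassGroup (𝓞 K), {α : (invRep C : Ideal (𝓞 K)) // α ≠ 0} ↦
        ((x.2.1 : 𝓞 K))) h
    have hIJ : I = J := by
      have h1 := congrArg (fun x : 𝓞 K ↦ Ideal.span {x}) hval
      simp only [span_unit_mul, span_idealGen, hC] at h1
      exact Subtype.ext (mul_right_cancel₀ (invRep_ne_bot _) h1)
    subst hIJ
    have h0 : idealGen I ≠ 0 := fun h0 ↦ hne u I (by rw [h0, mul_zero])
    have huv : u = v := Units.ext (mul_right_cancel₀ h0 hval)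
    rw [huv]
  · rintro ⟨C, ⟨⟨α, hα⟩, hα0⟩⟩
    have hα1 : α ≠ 0 := fun h ↦ hα0 (Subtype.ext h)
    obtain ⟨I, hI⟩ : (invRep C : Ideal (𝓞 K)) ∣ Ideal.span {α} := by
      rw [Ideal.dvd_iff_le, Ideal.span_singleton_le_iff_mem]; exact hα
    have hI0 : I ≠ 0 := by
      rintro rfl
      rw [mul_zero] at hI
      exact hα1 (Ideal.span_singleton_eq_bot.mp hI)
    let I' : (Ideal (𝓞 K))⁰ := ⟨I, mem_nonZeroDivisors_of_ne_zero hI0⟩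
    have hcl : ClassGroup.mk0 I' = C := by
      have h1 : ClassGroup.mk0 (invRep C * I') = 1 :=
        (ClassGroup.mk0_eq_one_iff (invRep C * I').2).mpr ⟨α, hI.symm⟩
      rw [map_mul, mk0_invRep] at h1
      exact (inv_mul_eq_one.mp h1).symm
    subst hcl
    have hass : Associated (idealGen I') α := by
      rw [← Ideal.span_singleton_eq_span_singleton, span_idealGen, hI, mul_comm]
    obtain ⟨u, hu⟩ := hass
    refine ⟨(u, I'), ?_⟩
    simp only
    congr 2
    apply Subtype.ext
    change (u : 𝓞 K) * idealGen I' = α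
    rw [← hu, mul_comm]

theorem absNorm_unitIdealEquiv (q : (𝓞 K)ˣ × (Ideal (𝓞 K))⁰) :
    Ideal.absNorm (Ideal.span {((unitIdealEquiv q).2.1 : 𝓞 K)}) =
      Ideal.absNorm (q.2 : Ideal (𝓞 K)) *
        Ideal.absNorm (invRep (unitIdealEquiv q).1 : Ideal (𝓞 K)) := by
  change Ideal.absNorm (Ideal.span {(q.1 : 𝓞 K) * idealGen q.2}) =
    _ * Ideal.absNorm (invRep (ClassGroup.mk0 q.2) : Ideal (𝓞 K))
  rw [span_unit_mul, span_idealGen, map_mul]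

/-- Nonzero ideals, sorted by their norm. -/
noncomputable def idealSigmaEquiv :
    (Σ n : ℕ+, {I : Ideal (𝓞 K) // Ideal.absNorm I = n}) ≃ (Ideal (𝓞 K))⁰ where
  toFun x := ⟨x.2.1, mem_nonZeroDivisors_of_ne_zero (by
    intro h
    have h2 := x.2.2
    rw [h, Ideal.zero_eq_bot, Ideal.absNorm_bot] at h2
    exact x.1.ne_zero h2.symm)⟩
  invFun I := ⟨⟨Ideal.absNorm (I : Ideal (𝓞 K)), Nat.pos_of_ne_zero
    (Ideal.absNorm_eq_zero_iff.not.mpr (nonZeroDivisors.coe_ne_zero I))⟩, ⟨I, rfl⟩⟩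
  left_inv := by
    rintro ⟨⟨n, hn⟩, ⟨I, hI⟩⟩
    simp only [PNat.mk_coe] at hI
    subst hI
    rfl
  right_inv I := rfl

variable [IsTotallyComplex K]

variable (K) in
/-- `h + w ∑ v_K(n) e^{-2πnt/√|D|}`, where `h` is the class number and `w` the number of units. -/
noncomputable def fieldTheta (t : ℝ) : ℂ :=
  Fintype.card (ClassGroup (𝓞 K)) + ∑' n : ℕ+, (Nat.card (𝓞 K)ˣ * idealCount K n : ℂ) *
    Real.exp (-(2 * Real.pi / sqrtDiscr K * n) * t)

theorem hasSum_theta_ne_zero (hK : finrank ℚ K = 2) {J : Ideal (𝓞 K)} (hJ : J ≠ ⊥) {t : ℝ}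
    (ht : 0 < t) :
    HasSum (fun α : {α : J // α ≠ 0} ↦ ((Real.exp (-(2 * Real.pi * t / (sqrtDiscr K *
      Ideal.absNorm J) * Ideal.absNorm (Ideal.span {(α.1 : 𝓞 K)}))) : ℝ) : ℂ))
      (idealTheta J t - 1) := by
  have hs : Summable fun α : J ↦ ((Real.exp (-(2 * Real.pi * t / (sqrtDiscr K *
      Ideal.absNorm J) * Ideal.absNorm (Ideal.span {(α : 𝓞 K)}))) : ℝ) : ℂ) :=
    Complex.ofRealCLM.summable (summable_idealTheta hK hJ ht)
  have h := hasSum_ne_zero hs.hasSum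
  simpa [idealTheta] using h

/-- Nonzero `α` in the chosen ideal `J_C` correspond to pairs of a unit and an ideal `I` with `N(α)
= N(I) N(J_C)`, so the exponent depends on `N(I)` alone; the elements `α = 0` contribute the class
number. Summability of the real exponentials over all classes licenses every rearrangement, which is
why both claims are proved together. -/
theorem fieldTheta_aux (hK : finrank ℚ K = 2) {t : ℝ} (ht : 0 < t) :
    (Summable fun n : ℕ+ ↦ (Nat.card (𝓞 K)ˣ * idealCount K n : ℂ) *
      Real.exp (-(2 * Real.pi / sqrtDiscr K * n) * t)) ∧
    fieldTheta K t = ∑ C : ClassGroup (𝓞 K), idealTheta (invRep C : Ideal (𝓞 K)) t := by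
  have : Finite (𝓞 K)ˣ := finite_units hK
  have hsq := sqrtDiscr_pos K
  let G : (Σ C : ClassGroup (𝓞 K), {α : (invRep C : Ideal (𝓞 K)) // α ≠ 0}) → ℝ := fun x ↦
    Real.exp (-(2 * Real.pi * t / (sqrtDiscr K * Ideal.absNorm (invRep x.1 : Ideal (𝓞 K))) *
      Ideal.absNorm (Ideal.span {(x.2.1 : 𝓞 K)})))
  have hG : Summable G := by
    rw [summable_sigma_of_nonneg fun x ↦ (Real.exp_pos _).le]
    exact ⟨fun C ↦ (summable_idealTheta hK (invRep_ne_bot C) ht).subtype _, Summable.of_finite⟩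
  have hGC : Summable fun x ↦ (G x : ℂ) := Complex.ofRealCLM.summable hG
  have h1 : ∑' x, (G x : ℂ) =
      ∑ C : ClassGroup (𝓞 K), (idealTheta (invRep C : Ideal (𝓞 K)) t - 1) := by
    rw [hGC.tsum_sigma, tsum_fintype]
    exact Finset.sum_congr rfl fun C _ ↦ (hasSum_theta_ne_zero hK (invRep_ne_bot C) ht).tsum_eq
  let E : ℕ → ℂ := fun n ↦ Real.exp (-(2 * Real.pi / sqrtDiscr K * n) * t)
  have hGE : ∀ q, (G (unitIdealEquiv q) : ℂ) = E (Ideal.absNorm (q.2 : Ideal (𝓞 K))) := by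
    intro q
    simp only [G, E, absNorm_unitIdealEquiv]
    have h0 : (Ideal.absNorm (invRep (unitIdealEquiv q).1 : Ideal (𝓞 K)) : ℝ) ≠ 0 :=
      Nat.cast_ne_zero.mpr (Ideal.absNorm_eq_zero_iff.not.mpr (invRep_ne_bot _))
    congr 3
    push_cast
    field_simp
  have hE : Summable fun q : (𝓞 K)ˣ × (Ideal (𝓞 K))⁰ ↦ E (Ideal.absNorm (q.2 : Ideal (𝓞 K))) :=
    ((unitIdealEquiv.summable_iff (f := fun x ↦ (G x : ℂ))).mpr hGC).congr hGE
  have hI : Summable fun I : (Ideal (𝓞 K))⁰ ↦ E (Ideal.absNorm (I : Ideal (𝓞 K))) :=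
    hE.prod_factor 1
  have h2 : ∑' x, (G x : ℂ) =
      Nat.card (𝓞 K)ˣ * ∑' I : (Ideal (𝓞 K))⁰, E (Ideal.absNorm (I : Ideal (𝓞 K))) := by
    rw [← unitIdealEquiv.tsum_eq, tsum_congr hGE, hE.tsum_prod]
    simp only [tsum_const, nsmul_eq_mul]
  have hS : Summable fun x : (Σ n : ℕ+, {I : Ideal (𝓞 K) // Ideal.absNorm I = n}) ↦
      E x.1 := by
    refine ((idealSigmaEquiv.summable_iff).mpr hI).congr fun x ↦ ?_
    exact congrArg E x.2.2.symm ▸ rfl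
  have h3 : ∑' I : (Ideal (𝓞 K))⁰, E (Ideal.absNorm (I : Ideal (𝓞 K))) =
      ∑' n : ℕ+, (idealCount K n : ℂ) * E n := by
    rw [← idealSigmaEquiv.tsum_eq]
    refine (tsum_congr fun x ↦ congrArg E x.2.2).trans ?_
    rw [hS.tsum_sigma]
    simp only [tsum_const, nsmul_eq_mul]
    rfl
  have hsum : Summable fun n : ℕ+ ↦ (idealCount K n : ℂ) * E n := by
    refine hS.sigma.congr fun n ↦ ?_
    simp only [tsum_const, nsmul_eq_mul]
    rfl
  refine ⟨(hsum.mul_left (Nat.card (𝓞 K)ˣ : ℂ)).congr fun n ↦ by rw [← mul_assoc], ?_⟩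
  rw [fieldTheta]
  simp_rw [mul_assoc]
  rw [tsum_mul_left]
  have h4 := h2.symm.trans h1
  rw [h3, Finset.sum_sub_distrib] at h4
  simp only [E] at h4
  rw [h4]
  simp

/-- The inversion formula of the theta series of the field. -/
theorem fieldTheta_inv (hK : finrank ℚ K = 2) {t : ℝ} (ht : 0 < t) :
    fieldTheta K t⁻¹ = t * fieldTheta K t := by
  rw [(fieldTheta_aux hK ht).2, (fieldTheta_aux hK (inv_pos.mpr ht)).2, Finset.mul_sum]
  exact Finset.sum_congr rfl fun C _ ↦ idealTheta_inv hK (invRep_ne_bot C) ht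

end field

end QuadLambert

/-! ### Continuation and functional equation of the Dedekind zeta function -/

namespace QuadLambert

open NumberField Module Complex MeasureTheory Set Asymptotics

/-- A Mellin transform converging everywhere is bounded on vertical strips. -/
theorem exists_norm_mellin_le {f : ℝ → ℂ} (hf : ∀ s : ℂ, MellinConvergent f s) (σ₁ σ₂ : ℝ) :
    ∃ C : ℝ, ∀ s : ℂ, σ₁ ≤ s.re → s.re ≤ σ₂ → ‖mellin f s‖ ≤ C := by
  have hint₀ : ∀ σ : ℝ, IntegrableOn (fun t : ℝ ↦ t ^ (σ - 1) * ‖f t‖) (Ioi 0) := by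
    intro σ
    have h : IntegrableOn (fun t : ℝ ↦ ‖(t : ℂ) ^ ((σ : ℂ) - 1) • f t‖) (Ioi 0) := (hf σ).norm
    refine h.congr_fun (fun t ht ↦ ?_) measurableSet_Ioi
    simp only
    rw [norm_smul, norm_cpow_eq_rpow_re_of_pos ht]
    simp
  refine ⟨∫ t in Ioi (0 : ℝ), (t ^ (σ₁ - 1) * ‖f t‖ + t ^ (σ₂ - 1) * ‖f t‖), fun s h1 h2 ↦ ?_⟩
  rw [mellin]
  refine norm_integral_le_of_norm_le ((hint₀ σ₁).add (hint₀ σ₂)) ?_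
  filter_upwards [self_mem_ae_restrict measurableSet_Ioi] with t ht
  have ht0 : (0 : ℝ) < t := ht
  rw [norm_smul, norm_cpow_eq_rpow_re_of_pos ht0, ← add_mul]
  refine mul_le_mul_of_nonneg_right ?_ (norm_nonneg _)
  rw [sub_re, one_re]
  rcases le_total 1 t with h | h
  · exact (Real.rpow_le_rpow_of_exponent_le h (by linarith)).trans
      (le_add_of_nonneg_left (Real.rpow_nonneg ht0.le _))
  · exact (Real.rpow_le_rpow_of_exponent_ge ht0 h (by linarith)).trans
      (le_add_of_nonneg_right (Real.rpow_nonneg ht0.le _))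

theorem exists_norm_feLambda_le (P : WeakFEPair ℂ) (σ₁ σ₂ : ℝ) :
    ∃ C : ℝ, ∀ s : ℂ, σ₁ ≤ s.re → s.re ≤ σ₂ → ‖P.Λ₀ s‖ ≤ C :=
  exists_norm_mellin_le (fun s ↦ (P.isStrongFEPair_toStrongFEPair.hasMellin s).1) σ₁ σ₂

theorem lseries_eq_tsum_pnat (f : ℕ → ℂ) (s : ℂ) :
    LSeries f s = ∑' n : ℕ+, f n / (n : ℂ) ^ s := by
  rw [LSeries, ← PNat.coe_injective.tsum_eq (f := LSeries.term f s)]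
  · exact tsum_congr fun n ↦ LSeries.term_of_ne_zero n.ne_zero f s
  · intro n hn
    have h0 : n ≠ 0 := by
      rintro rfl
      exact hn (LSeries.term_zero f s)
    exact ⟨⟨n, Nat.pos_of_ne_zero h0⟩, rfl⟩

section expSeries

variable {a : ℕ+ → ℂ} {c : ℝ}

theorem summable_norm_expSeries
    (hs : ∀ t : ℝ, 0 < t → Summable fun n : ℕ+ ↦ a n * (Real.exp (-(c * n) * t) : ℂ)) {t : ℝ}
    (ht : 0 < t) : Summable fun n : ℕ+ ↦ ‖a n‖ * Real.exp (-(c * n) * t) := by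
  refine (hs t ht).norm.congr fun n ↦ ?_
  rw [norm_mul, norm_real, Real.norm_eq_abs, Real.abs_exp]

theorem continuousOn_expSeries (hc : 0 < c)
    (hs : ∀ t : ℝ, 0 < t → Summable fun n : ℕ+ ↦ a n * (Real.exp (-(c * n) * t) : ℂ)) :
    ContinuousOn (fun t : ℝ ↦ ∑' n : ℕ+, a n * (Real.exp (-(c * n) * t) : ℂ)) (Ioi 0) := by
  intro t ht
  have ht0 : (0 : ℝ) < t := ht
  have h : ContinuousOn (fun t : ℝ ↦ ∑' n : ℕ+, a n * (Real.exp (-(c * n) * t) : ℂ))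
      (Ici (t / 2)) := by
    refine continuousOn_tsum (u := fun n : ℕ+ ↦ ‖a n‖ * Real.exp (-(c * n) * (t / 2)))
      (fun n ↦ Continuous.continuousOn (by fun_prop)) (summable_norm_expSeries hs (by positivity))
      fun n x hx ↦ ?_
    rw [norm_mul, norm_real, Real.norm_eq_abs, Real.abs_exp]
    refine mul_le_mul_of_nonneg_left (Real.exp_le_exp.mpr ?_) (norm_nonneg _)
    have hx' : t / 2 ≤ x := hx
    have : 0 ≤ c * n := by positivity
    nlinarith
  exact (h.continuousAt (Ici_mem_nhds (by linarith))).continuousWithinAt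

theorem isBigO_expSeries (hc : 0 < c)
    (hs : ∀ t : ℝ, 0 < t → Summable fun n : ℕ+ ↦ a n * (Real.exp (-(c * n) * t) : ℂ)) (r : ℝ) :
    (fun t : ℝ ↦ ∑' n : ℕ+, a n * (Real.exp (-(c * n) * t) : ℂ)) =O[atTop] (· ^ r) := by
  have h1 : (fun t : ℝ ↦ ∑' n : ℕ+, a n * (Real.exp (-(c * n) * t) : ℂ)) =O[atTop]
      fun t ↦ Real.exp (-c * t) := by
    refine IsBigO.of_bound (Real.exp c * ∑' n : ℕ+, ‖a n‖ * Real.exp (-(c * n) * 1)) ?_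
    filter_upwards [eventually_ge_atTop 1] with t ht
    rw [Real.norm_eq_abs, Real.abs_exp, mul_right_comm, ← Real.exp_add]
    have hS := summable_norm_expSeries hs one_pos
    refine tsum_of_norm_bounded (hS.hasSum.mul_left (Real.exp (c + -c * t))) fun n ↦ ?_
    rw [norm_mul, norm_real, Real.norm_eq_abs, Real.abs_exp, mul_left_comm, ← Real.exp_add]
    refine mul_le_mul_of_nonneg_left (Real.exp_le_exp.mpr ?_) (norm_nonneg _)
    have hn : (1 : ℝ) ≤ n := by exact_mod_cast (one_le : 1 ≤ n)
    -- Expanded, this is `nt ≥ n + t - 1`: the term at `t` is at most its value at `1` times `exp(c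
    -- - ct)`.
    have : 0 ≤ c * ((n - 1) * (t - 1)) := mul_nonneg hc.le (mul_nonneg (by linarith) (by linarith))
    nlinarith
  exact h1.trans (isLittleO_exp_neg_mul_rpow_atTop hc r).isBigO

end expSeries

section field

variable {K : Type*} [Field K] [NumberField K]

variable (K) in
/-- The constant `2π/√|D|`. -/
noncomputable def thetaScale : ℝ := 2 * Real.pi / sqrtDiscr K

variable (K) in
theorem thetaScale_pos : 0 < thetaScale K :=
  div_pos (by positivity) (sqrtDiscr_pos K)

theorem norm_kroneckerSym_le (D : ℤ) (n : ℕ) : ‖(kroneckerSym D n : ℂ)‖ ≤ 1 := by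
  have h : |kroneckerSym D n| ≤ 1 := by
    rw [kroneckerSym, abs_mul, abs_pow]
    have h1 : |ZMod.χ₈ (D : ZMod 8)| ≤ 1 := by
      generalize (D : ZMod 8) = x
      revert x
      decide
    have h2 : |jacobiSym D (n / 2 ^ padicValNat 2 n)| ≤ 1 := by
      rcases jacobiSym.trichotomy D (n / 2 ^ padicValNat 2 n) with h | h | h <;> simp [h]
    exact mul_le_one₀ (pow_le_one₀ (abs_nonneg _) h1) (abs_nonneg _) h2
  rw [norm_intCast]
  exact_mod_cast h

theorem lseriesSummable_kroneckerSym (D : ℤ) {s : ℂ} (hs : 1 < s.re) :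
    LSeriesSummable (fun n ↦ (kroneckerSym D n : ℂ)) s :=
  LSeriesSummable_of_bounded_of_one_lt_re (fun n _ ↦ norm_kroneckerSym_le D n) hs

theorem idealCount_eq_convolution (hK : finrank ℚ K = 2) {n : ℕ} (hn : n ≠ 0) :
    LSeries.convolution 1 (fun n ↦ (kroneckerSym (discr K) n : ℂ)) n = (idealCount K n : ℂ) := by
  have h := idealCount_eq_sum K hK hn
  have h2 : (idealCount K n : ℂ) = ∑ d ∈ n.divisors, (kroneckerSym (discr K) d : ℂ) := by
    exact_mod_cast congrArg (Int.cast : ℤ → ℂ) h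
  rw [h2, LSeries.convolution_def]
  simp only [Pi.one_apply, one_mul]
  exact Nat.sum_divisorsAntidiagonal' (f := fun _ d ↦ (kroneckerSym (discr K) d : ℂ))

theorem lseriesSummable_idealCount (hK : finrank ℚ K = 2) {s : ℂ} (hs : 1 < s.re) :
    LSeriesSummable (fun n ↦ (idealCount K n : ℂ)) s :=
  (LSeriesSummable_congr s fun {_} hn ↦ idealCount_eq_convolution hK hn).mp
    ((LSeriesSummable_one_iff.mpr hs).convolution (lseriesSummable_kroneckerSym _ hs))

theorem dedekindZeta_eq_mul (hK : finrank ℚ K = 2) {s : ℂ} (hs : 1 < s.re) :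
    dedekindZeta K s = riemannZeta s * LSeries (fun n ↦ (kroneckerSym (discr K) n : ℂ)) s := by
  rw [← LSeries_one_eq_riemannZeta hs, ← LSeries_convolution' (LSeriesSummable_one_iff.mpr hs)
    (lseriesSummable_kroneckerSym _ hs)]
  exact LSeries_congr (fun {n} hn ↦ (idealCount_eq_convolution hK hn).symm) s

variable [IsTotallyComplex K]

/-- The theta series as a Mellin pair. -/
noncomputable def thetaPair (hK : finrank ℚ K = 2) : WeakFEPair ℂ :=
  have hs := fun (t : ℝ) (ht : 0 < t) ↦ (fieldTheta_aux hK ht).1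
  have hint₀ : LocallyIntegrableOn (fieldTheta K) (Ioi 0) :=
    (continuousOn_const.add (continuousOn_expSeries (thetaScale_pos K) hs)).locallyIntegrableOn
      measurableSet_Ioi
  have htop : ∀ r : ℝ, (fun t ↦ fieldTheta K t - Fintype.card (ClassGroup (𝓞 K))) =O[atTop]
      (· ^ r) := fun r ↦ by
    simpa [fieldTheta, thetaScale] using isBigO_expSeries (thetaScale_pos K) hs r
  { f := fieldTheta K
    g := fieldTheta K
    k := 1
    ε := 1
    f₀ := Fintype.card (ClassGroup (𝓞 K))
    g₀ := Fintype.card (ClassGroup (𝓞 K))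
    hf_int := hint₀
    hg_int := hint₀
    hk := one_pos
    hε := one_ne_zero
    h_feq := fun x hx ↦ by
      rw [one_div, fieldTheta_inv hK hx, Real.rpow_one, one_mul, smul_eq_mul]
    hf_top := htop
    hg_top := htop }

theorem thetaPair_symm (hK : finrank ℚ K = 2) : (thetaPair hK).symm = thetaPair hK := by
  simp [WeakFEPair.symm, thetaPair]

theorem thetaPair_Λ (hK : finrank ℚ K = 2) {s : ℂ} (hs : 1 < s.re) :
    (thetaPair hK).Λ s =
      Nat.card (𝓞 K)ˣ * ((thetaScale K : ℂ) ^ s)⁻¹ * Gamma s * dedekindZeta K s := by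
  have hm := ((thetaPair hK).hasMellin (s := s) hs).2
  have hc := thetaScale_pos K
  have h := hasSum_mellin (ι := ℕ+) (a := fun n ↦ (Nat.card (𝓞 K)ˣ * idealCount K n : ℂ))
    (p := fun n ↦ thetaScale K * n)
    (F := fun t ↦ fieldTheta K t - Fintype.card (ClassGroup (𝓞 K))) (s := s)
    (fun n ↦ Or.inr (by positivity)) (by linarith)
    (fun t ht ↦ by
      simpa [fieldTheta, thetaScale] using (fieldTheta_aux hK ht).1.hasSum)
    (by
      have h1 := (lseriesSummable_idealCount hK hs).norm
      have h2 := (h1.comp_injective PNat.coe_injective).mul_left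
        (Nat.card (𝓞 K)ˣ / thetaScale K ^ s.re)
      refine h2.congr fun n ↦ ?_
      rw [Function.comp_apply, LSeries.norm_term_eq, if_neg n.ne_zero,
        Real.mul_rpow hc.le (Nat.cast_nonneg _)]
      simp
      field_simp)
  rw [← hm]
  change mellin (fun t ↦ fieldTheta K t - Fintype.card (ClassGroup (𝓞 K))) s = _
  rw [← h.tsum_eq, dedekindZeta, lseries_eq_tsum_pnat, ← tsum_mul_left]
  refine tsum_congr fun n ↦ ?_
  have hn : (n : ℂ) ^ s ≠ 0 := by simp [cpow_eq_zero_iff]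
  have hcs : (thetaScale K : ℂ) ^ s ≠ 0 := by simp [cpow_eq_zero_iff, hc.ne']
  rw [ofReal_mul, mul_cpow_ofReal_nonneg hc.le (Nat.cast_nonneg _), ofReal_natCast]
  change _ = _ * ((idealCount K n : ℂ) / _)
  field_simp

/-- The class number divided by the number of units. -/
noncomputable def thetaResidue (K : Type*) [Field K] [NumberField K] : ℂ :=
  Fintype.card (ClassGroup (𝓞 K)) / Nat.card (𝓞 K)ˣ

/-- An explicit formula for the continued Dedekind zeta function. -/
noncomputable def zetaKExplicit (hK : finrank ℚ K = 2) (s : ℂ) : ℂ :=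
  -- The polar part `1/s` of `Λ` is absorbed through `1 / (s Γ(s)) = 1 / Γ(s + 1)`, so the formula
  -- is regular at `0` and `s = 1` is the only singular point.
  (thetaScale K : ℂ) ^ s * ((thetaPair hK).Λ₀ s / Nat.card (𝓞 K)ˣ * (Gamma s)⁻¹ -
    thetaResidue K * (Gamma (s + 1))⁻¹ - thetaResidue K / (1 - s) * (Gamma s)⁻¹)

theorem card_units_ne_zero (hK : finrank ℚ K = 2) : (Nat.card (𝓞 K)ˣ : ℂ) ≠ 0 := by
  have := finite_units hK
  exact_mod_cast Nat.card_pos.ne'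

theorem zetaKExplicit_eq_Λ (hK : finrank ℚ K = 2) {s : ℂ} (hs : s ≠ 0) :
    zetaKExplicit hK s =
      (thetaScale K : ℂ) ^ s * (Nat.card (𝓞 K)ˣ : ℂ)⁻¹ * (Gamma s)⁻¹ * (thetaPair hK).Λ s := by
  have hw := card_units_ne_zero hK
  rw [zetaKExplicit, Gamma_add_one s hs, WeakFEPair.Λ, thetaResidue, mul_inv]
  change _ = _ * (_ - (1 / s) • (Fintype.card (ClassGroup (𝓞 K)) : ℂ) -
    ((1 : ℂ) / (((1 : ℝ) : ℂ) - s)) • (Fintype.card (ClassGroup (𝓞 K)) : ℂ))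
  rw [ofReal_one, smul_eq_mul, smul_eq_mul]
  ring

theorem zetaKExplicit_eq_dedekindZeta (hK : finrank ℚ K = 2) {s : ℂ} (hs : 1 < s.re) :
    zetaKExplicit hK s = dedekindZeta K s := by
  have hc := thetaScale_pos K
  have hcs : (thetaScale K : ℂ) ^ s ≠ 0 := by simp [cpow_eq_zero_iff, hc.ne']
  have hΓ : Gamma s ≠ 0 := Gamma_ne_zero_of_re_pos (by linarith)
  have hw := card_units_ne_zero hK
  rw [zetaKExplicit_eq_Λ hK (by rintro rfl; simp at hs; linarith), thetaPair_Λ hK hs]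
  field_simp

theorem differentiableAt_zetaKExplicit (hK : finrank ℚ K = 2) {s : ℂ} (hs : s ≠ 1) :
    DifferentiableAt ℂ (zetaKExplicit hK) s := by
  have hc : (thetaScale K : ℂ) ≠ 0 := ofReal_ne_zero.mpr (thetaScale_pos K).ne'
  have h1 : DifferentiableAt ℂ (thetaPair hK).Λ₀ s := (thetaPair hK).differentiable_Λ₀ s
  have h2 : DifferentiableAt ℂ (fun s ↦ (Gamma s)⁻¹) s := differentiable_one_div_Gamma s
  have h3 : DifferentiableAt ℂ (fun s ↦ (Gamma (s + 1))⁻¹) s :=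
    (differentiable_one_div_Gamma.comp (differentiable_id.add_const 1)) s
  have h4 : DifferentiableAt ℂ (fun s ↦ thetaResidue K / (1 - s)) s :=
    (differentiableAt_const _).div (by fun_prop) (sub_ne_zero.mpr hs.symm)
  have h5 : DifferentiableAt ℂ (fun s ↦ (thetaScale K : ℂ) ^ s) s :=
    differentiableAt_id.const_cpow (Or.inl hc)
  exact h5.mul ((((h1.div_const _).mul h2).sub (h3.const_mul _)).sub (h4.mul h2))

/-- Two continuations from `Re s > 1` to `ℂ \ S`, `S` countable, agree off `S`. -/
theorem IsContinuation.eq_of {S : Set ℂ} (hS : S.Countable) (hSc : IsClosed S) {f F G : ℂ → ℂ}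
    (hF : IsContinuation S f F) (hG : IsContinuation S f G) {s : ℂ} (hs : s ∉ S) : F s = G s := by
  have hopen : IsOpen Sᶜ := hSc.isOpen_compl
  have hconn : IsPreconnected Sᶜ :=
    (hS.isConnected_compl_of_one_lt_rank (by simp [rank_real_complex])).isPreconnected
  obtain ⟨z, hz, hzS⟩ : ∃ z : ℂ, 1 < z.re ∧ z ∉ S := by
    obtain ⟨z, hzS, hz⟩ := (hS.dense_compl ℝ).exists_mem_open
      (isOpen_lt continuous_const continuous_re : IsOpen {z : ℂ | 1 < z.re}) ⟨2, by simp⟩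
    exact ⟨z, hz, hzS⟩
  have heq : EqOn F G Sᶜ := by
    refine (hF.1.analyticOnNhd hopen).eqOn_of_preconnected_of_eventuallyEq
      (hG.1.analyticOnNhd hopen) hconn hzS ?_
    filter_upwards [(isOpen_lt continuous_const continuous_re).mem_nhds hz] with w hw
    rw [hF.2 w hw, hG.2 w hw]
  exact heq hs

theorem isContinuation_continuation {S : Set ℂ} {f F : ℂ → ℂ} (h : IsContinuation S f F) :
    IsContinuation S f (continuation S f) := by
  have hex : ∃ F, IsContinuation S f F := ⟨F, h⟩
  rw [continuation, dif_pos hex]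
  exact hex.choose_spec

theorem isContinuation_zetaKExplicit (hK : finrank ℚ K = 2) :
    IsContinuation {1} (dedekindZeta K) (zetaKExplicit hK) :=
  ⟨fun _ hs ↦ (differentiableAt_zetaKExplicit hK hs).differentiableWithinAt,
    fun _ hs ↦ zetaKExplicit_eq_dedekindZeta hK hs⟩

theorem isContinuation_zetaK (hK : finrank ℚ K = 2) :
    IsContinuation {1} (dedekindZeta K) (zetaK K) :=
  isContinuation_continuation (isContinuation_zetaKExplicit hK)

theorem zetaK_eq_explicit (hK : finrank ℚ K = 2) {s : ℂ} (hs : s ≠ 1) :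
    zetaK K s = zetaKExplicit hK s :=
  (isContinuation_zetaK hK).eq_of (countable_singleton 1) isClosed_singleton
    (isContinuation_zetaKExplicit hK) hs

theorem zetaK_eq_dedekindZeta (hK : finrank ℚ K = 2) {s : ℂ} (hs : 1 < s.re) :
    zetaK K s = dedekindZeta K s :=
  (isContinuation_zetaK hK).2 s hs

theorem differentiableAt_zetaK (hK : finrank ℚ K = 2) {s : ℂ} (hs : s ≠ 1) :
    DifferentiableAt ℂ (zetaK K) s :=
  (isContinuation_zetaK hK).1.differentiableAt (isOpen_compl_singleton.mem_nhds hs)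

/-- The functional equation of the Dedekind zeta function of an imaginary quadratic field. -/
theorem zetaK_functional_equation (hK : finrank ℚ K = 2) {w : ℂ} (hw : w.re < 0) :
    zetaK K w = (thetaScale K : ℂ) ^ (2 * w - 1) * (Gamma (1 - w) * (Gamma w)⁻¹) *
      zetaK K (1 - w) := by
  have hc : (thetaScale K : ℂ) ≠ 0 := ofReal_ne_zero.mpr (thetaScale_pos K).ne'
  have h0 : w ≠ 0 := by rintro rfl; simp at hw
  have h1 : w ≠ 1 := by rintro rfl; simp at hw; linarith
  have hΓ : Gamma (1 - w) ≠ 0 := Gamma_ne_zero_of_re_pos (by simp; linarith)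
  have hu := card_units_ne_zero hK
  have hΛ : (thetaPair hK).Λ (1 - w) = (thetaPair hK).Λ w := by
    have h := (thetaPair hK).functional_equation w
    rw [show (thetaPair hK).ε = 1 from rfl, one_smul,
      show ((thetaPair hK).k : ℂ) = 1 from ofReal_one] at h
    rw [h, thetaPair_symm]
  have hpow : (thetaScale K : ℂ) ^ w = (thetaScale K : ℂ) ^ (2 * w - 1) *
      (thetaScale K : ℂ) ^ (1 - w) := by
    rw [← cpow_add _ _ hc]
    congr 1
    ring
  rw [zetaK_eq_explicit hK h1, zetaK_eq_explicit hK (s := 1 - w) (by simpa using h0),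
    zetaKExplicit_eq_Λ hK h0, zetaKExplicit_eq_Λ hK (sub_ne_zero.mpr h1.symm), hΛ, hpow]
  field_simp

end field

end QuadLambert

/-! ### The quadratic L-function -/

namespace QuadLambert

open NumberField Module Complex

theorem χ₈_natAbs (D : ℤ) : ZMod.χ₈ (D.natAbs : ZMod 8) = ZMod.χ₈ (D : ZMod 8) := by
  rcases Int.natAbs_eq D with h | h
  · conv_rhs => rw [h]
    simp
  · have heven : ∀ x : ZMod 8, ZMod.χ₈ (-x) = ZMod.χ₈ x := by decide
    conv_rhs => rw [h]
    rw [Int.cast_neg, heven, Int.cast_natCast]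

/-- Reciprocity is free of signs for `D ≡ 1 mod 4`: when `D` is negative, the sign from `-1` cancels
the one from `|D| ≡ 3 mod 4`. -/
theorem jacobiSym_flip {D : ℤ} (hD : D % 4 = 1) {m : ℕ} (hm : Odd m) :
    jacobiSym D m = jacobiSym m D.natAbs := by
  rcases Int.natAbs_eq D with h | h
  · have h4 : D.natAbs % 4 = 1 := by omega
    conv_lhs => rw [h]
    exact jacobiSym.quadratic_reciprocity_one_mod_four h4 hm
  · have h4 : D.natAbs % 4 = 3 := by omega
    have hodd : Odd D.natAbs := Nat.odd_iff.mpr (by omega)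
    conv_lhs => rw [h]
    rw [jacobiSym.neg _ hm]
    rcases Nat.odd_mod_four_iff.mp (Nat.odd_iff.mp hm) with h1 | h3
    · rw [ZMod.χ₄_nat_one_mod_four h1, one_mul,
        jacobiSym.quadratic_reciprocity_one_mod_four' hodd h1]
    · rw [ZMod.χ₄_nat_three_mod_four h3, jacobiSym.quadratic_reciprocity_three_mod_four h4 h3]
      ring

/-- The odd part of `n` is handled by reciprocity, the power of `2` by `χ₈(D) = χ₈(|D|) = (2 /
|D|)`. -/
theorem kroneckerSym_eq_jacobiSym {D : ℤ} (hD : D % 4 = 1) {n : ℕ} (hn : n ≠ 0) :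
    kroneckerSym D n = jacobiSym n D.natAbs := by
  have hodd : Odd D.natAbs := Nat.odd_iff.mpr (by omega)
  obtain ⟨k, m, hm, rfl⟩ := Nat.exists_eq_two_pow_mul_odd hn
  have hm0 : m ≠ 0 := by rintro rfl; exact absurd hm (by decide)
  rw [kroneckerSym_mul D (by positivity) hm0, kroneckerSym_pow D two_ne_zero, kroneckerSym_two,
    kroneckerSym_of_odd D hm, jacobiSym_flip hD hm, ← χ₈_natAbs, ← jacobiSym.at_two hodd]
  push_cast
  rw [jacobiSym.mul_left, jacobiSym.pow_left]

theorem kroneckerSym_of_even {D : ℤ} (hD : Even D) {n : ℕ} (hn : n ≠ 0) (hn2 : Even n) :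
    kroneckerSym D n = 0 := by
  obtain ⟨m, rfl⟩ := even_iff_two_dvd.mp hn2
  have hm : m ≠ 0 := by rintro rfl; exact hn rfl
  rw [kroneckerSym_mul D two_ne_zero hm, kroneckerSym_two]
  obtain ⟨d, rfl⟩ := even_iff_two_dvd.mp hD
  push_cast
  have : ∀ x : ZMod 8, ZMod.χ₈ (2 * x) = 0 := by decide
  rw [this, zero_mul]

/-- For even `D` the symbol vanishes at even `n`, and at odd `n` the Jacobi symbol has period `4|D|`
in its lower entry. For odd `D`, reciprocity moves `n` to the upper entry. The period need not be
minimal. -/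
theorem kroneckerSym_add {D : ℤ} (hD : D % 4 = 0 ∨ D % 4 = 1) {n : ℕ} (hn : n ≠ 0) :
    kroneckerSym D (n + 4 * D.natAbs) = kroneckerSym D n := by
  rcases hD with hD | hD
  · have hev : Even D := Int.even_iff.mpr (by omega)
    rcases Nat.even_or_odd n with h | h
    · rw [kroneckerSym_of_even hev hn h, kroneckerSym_of_even hev (by omega)
        (h.add (by simp [show Even 4 by decide]))]
    · have h' : Odd (n + 4 * D.natAbs) := h.add_even (by simp [show Even 4 by decide])
      rw [kroneckerSym_of_odd D h, kroneckerSym_of_odd D h', jacobiSym.mod_right D h,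
        jacobiSym.mod_right D h', Nat.add_mod_right]
  · rw [kroneckerSym_eq_jacobiSym hD hn, kroneckerSym_eq_jacobiSym hD (by omega),
      jacobiSym.mod_left, jacobiSym.mod_left n]
    push_cast
    congr 1
    exact Int.add_mul_emod_self_right _ _ _

theorem kroneckerSym_add_mul {D : ℤ} (hD : D % 4 = 0 ∨ D % 4 = 1) {n : ℕ} (hn : n ≠ 0) (k : ℕ) :
    kroneckerSym D (n + 4 * D.natAbs * k) = kroneckerSym D n := by
  induction k with
  | zero => simp
  | succ k ih => rw [mul_add, mul_one, ← add_assoc, kroneckerSym_add hD (by omega), ih]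

/-- The Kronecker symbol as a function modulo `4|D|`. -/
noncomputable def kroneckerMod (D : ℤ) (j : ZMod (4 * D.natAbs)) : ℂ :=
  -- Adding a period avoids the argument `0`, where `kroneckerSym` has the default value `1` and
  -- periodicity can fail.
  kroneckerSym D (j.val + 4 * D.natAbs)

theorem kroneckerMod_natCast {D : ℤ} (hD : D % 4 = 0 ∨ D % 4 = 1) (h0 : D ≠ 0) {n : ℕ}
    (hn : n ≠ 0) : kroneckerMod D n = kroneckerSym D n := by
  have hpos : 0 < 4 * D.natAbs := by have := Int.natAbs_pos.mpr h0; omega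
  have : NeZero (4 * D.natAbs) := ⟨hpos.ne'⟩
  rw [kroneckerMod, ZMod.val_natCast, ← kroneckerSym_add_mul hD hn 1, mul_one]
  conv_rhs => rw [← Nat.mod_add_div n (4 * D.natAbs)]
  rw [add_right_comm, kroneckerSym_add_mul hD (by omega)]

section field

variable {K : Type*} [Field K] [NumberField K]

theorem discr_mod_four (hK : finrank ℚ K = 2) : discr K % 4 = 0 ∨ discr K % 4 = 1 := by
  obtain ⟨b, hb⟩ := exists_basis_one K hK
  have hθ := quadratic_relation b hb
  set t := b.repr (b 1 ^ 2) 1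
  set n := -b.repr (b 1 ^ 2) 0 with hn
  have hθ' : b 1 ^ 2 = t * b 1 - n := by rw [hθ, hn]; push_cast; ring
  rw [discr_eq_of_basis b hb hθ']
  rcases Int.even_or_odd' t with ⟨k, hk | hk⟩ <;> rw [hk]
  · left
    rw [show (2 * k) ^ 2 - 4 * n = 4 * (k ^ 2 - n) by ring]
    exact Int.mul_emod_right _ _
  · right
    rw [show (2 * k + 1) ^ 2 - 4 * n = 1 + 4 * (k ^ 2 + k - n) by ring]
    omega

instance (K : Type*) [Field K] [NumberField K] : NeZero (4 * (discr K).natAbs) :=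
  ⟨by have := Int.natAbs_pos.mpr (discr_ne_zero K); omega⟩

theorem lfunction_eq_lseries (hK : finrank ℚ K = 2) {s : ℂ} (hs : 1 < s.re) :
    ZMod.LFunction (kroneckerMod (discr K)) s =
      LSeries (fun n ↦ (kroneckerSym (discr K) n : ℂ)) s := by
  rw [ZMod.LFunction_eq_LSeries _ hs]
  exact LSeries_congr (fun hn ↦ kroneckerMod_natCast (discr_mod_four hK) (discr_ne_zero K) hn) s

/-- The residue of the periodic L-function at `1` is the mean of its coefficients. Were it nonzero,
`ζ_K = ζ L` would have a double pole, but `(s - 1)² ζ_K(s) → 0` as `s → 1⁺`. -/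
theorem sum_kroneckerMod (hK : finrank ℚ K = 2) :
    ∑ j : ZMod (4 * (discr K).natAbs), kroneckerMod (discr K) j = 0 := by
  set N := 4 * (discr K).natAbs
  set Φ := kroneckerMod (discr K)
  have hle : 𝓝[>] (1 : ℝ) ≤ comap (fun s : ℝ ↦ (s : ℂ)) (𝓝[≠] 1) := by
    rw [← tendsto_iff_comap]
    refine tendsto_nhdsWithin_iff.mpr ⟨?_, ?_⟩
    · exact (continuous_ofReal.tendsto' 1 1 ofReal_one).mono_left nhdsWithin_le_nhds
    · filter_upwards [self_mem_nhdsWithin] with s hs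
      simpa using (show (1 : ℝ) < s from hs).ne'
  have hto : Tendsto (fun s : ℝ ↦ (s : ℂ)) (𝓝[>] 1) (𝓝[≠] 1) := tendsto_iff_comap.mpr hle
  have h1 := (riemannZeta_residue_one.comp hto).mul ((ZMod.LFunction_residue_one Φ).comp hto)
  have h2 : Tendsto (fun s : ℝ ↦ ((s : ℂ) - 1) * ((s - 1) * dedekindZeta K s)) (𝓝[>] 1)
      (𝓝 (0 * dedekindZeta_residue K)) := by
    refine Tendsto.mul ?_ (tendsto_sub_one_mul_dedekindZeta_nhdsGT K)
    have : Tendsto (fun s : ℝ ↦ (s : ℂ) - 1) (𝓝 1) (𝓝 0) :=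
      (continuous_ofReal.sub continuous_const).tendsto' 1 0 (by simp)
    exact this.mono_left nhdsWithin_le_nhds
  have h3 := tendsto_nhds_unique_of_eventuallyEq h1 h2 (by
    filter_upwards [self_mem_nhdsWithin] with s hs
    have hs1 : 1 < (s : ℂ).re := hs
    simp only [Function.comp_apply]
    rw [dedekindZeta_eq_mul hK hs1, ← lfunction_eq_lseries hK hs1]
    ring)
  rw [zero_mul, one_mul, ← Finset.sum_div, div_eq_zero_iff] at h3
  exact h3.resolve_right (Nat.cast_ne_zero.mpr (NeZero.ne N))

theorem isContinuation_lfunction (hK : finrank ℚ K = 2) :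
    IsContinuation ∅ (LSeries fun n ↦ (kroneckerSym (discr K) n : ℂ))
      (ZMod.LFunction (kroneckerMod (discr K))) :=
  ⟨(ZMod.differentiable_LFunction_of_sum_zero (sum_kroneckerMod hK)).differentiableOn,
    fun _ hs ↦ lfunction_eq_lseries hK hs⟩

theorem isContinuation_quadraticL (hK : finrank ℚ K = 2) :
    IsContinuation ∅ (LSeries fun n ↦ (kroneckerSym (discr K) n : ℂ)) (quadraticL (discr K)) :=
  isContinuation_continuation (isContinuation_lfunction hK)

theorem differentiable_quadraticL (hK : finrank ℚ K = 2) :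
    Differentiable ℂ (quadraticL (discr K)) := by
  have h := (isContinuation_quadraticL hK).1
  rwa [Set.compl_empty, differentiableOn_univ] at h

variable [IsTotallyComplex K]

theorem zetaK_eq_mul (hK : finrank ℚ K = 2) {s : ℂ} (hs : s ≠ 1) :
    zetaK K s = riemannZeta s * quadraticL (discr K) s := by
  refine (isContinuation_zetaK hK).eq_of (G := fun s ↦ riemannZeta s * quadraticL (discr K) s)
    (Set.countable_singleton 1) isClosed_singleton ⟨?_, ?_⟩ hs
  · intro s hs
    exact ((differentiableAt_riemannZeta hs).mul
      (differentiable_quadraticL hK s)).differentiableWithinAt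
  · intro s hs
    simp only
    rw [(isContinuation_quadraticL hK).2 s hs, dedekindZeta_eq_mul hK hs]

/-- The residue of `ζ_K` at `1` is `L(1, χ_D)`. -/
theorem zetaK_residue_one (hK : finrank ℚ K = 2) :
    Tendsto (fun s ↦ (s - 1) * zetaK K s) (𝓝[≠] 1) (𝓝 (quadraticL (discr K) 1)) := by
  have h1 : Tendsto (quadraticL (discr K)) (𝓝[≠] 1) (𝓝 (quadraticL (discr K) 1)) :=
    ((differentiable_quadraticL hK).continuous.tendsto 1).mono_left nhdsWithin_le_nhds
  have h := riemannZeta_residue_one.mul h1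
  rw [one_mul] at h
  refine h.congr' ?_
  filter_upwards [self_mem_nhdsWithin] with s hs
  rw [zetaK_eq_mul hK hs, mul_assoc]

end field

end QuadLambert

/-! ### Growth in vertical strips -/

namespace QuadLambert

open NumberField Module Complex Set

/-- `f` grows at most exponentially on the strip `σ₁ ≤ Re z ≤ σ₂`. -/
def ExpBounded (σ₁ σ₂ : ℝ) (f : ℂ → ℂ) : Prop :=
  ∃ C A : ℝ, 0 ≤ C ∧ 0 ≤ A ∧ ∀ z : ℂ, σ₁ ≤ z.re → z.re ≤ σ₂ → ‖f z‖ ≤ C * Real.exp (A * |z.im|)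

namespace ExpBounded

variable {σ₁ σ₂ : ℝ} {f g : ℂ → ℂ}

theorem of_bounded {C : ℝ} (h : ∀ z : ℂ, σ₁ ≤ z.re → z.re ≤ σ₂ → ‖f z‖ ≤ C) :
    ExpBounded σ₁ σ₂ f := by
  refine ⟨|C|, 0, abs_nonneg _, le_rfl, fun z h1 h2 ↦ ?_⟩
  simpa using (h z h1 h2).trans (le_abs_self C)

theorem const (c : ℂ) : ExpBounded σ₁ σ₂ fun _ ↦ c := of_bounded (C := ‖c‖) fun _ _ _ ↦ le_rfl

theorem mul (hf : ExpBounded σ₁ σ₂ f) (hg : ExpBounded σ₁ σ₂ g) :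
    ExpBounded σ₁ σ₂ fun z ↦ f z * g z := by
  obtain ⟨C, A, hC, hA, h⟩ := hf
  obtain ⟨C', A', hC', hA', h'⟩ := hg
  refine ⟨C * C', A + A', by positivity, by positivity, fun z h1 h2 ↦ ?_⟩
  rw [norm_mul, add_mul, Real.exp_add]
  calc ‖f z‖ * ‖g z‖ ≤ (C * Real.exp (A * |z.im|)) * (C' * Real.exp (A' * |z.im|)) :=
        mul_le_mul (h z h1 h2) (h' z h1 h2) (norm_nonneg _) (by positivity)
    _ = _ := by ring

theorem add (hf : ExpBounded σ₁ σ₂ f) (hg : ExpBounded σ₁ σ₂ g) :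
    ExpBounded σ₁ σ₂ fun z ↦ f z + g z := by
  obtain ⟨C, A, hC, hA, h⟩ := hf
  obtain ⟨C', A', hC', hA', h'⟩ := hg
  refine ⟨C + C', A + A', by positivity, by positivity, fun z h1 h2 ↦ ?_⟩
  have e1 : Real.exp (A * |z.im|) ≤ Real.exp ((A + A') * |z.im|) :=
    Real.exp_le_exp.mpr (mul_le_mul_of_nonneg_right (by linarith) (abs_nonneg _))
  have e2 : Real.exp (A' * |z.im|) ≤ Real.exp ((A + A') * |z.im|) :=
    Real.exp_le_exp.mpr (mul_le_mul_of_nonneg_right (by linarith) (abs_nonneg _))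
  rw [add_mul]
  exact (norm_add_le _ _).trans (add_le_add
    ((h z h1 h2).trans (mul_le_mul_of_nonneg_left e1 hC))
    ((h' z h1 h2).trans (mul_le_mul_of_nonneg_left e2 hC')))

theorem sub (hf : ExpBounded σ₁ σ₂ f) (hg : ExpBounded σ₁ σ₂ g) :
    ExpBounded σ₁ σ₂ fun z ↦ f z - g z := by
  have := hf.add ((const (-1)).mul hg)
  simpa [sub_eq_add_neg] using this

theorem of_pow {C A : ℝ} {m : ℕ} (hC : 0 ≤ C) (hA : 0 ≤ A)
    (h : ∀ z : ℂ, σ₁ ≤ z.re → z.re ≤ σ₂ → ‖f z‖ ≤ C * (1 + |z.im|) ^ m * Real.exp (A * |z.im|)) :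
    ExpBounded σ₁ σ₂ f := by
  refine ⟨C, m + A, hC, by positivity, fun z h1 h2 ↦ (h z h1 h2).trans ?_⟩
  rw [mul_assoc]
  refine mul_le_mul_of_nonneg_left ?_ hC
  rw [add_mul, Real.exp_add, Real.exp_nat_mul]
  refine mul_le_mul_of_nonneg_right ?_ (Real.exp_pos _).le
  exact pow_le_pow_left₀ (by positivity) (by linarith [Real.add_one_le_exp |z.im|]) m

theorem id : ExpBounded σ₁ σ₂ fun z ↦ z := by
  refine of_pow (C := |σ₁| + |σ₂| + 1) (A := 0) (m := 1) (by positivity) le_rfl fun z h1 h2 ↦ ?_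
  have h3 : |z.re| ≤ |σ₁| + |σ₂| := by
    rw [abs_le]
    constructor
    · linarith [neg_abs_le σ₁, abs_nonneg σ₂]
    · linarith [le_abs_self σ₂, abs_nonneg σ₁]
  have h4 := norm_le_abs_re_add_abs_im z
  have h5 : 0 ≤ |σ₁| + |σ₂| := by positivity
  have h6 := abs_nonneg z.im
  rw [zero_mul, Real.exp_zero, mul_one, pow_one]
  nlinarith

theorem comp_add (c : ℂ) (hf : ExpBounded (σ₁ + c.re) (σ₂ + c.re) f) :
    ExpBounded σ₁ σ₂ fun z ↦ f (z + c) := by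
  obtain ⟨C, A, hC, hA, h⟩ := hf
  refine ⟨C * Real.exp (A * |c.im|), A, by positivity, hA, fun z h1 h2 ↦ ?_⟩
  refine (h (z + c) (by simpa using h1) (by simpa using h2)).trans ?_
  rw [mul_assoc, ← Real.exp_add]
  refine mul_le_mul_of_nonneg_left (Real.exp_le_exp.mpr ?_) hC
  rw [← mul_add]
  refine mul_le_mul_of_nonneg_left ?_ hA
  rw [add_im, add_comm]
  exact abs_add_le _ _

theorem comp_half (hf : ExpBounded (σ₁ / 2) (σ₂ / 2) f) :
    ExpBounded σ₁ σ₂ fun z ↦ f (z / 2) := by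
  obtain ⟨C, A, hC, hA, h⟩ := hf
  have hre : ∀ z : ℂ, (z / 2).re = z.re / 2 := fun z ↦ by simp
  have him : ∀ z : ℂ, (z / 2).im = z.im / 2 := fun z ↦ by simp
  refine ⟨C, A, hC, hA, fun z h1 h2 ↦ ?_⟩
  refine (h (z / 2) (by rw [hre]; linarith) (by rw [hre]; linarith)).trans ?_
  refine mul_le_mul_of_nonneg_left (Real.exp_le_exp.mpr ?_) hC
  refine mul_le_mul_of_nonneg_left ?_ hA
  rw [him, abs_div, abs_two]
  linarith [abs_nonneg z.im]

theorem cpow {ω : ℂ} (hω : ω ≠ 0) : ExpBounded σ₁ σ₂ fun z ↦ ω ^ z := by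
  have hω' := norm_pos_iff.mpr hω
  refine ⟨‖ω‖ ^ σ₁ + ‖ω‖ ^ σ₂, |ω.arg|, by positivity, abs_nonneg _, fun z h1 h2 ↦ ?_⟩
  refine (norm_cpow_le hω z).trans (mul_le_mul_of_nonneg_right ?_ (Real.exp_pos _).le)
  rcases le_total 1 ‖ω‖ with h | h
  · exact (Real.rpow_le_rpow_of_exponent_le h h2).trans (le_add_of_nonneg_left (by positivity))
  · exact (Real.rpow_le_rpow_of_exponent_ge hω' h h1).trans
      (le_add_of_nonneg_right (by positivity))

theorem inv_Gamma : ExpBounded σ₁ σ₂ fun z ↦ (Gamma z)⁻¹ := by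
  obtain ⟨C, hC, m, h⟩ := exists_norm_inv_Gamma_le σ₁ σ₂
  exact of_pow hC (by positivity) h

theorem Gamma (h₁ : 0 < σ₁) : ExpBounded σ₁ σ₂ Gamma := by
  obtain ⟨C, hC, m, h⟩ := exists_norm_Gamma_le h₁ σ₂
  refine of_pow (m := m) hC le_rfl fun z h1 h2 ↦ (h z h1 h2).trans ?_
  refine mul_le_mul_of_nonneg_left (Real.exp_le_exp.mpr ?_) (by positivity)
  rw [zero_mul, neg_nonpos]
  positivity

theorem inv_Gammaℝ : ExpBounded σ₁ σ₂ fun z ↦ (Gammaℝ z)⁻¹ := by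
  have h1 : ExpBounded σ₁ σ₂ fun z ↦ (Real.pi : ℂ) ^ (z / 2) :=
    comp_half (f := fun z ↦ (Real.pi : ℂ) ^ z) (cpow (ofReal_ne_zero.mpr Real.pi_ne_zero))
  have h2 : ExpBounded σ₁ σ₂ fun z ↦ (Complex.Gamma (z / 2))⁻¹ :=
    comp_half (f := fun z ↦ (Complex.Gamma z)⁻¹) inv_Gamma
  have := h1.mul h2
  refine (congrArg _ (funext fun z ↦ ?_)).mp this
  rw [Gammaℝ_def, mul_inv, neg_div, cpow_neg, inv_inv]

/-- A holomorphic function of exponential growth bounded on the edges of a strip is bounded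
on it. -/
theorem norm_le_of_edges (h : σ₁ < σ₂)
    (hd : ∀ z : ℂ, σ₁ ≤ z.re → z.re ≤ σ₂ → DifferentiableAt ℂ f z) (hf : ExpBounded σ₁ σ₂ f) {C : ℝ}
    (h₁ : ∀ z : ℂ, z.re = σ₁ → ‖f z‖ ≤ C) (h₂ : ∀ z : ℂ, z.re = σ₂ → ‖f z‖ ≤ C) {z : ℂ}
    (hz₁ : σ₁ ≤ z.re) (hz₂ : z.re ≤ σ₂) : ‖f z‖ ≤ C := by
  obtain ⟨C', A, hC', hA, hb⟩ := hf
  -- Phragmén–Lindelöf tolerates growth `exp(B exp(κ |Im z|))` for `κ < π / (σ₂ - σ₁)`; half the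
  -- critical rate is ample for exponential growth.
  set κ : ℝ := Real.pi / (σ₂ - σ₁) / 2 with hκ
  have hpos : 0 < Real.pi / (σ₂ - σ₁) := div_pos Real.pi_pos (by linarith)
  have hκ0 : 0 < κ := by positivity
  have hcl : closure (re ⁻¹' Ioo σ₁ σ₂) ⊆ re ⁻¹' Icc σ₁ σ₂ :=
    closure_minimal (preimage_mono Ioo_subset_Icc_self) (isClosed_Icc.preimage continuous_re)
  have hdiff : DiffContOnCl ℂ f (re ⁻¹' Ioo σ₁ σ₂) :=
    ⟨fun z hz ↦ (hd z hz.1.le hz.2.le).differentiableWithinAt, fun z hz ↦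
      (hd z (hcl hz).1 (hcl hz).2).continuousAt.continuousWithinAt⟩
  refine PhragmenLindelof.vertical_strip hdiff ⟨κ, half_lt_self hpos, A / κ, ?_⟩
    h₁ h₂ hz₁ hz₂
  refine Asymptotics.IsBigO.of_bound C' ?_
  refine eventually_inf_principal.mpr (Eventually.of_forall fun w hw ↦ ?_)
  refine (hb w hw.1.le hw.2.le).trans ?_
  rw [Real.norm_eq_abs, Real.abs_exp]
  refine mul_le_mul_of_nonneg_left (Real.exp_le_exp.mpr ?_) hC'
  have h3 := Real.add_one_le_exp (κ * |w.im|)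
  calc A * |w.im| = A / κ * (κ * |w.im|) := by field_simp
    _ ≤ _ := mul_le_mul_of_nonneg_left (by linarith) (by positivity)

end ExpBounded

/-- The entire function `(s - 1) ζ(s)`. -/
noncomputable def zetaReg (s : ℂ) : ℂ :=
  -- Division by `s` is avoided by `1 / (s Γ_ℝ(s)) = 1 / (2π Γ_ℝ(s + 2))`, which makes the formula
  -- visibly entire.
  (s - 1) * completedRiemannZeta₀ s * (Gammaℝ s)⁻¹ -
    (s - 1) / (2 * Real.pi) * (Gammaℝ (s + 2))⁻¹ + (Gammaℝ s)⁻¹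

theorem differentiable_zetaReg : Differentiable ℂ zetaReg := by
  have h1 := differentiable_completedZeta₀
  have h2 := differentiable_Gammaℝ_inv
  have h3 : Differentiable ℂ fun s : ℂ ↦ (Gammaℝ (s + 2))⁻¹ :=
    h2.comp (differentiable_id.add_const 2)
  unfold zetaReg
  fun_prop

theorem zetaReg_eq {s : ℂ} (h0 : s ≠ 0) (h1 : s ≠ 1) : zetaReg s = (s - 1) * riemannZeta s := by
  have hs : 1 - s ≠ 0 := sub_ne_zero.mpr h1.symm
  have hπ : (Real.pi : ℂ) ≠ 0 := ofReal_ne_zero.mpr Real.pi_ne_zero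
  have hG : (Gammaℝ (s + 2))⁻¹ = (Gammaℝ s)⁻¹ * (2 * Real.pi / s) := by
    rw [Gammaℝ_add_two h0, mul_div_assoc, mul_div_assoc, mul_inv]
    congr 1
    field_simp
  rw [riemannZeta_def_of_ne_zero h0, completedRiemannZeta_eq, zetaReg, hG,
    div_eq_mul_inv (_ - _) (Gammaℝ s)]
  generalize (Gammaℝ s)⁻¹ = G
  field_simp
  ring

/-- The function is a Mellin transform converging everywhere, hence bounded on strips; the strip is
halved because the underlying variable is `s / 2`. -/
theorem expBounded_completedRiemannZeta₀ (σ₁ σ₂ : ℝ) :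
    ExpBounded σ₁ σ₂ completedRiemannZeta₀ := by
  obtain ⟨C, hC⟩ := exists_norm_feLambda_le (HurwitzZeta.hurwitzEvenFEPair 0) (σ₁ / 2) (σ₂ / 2)
  have h1 : ExpBounded (σ₁ / 2) (σ₂ / 2) (HurwitzZeta.hurwitzEvenFEPair 0).Λ₀ :=
    ExpBounded.of_bounded hC
  have h2 := (ExpBounded.comp_half h1).mul (ExpBounded.const (1 / 2))
  refine (congrArg _ (funext fun z ↦ ?_)).mp h2
  rw [← HurwitzZeta.completedHurwitzZetaEven₀_zero, HurwitzZeta.completedHurwitzZetaEven₀]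
  ring

theorem expBounded_zetaReg (σ₁ σ₂ : ℝ) : ExpBounded σ₁ σ₂ zetaReg := by
  have h1 : ExpBounded σ₁ σ₂ fun s ↦ s - 1 := ExpBounded.id.sub (ExpBounded.const 1)
  have h2 : ExpBounded σ₁ σ₂ fun s ↦ (Gammaℝ (s + 2))⁻¹ :=
    ExpBounded.comp_add (f := fun s ↦ (Gammaℝ s)⁻¹) 2 ExpBounded.inv_Gammaℝ
  exact ((((h1.mul (expBounded_completedRiemannZeta₀ σ₁ σ₂)).mul ExpBounded.inv_Gammaℝ).sub
    ((h1.mul (ExpBounded.const (2 * Real.pi : ℂ)⁻¹)).mul h2)).add ExpBounded.inv_Gammaℝ)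

section field

variable {K : Type*} [Field K] [NumberField K] [IsTotallyComplex K]

/-- The entire function `(s - 1) ζ_K(s)`. -/
noncomputable def zetaKReg (hK : finrank ℚ K = 2) (s : ℂ) : ℂ :=
  (thetaScale K : ℂ) ^ s * ((s - 1) * (thetaPair hK).Λ₀ s / Nat.card (𝓞 K)ˣ * (Gamma s)⁻¹ -
    thetaResidue K * (s - 1) * (Gamma (s + 1))⁻¹ + thetaResidue K * (Gamma s)⁻¹)

theorem differentiable_zetaKReg (hK : finrank ℚ K = 2) : Differentiable ℂ (zetaKReg hK) := by
  have hc : (thetaScale K : ℂ) ≠ 0 := ofReal_ne_zero.mpr (thetaScale_pos K).ne'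
  have h1 := (thetaPair hK).differentiable_Λ₀
  have h2 : Differentiable ℂ (fun s ↦ (Gamma s)⁻¹) := differentiable_one_div_Gamma
  have h3 : Differentiable ℂ (fun s ↦ (Gamma (s + 1))⁻¹) :=
    h2.comp (differentiable_id.add_const 1)
  have h4 : Differentiable ℂ (fun s : ℂ ↦ (thetaScale K : ℂ) ^ s) :=
    differentiable_id.const_cpow (Or.inl hc)
  unfold zetaKReg
  fun_prop

theorem zetaKReg_eq (hK : finrank ℚ K = 2) {s : ℂ} (h1 : s ≠ 1) :
    zetaKReg hK s = (s - 1) * zetaK K s := by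
  have hs : 1 - s ≠ 0 := sub_ne_zero.mpr h1.symm
  have hw := card_units_ne_zero hK
  rw [zetaK_eq_explicit hK h1, zetaKExplicit, zetaKReg]
  field_simp
  ring

theorem expBounded_zetaKReg (hK : finrank ℚ K = 2) (σ₁ σ₂ : ℝ) :
    ExpBounded σ₁ σ₂ (zetaKReg hK) := by
  have hc : (thetaScale K : ℂ) ≠ 0 := ofReal_ne_zero.mpr (thetaScale_pos K).ne'
  obtain ⟨C, hC⟩ := exists_norm_feLambda_le (thetaPair hK) σ₁ σ₂
  have h0 : ExpBounded σ₁ σ₂ (thetaPair hK).Λ₀ := ExpBounded.of_bounded hC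
  have h1 : ExpBounded σ₁ σ₂ fun s ↦ s - 1 := ExpBounded.id.sub (ExpBounded.const 1)
  have h2 : ExpBounded σ₁ σ₂ fun s ↦ (Gamma (s + 1))⁻¹ :=
    ExpBounded.comp_add (f := fun s ↦ (Gamma s)⁻¹) 1 ExpBounded.inv_Gamma
  exact (ExpBounded.cpow hc).mul
    (((((h1.mul h0).mul (ExpBounded.const (Nat.card (𝓞 K)ˣ : ℂ)⁻¹)).mul ExpBounded.inv_Gamma).sub
      (((ExpBounded.const (thetaResidue K)).mul h1).mul h2)).add
        ((ExpBounded.const (thetaResidue K)).mul ExpBounded.inv_Gamma))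

end field

end QuadLambert

/-! ### The Mellin–Barnes representation of the Lambert series -/

namespace QuadLambert

open NumberField Module Complex Set MeasureTheory

theorem integrableOn_rpow_mul_exp_neg {σ b : ℝ} (hσ : 0 < σ) (hb : 0 < b) :
    IntegrableOn (fun t : ℝ ↦ t ^ (σ - 1) * Real.exp (-(b * t))) (Ioi 0) := by
  have h := integrableOn_rpow_mul_exp_neg_mul_rpow (s := σ - 1) (p := 1) (b := b) (by linarith)
    one_pos hb
  refine h.congr_fun (fun t _ ↦ ?_) measurableSet_Ioi
  simp

theorem norm_cpow_mul_exp {s z : ℂ} {t : ℝ} (ht : 0 < t) :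
    ‖(t : ℂ) ^ (s - 1) * exp (-(z * t))‖ = t ^ (s.re - 1) * Real.exp (-(z.re * t)) := by
  rw [norm_mul, norm_cpow_eq_rpow_re_of_pos ht, norm_exp]
  simp

theorem aestronglyMeasurable_cpow_mul_exp (s z : ℂ) :
    AEStronglyMeasurable (fun t : ℝ ↦ (t : ℂ) ^ (s - 1) * exp (-(z * t)))
      (volume.restrict (Ioi 0)) := by
  refine ContinuousOn.aestronglyMeasurable ?_ measurableSet_Ioi
  refine ContinuousOn.mul (fun t ht ↦ ?_) (Continuous.continuousOn (by fun_prop))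
  exact (continuousAt_ofReal_cpow_const t (s - 1) (Or.inr (ne_of_gt ht))).continuousWithinAt

theorem integrableOn_cpow_mul_exp {s z : ℂ} (hs : 0 < s.re) (hz : 0 < z.re) :
    IntegrableOn (fun t : ℝ ↦ (t : ℂ) ^ (s - 1) * exp (-(z * t))) (Ioi 0) := by
  refine Integrable.mono' (integrableOn_rpow_mul_exp_neg hs hz)
    (aestronglyMeasurable_cpow_mul_exp s z) ?_
  filter_upwards [self_mem_ae_restrict measurableSet_Ioi] with t ht
  exact (norm_cpow_mul_exp ht).le

/-- `∫ t^{s-1} e^{-zt} dt = Γ(s) z^{-s}` for complex `z` with `Re z > 0`. -/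
theorem integral_cpow_mul_exp_neg {s z : ℂ} (hs : 0 < s.re) (hz : 0 < z.re) :
    ∫ t : ℝ in Ioi 0, (t : ℂ) ^ (s - 1) * exp (-(z * t)) = Gamma s * z ^ (-s) := by
  have hopen : IsOpen {z : ℂ | 0 < z.re} := isOpen_lt continuous_const continuous_re
  have hconv : Convex ℝ {z : ℂ | 0 < z.re} := convex_halfSpace_re_gt 0
  have hd1 : DifferentiableOn ℂ
      (fun z : ℂ ↦ ∫ t : ℝ in Ioi 0, (t : ℂ) ^ (s - 1) * exp (-(z * t))) {z : ℂ | 0 < z.re} := by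
    intro z₀ hz₀
    have hz₀' : 0 < z₀.re := hz₀
    have hs1 : 0 < s.re + 1 := by linarith
    have hball : ∀ z ∈ Metric.ball z₀ (z₀.re / 2), z₀.re / 2 ≤ z.re := by
      intro z hz
      have h1 : |z.re - z₀.re| < z₀.re / 2 := by
        rw [← sub_re]
        exact (abs_re_le_norm _).trans_lt (by simpa [dist_eq_norm] using hz)
      have := (abs_lt.mp h1).1
      linarith
    have h := hasDerivAt_integral_of_dominated_loc_of_deriv_le (μ := volume.restrict (Ioi (0 : ℝ)))
      (F := fun (z : ℂ) (t : ℝ) ↦ (t : ℂ) ^ (s - 1) * exp (-(z * t)))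
      (F' := fun (z : ℂ) (t : ℝ) ↦ (t : ℂ) ^ (s - 1) * (exp (-(z * t)) * -t))
      (bound := fun t ↦ t ^ (s.re + 1 - 1) * Real.exp (-(z₀.re / 2 * t)))
      (Metric.ball_mem_nhds z₀ (half_pos hz₀'))
      (Eventually.of_forall fun z ↦ aestronglyMeasurable_cpow_mul_exp s z)
      (integrableOn_cpow_mul_exp hs hz₀')
      (by
        have := (aestronglyMeasurable_cpow_mul_exp s z₀).mul
          (continuous_ofReal.neg.aestronglyMeasurable (μ := volume.restrict (Ioi (0 : ℝ))))
        refine this.congr (Eventually.of_forall fun t ↦ ?_)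
        simp only [Pi.mul_apply, Pi.neg_apply]
        ring)
      (by
        filter_upwards [self_mem_ae_restrict measurableSet_Ioi] with t ht z hz
        have ht0 : (0 : ℝ) < t := ht
        rw [← mul_assoc, norm_mul, norm_cpow_mul_exp ht0, norm_neg, norm_real, Real.norm_eq_abs,
          abs_of_pos ht0]
        have e : t ^ (s.re + 1 - 1) = t ^ (s.re - 1) * t := by
          rw [show s.re + 1 - 1 = (s.re - 1) + 1 by ring, Real.rpow_add_one ht0.ne']
        rw [e, mul_right_comm]
        refine mul_le_mul_of_nonneg_left (Real.exp_le_exp.mpr ?_) (by positivity)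
        have := mul_le_mul_of_nonneg_right (hball z hz) ht0.le
        linarith)
      (integrableOn_rpow_mul_exp_neg hs1 (half_pos hz₀'))
      (Eventually.of_forall fun t z _ ↦ by
        have h1 : HasDerivAt (fun z : ℂ ↦ -(z * t)) (-t) z := by
          exact (hasDerivAt_mul_const (t : ℂ)).fun_neg
        exact h1.cexp.const_mul _)
    exact h.2.differentiableAt.differentiableWithinAt
  have hd2 : DifferentiableOn ℂ (fun z : ℂ ↦ Gamma s * z ^ (-s)) {z : ℂ | 0 < z.re} := by
    intro z hz
    exact ((differentiableAt_id.cpow_const (Or.inl hz)).const_mul _).differentiableWithinAt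
  -- Both sides are analytic in `z`, and the known formula for real `z` gives agreement at points
  -- accumulating at `1`.
  refine (hd1.analyticOnNhd hopen).eqOn_of_preconnected_of_frequently_eq
    (hd2.analyticOnNhd hopen) hconv.isPreconnected (z₀ := 1) (by simp) ?_ hz
  have hreal : ∀ r : ℝ, 0 < r → ∫ t : ℝ in Ioi 0, (t : ℂ) ^ (s - 1) * exp (-((r : ℂ) * t)) =
      Gamma s * (r : ℂ) ^ (-s) := by
    intro r hr
    rw [integral_cpow_mul_exp_neg_mul_Ioi hs hr, one_div, inv_cpow _ _
      (by rw [arg_ofReal_of_nonneg hr.le]; exact Real.pi_ne_zero.symm), ← cpow_neg, mul_comm]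
  have hto : Tendsto (fun r : ℝ ↦ (r : ℂ)) (𝓝[>] 1) (𝓝[≠] 1) := by
    refine tendsto_nhdsWithin_iff.mpr ⟨?_, ?_⟩
    · exact (continuous_ofReal.tendsto' 1 1 ofReal_one).mono_left nhdsWithin_le_nhds
    · filter_upwards [self_mem_nhdsWithin] with r hr
      simpa using (show (1 : ℝ) < r from hr).ne'
  refine hto.frequently (Eventually.frequently ?_)
  filter_upwards [self_mem_nhdsWithin] with r hr
  exact hreal r (zero_lt_one.trans hr)

theorem exists_norm_Gamma_mul_cpow_le {z : ℂ} (hz : 0 < z.re) {c : ℝ} (hc : 0 < c) :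
    ∃ C : ℝ, 0 ≤ C ∧ ∃ m : ℕ, ∀ t : ℝ, ‖Gamma (c + t * I) * z ^ (-(c + t * I))‖ ≤
      C * ((1 + |t|) ^ m * Real.exp (-((Real.pi / 2 - |z.arg|) * |t|))) := by
  obtain ⟨C, hC, m, h⟩ := exists_norm_Gamma_le hc c
  have hz0 : z ≠ 0 := by rintro rfl; simp at hz
  refine ⟨C * ‖z‖ ^ (-c), by positivity, m, fun t ↦ ?_⟩
  have h1 := h (c + t * I) (by simp) (by simp)
  have h2 := norm_cpow_le hz0 (-(c + t * I))
  simp only [add_im, ofReal_im, mul_im, ofReal_re, I_im, mul_one, I_re, mul_zero, add_zero,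
    zero_add, neg_re, add_re, mul_re, sub_self, neg_im, abs_neg] at h1 h2
  rw [norm_mul]
  calc _ ≤ (C * (1 + |t|) ^ m * Real.exp (-(Real.pi / 2 * |t|))) *
        (‖z‖ ^ (-c) * Real.exp (|z.arg| * |t|)) :=
        mul_le_mul h1 h2 (norm_nonneg _) (by positivity)
    _ = C * ‖z‖ ^ (-c) * ((1 + |t|) ^ m * (Real.exp (-(Real.pi / 2 * |t|)) *
        Real.exp (|z.arg| * |t|))) := by ring
    _ = _ := by
      rw [← Real.exp_add]
      congr 3
      ring

theorem continuous_Gamma_mul_cpow {z : ℂ} (hz : 0 < z.re) {c : ℝ} (hc : 0 < c) :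
    Continuous fun t : ℝ ↦ Gamma (c + t * I) * z ^ (-(c + t * I)) := by
  have hz0 : z ≠ 0 := by rintro rfl; simp at hz
  refine Continuous.mul ?_ ?_
  · refine continuous_iff_continuousAt.mpr fun t ↦ ?_
    have h1 : ContinuousAt Gamma (c + t * I) := (differentiableAt_Gamma _ fun n hn ↦ by
      have := congrArg re hn
      simp at this
      linarith [(Nat.cast_nonneg n : (0 : ℝ) ≤ n)]).continuousAt
    exact ContinuousAt.comp (f := fun t : ℝ ↦ (c + t * I : ℂ)) h1 (by fun_prop)
  · exact Continuous.const_cpow (by fun_prop) (Or.inl hz0)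

/-- The Cahen–Mellin integral. -/
theorem integral_Gamma_mul_cpow {z : ℂ} (hz : 0 < z.re) {c : ℝ} (hc : 0 < c) :
    ∫ t : ℝ, Gamma (c + t * I) * z ^ (-(c + t * I)) = 2 * Real.pi * exp (-z) := by
  have hmel : ∀ s : ℂ, 0 < s.re → mellin (fun t : ℝ ↦ exp (-(z * t))) s = Gamma s * z ^ (-s) :=
    fun s hs ↦ integral_cpow_mul_exp_neg hs hz
  have hre : ∀ t : ℝ, 0 < (c + t * I : ℂ).re := fun t ↦ by simpa using hc
  have hv : VerticalIntegrable (mellin fun t : ℝ ↦ exp (-(z * t))) c := by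
    obtain ⟨C, hC, m, h⟩ := exists_norm_Gamma_mul_cpow_le hz hc
    rw [VerticalIntegrable]
    simp_rw [fun t : ℝ ↦ hmel (c + t * I) (hre t)]
    exact Integrable.mono' ((integrable_pow_mul_exp_neg_abs m (abs_arg_lt hz)).const_mul C)
      (continuous_Gamma_mul_cpow hz hc).aestronglyMeasurable (Eventually.of_forall h)
  have h := mellinInv_mellin_eq c (fun t : ℝ ↦ exp (-(z * t))) one_pos
    (integrableOn_cpow_mul_exp (by simpa using hc) hz) hv
    (Continuous.continuousAt (by fun_prop))
  rw [mellinInv] at h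
  simp_rw [fun t : ℝ ↦ hmel (c + t * I) (hre t)] at h
  simp only [ofReal_one, one_cpow, one_smul, mul_one] at h
  rw [← h, Complex.real_smul]
  generalize ∫ t : ℝ, Gamma (c + t * I) * z ^ (-(c + t * I)) = J
  push_cast
  have : (Real.pi : ℂ) ≠ 0 := ofReal_ne_zero.mpr Real.pi_ne_zero
  field_simp

end QuadLambert

/-! ### The Lambert series as a contour integral -/

namespace QuadLambert

open NumberField Module Complex Set MeasureTheory

theorem exists_pow_mul_exp_neg_le (M : ℕ) {δ : ℝ} (hδ : 0 < δ) :
    ∃ C : ℝ, 0 ≤ C ∧ ∀ t : ℝ, 0 ≤ t → (1 + t) ^ M * Real.exp (-(δ * t)) ≤ C := by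
  refine ⟨M.factorial * Real.exp δ / δ ^ M, by positivity, fun t ht ↦ ?_⟩
  have h := Real.pow_div_factorial_le_exp (δ * (1 + t)) (by positivity) M
  rw [div_le_iff₀ (by positivity), mul_pow, mul_add, Real.exp_add, mul_one] at h
  rw [Real.exp_neg, le_div_iff₀ (by positivity)]
  have he := Real.exp_pos (δ * t)
  rw [show (1 + t) ^ M * (Real.exp (δ * t))⁻¹ * δ ^ M =
    (δ ^ M * (1 + t) ^ M) * (Real.exp (δ * t))⁻¹ by ring]
  calc _ ≤ (Real.exp δ * Real.exp (δ * t) * M.factorial) * (Real.exp (δ * t))⁻¹ :=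
        mul_le_mul_of_nonneg_right h (by positivity)
    _ = _ := by field_simp

theorem _root_.HasSum.congr_eq {ι : Type*} {f g : ι → ℂ} {a b : ℂ} (h : HasSum f a)
    (hfg : ∀ n, g n = f n) (hab : b = a) : HasSum g b := by
  rw [hab, funext hfg]
  exact h

/-- Termwise integration of a Dirichlet series on a vertical line. -/
theorem hasSum_integral_dirichlet {b : ℕ → ℂ} {g : ℝ → ℂ} (hg : Integrable g) {σ : ℝ}
    (hb : LSeriesSummable b σ) {z : ℝ → ℂ} (hz : Continuous z) (hzσ : ∀ t, (z t).re = σ) :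
    HasSum (fun n : ℕ+ ↦ ∫ t : ℝ, b n / (n : ℂ) ^ z t * g t) (∫ t : ℝ, LSeries b (z t) * g t) := by
  have hnorm : ∀ (n : ℕ+) (t : ℝ), ‖b n / (n : ℂ) ^ z t * g t‖ =
      ‖b n‖ / (n : ℝ) ^ σ * ‖g t‖ := by
    intro n t
    rw [norm_mul, norm_div, norm_natCast_cpow_of_pos n.pos, hzσ]
  have hint₀ : ∀ n : ℕ+, Integrable fun t : ℝ ↦ b n / (n : ℂ) ^ z t * g t := by
    intro n
    refine Integrable.mono' (hg.norm.const_mul (‖b n‖ / (n : ℝ) ^ σ)) ?_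
      (Eventually.of_forall fun t ↦ (hnorm n t).le)
    refine (Continuous.aestronglyMeasurable ?_).mul hg.1
    have hn : (n : ℂ) ≠ 0 := Nat.cast_ne_zero.mpr n.ne_zero
    exact continuous_const.div (hz.const_cpow (Or.inl hn)) fun t ↦ by
      simp [cpow_eq_zero_iff]
  have hsum : Summable fun n : ℕ+ ↦ ∫ t : ℝ, ‖b n / (n : ℂ) ^ z t * g t‖ := by
    simp_rw [hnorm, integral_const_mul]
    refine Summable.mul_right _ ?_
    refine (hb.norm.comp_injective PNat.coe_injective).congr fun n ↦ ?_
    rw [Function.comp_apply, LSeries.norm_term_eq, if_neg n.ne_zero, ofReal_re]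
  have h := hasSum_integral_of_summable_integral_norm hint₀ hsum
  refine h.congr_eq (fun _ ↦ rfl) (integral_congr_ae (Eventually.of_forall fun t ↦ ?_))
  simp only
  rw [lseries_eq_tsum_pnat, tsum_mul_right]

theorem norm_lseries_le {b : ℕ → ℂ} {σ : ℝ} (hb : LSeriesSummable b σ) {z : ℂ} (hz : z.re = σ) :
    ‖LSeries b z‖ ≤ ∑' n, ‖LSeries.term b σ n‖ := by
  refine tsum_of_norm_bounded hb.norm.hasSum fun n ↦ ?_
  rw [LSeries.norm_term_eq, LSeries.norm_term_eq, hz, ofReal_re]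

section field

variable {K : Type*} [Field K] [NumberField K]

theorem sigmaK_eq_convolution (b : ℂ) (n : ℕ) :
    sigmaK K b n = LSeries.convolution (fun d ↦ (idealCount K d : ℂ) * (d : ℂ) ^ b) 1 n := by
  rw [sigmaK, LSeries.convolution_def]
  simp only [Pi.one_apply, mul_one]
  exact (Nat.sum_divisorsAntidiagonal (f := fun d _ ↦ (idealCount K d : ℂ) * (d : ℂ) ^ b)).symm

theorem term_idealCount_mul_cpow (b s : ℂ) (n : ℕ) :
    LSeries.term (fun d ↦ (idealCount K d : ℂ) * (d : ℂ) ^ b) s n =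
      LSeries.term (fun d ↦ (idealCount K d : ℂ)) (s - b) n := by
  rcases eq_or_ne n 0 with rfl | hn
  · simp
  · have hn' : (n : ℂ) ≠ 0 := Nat.cast_ne_zero.mpr hn
    rw [LSeries.term_of_ne_zero hn, LSeries.term_of_ne_zero hn, cpow_sub _ _ hn', div_div_eq_mul_div]

theorem lseriesSummable_sigmaK (hK : finrank ℚ K = 2) {b s : ℂ} (hs : 1 < s.re)
    (hsb : 1 < (s - b).re) : LSeriesSummable (sigmaK K b) s := by
  have h1 : LSeriesSummable (fun d ↦ (idealCount K d : ℂ) * (d : ℂ) ^ b) s :=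
    (lseriesSummable_idealCount hK hsb).congr fun n ↦ (term_idealCount_mul_cpow b s n).symm
  rw [show sigmaK K b = _ from funext (sigmaK_eq_convolution b)]
  exact h1.convolution (LSeriesSummable_one_iff.mpr hs)

variable [IsTotallyComplex K]

theorem lseries_sigmaK (hK : finrank ℚ K = 2) {b s : ℂ} (hs : 1 < s.re)
    (hsb : 1 < (s - b).re) : LSeries (sigmaK K b) s = riemannZeta s * zetaK K (s - b) := by
  have h1 : LSeriesSummable (fun d ↦ (idealCount K d : ℂ) * (d : ℂ) ^ b) s :=
    (lseriesSummable_idealCount hK hsb).congr fun n ↦ (term_idealCount_mul_cpow b s n).symm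
  rw [show sigmaK K b = _ from funext (sigmaK_eq_convolution b),
    LSeries_convolution' h1 (LSeriesSummable_one_iff.mpr hs), LSeries_one_eq_riemannZeta hs,
    mul_comm, zetaK_eq_dedekindZeta hK hsb]
  congr 1
  exact tsum_congr fun n ↦ term_idealCount_mul_cpow b s n

variable (K) in
/-- The integrand `Γ(s) ζ(s) ζ_K(s - a) y^{-s}`. -/
noncomputable def lambertIntegrand (a y s : ℂ) : ℂ :=
  Gamma s * riemannZeta s * zetaK K (s - a) * y ^ (-s)

theorem lambertIntegrand_right (hK : finrank ℚ K = 2) {a y s : ℂ} (hs : 1 < s.re)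
    (hsa : 1 + a.re < s.re) :
    lambertIntegrand K a y s = LSeries (sigmaK K a) s * (Gamma s * y ^ (-s)) := by
  rw [lseries_sigmaK hK hs (by rw [sub_re]; linarith), lambertIntegrand]
  ring

/-- The Dirichlet series is bounded on the line, so the decay is that of `Γ(s) y^{-s}`, at the
positive rate `π/2 - |arg y|`. -/
theorem lineBound_right (hK : finrank ℚ K = 2) {a y : ℂ} (hy : 0 < y.re) {c : ℝ} (hc : 1 < c)
    (hca : 1 + a.re < c) : ∃ C : ℝ, 0 ≤ C ∧ ∃ m : ℕ, ∀ t : ℝ,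
      ‖lambertIntegrand K a y (c + t * I)‖ ≤
        C * ((1 + |t|) ^ m * Real.exp (-((Real.pi / 2 - |y.arg|) * |t|))) := by
  obtain ⟨C, hC, m, h⟩ := exists_norm_Gamma_mul_cpow_le hy (zero_lt_one.trans hc)
  have hσ : LSeriesSummable (sigmaK K a) c := lseriesSummable_sigmaK hK (by simpa using hc)
    (by simp; linarith)
  refine ⟨(∑' n, ‖LSeries.term (sigmaK K a) c n‖) * C,
    mul_nonneg (tsum_nonneg fun _ ↦ norm_nonneg _) hC, m, fun t ↦ ?_⟩
  rw [lambertIntegrand_right hK (by simpa using hc) (by simpa using hca), norm_mul, mul_assoc]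
  exact mul_le_mul (norm_lseries_le hσ (by simp)) (h t) (norm_nonneg _)
    (tsum_nonneg fun _ ↦ norm_nonneg _)

theorem differentiableAt_lambertIntegrand (hK : finrank ℚ K = 2) {a y s : ℂ} (hy : y ≠ 0)
    (hs : -1 < s.re) (h0 : s ≠ 0) (h1 : s ≠ 1) (ha : s ≠ 1 + a) :
    DifferentiableAt ℂ (lambertIntegrand K a y) s := by
  have hΓ : DifferentiableAt ℂ Gamma s := differentiableAt_Gamma s fun n hn ↦ by
    rcases n with _ | n
    · exact h0 (by simpa using hn)
    · have := congrArg re hn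
      simp at this
      linarith [(Nat.cast_nonneg n : (0 : ℝ) ≤ n)]
  have hz : DifferentiableAt ℂ (fun s ↦ zetaK K (s - a)) s :=
    (differentiableAt_zetaK hK (s := s - a) (fun h ↦ ha (by rw [← h]; ring))).comp s
      (differentiableAt_id.sub_const a)
  have hp : DifferentiableAt ℂ (fun s : ℂ ↦ y ^ (-s)) s :=
    differentiableAt_id.neg.const_cpow (Or.inl hy)
  exact ((hΓ.mul (differentiableAt_riemannZeta h1)).mul hz).mul hp

theorem continuous_lambertIntegrand_line (hK : finrank ℚ K = 2) {a y : ℂ} (hy : y ≠ 0) {c : ℝ}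
    (hc : -1 < c) (h0 : c ≠ 0) (h1 : c ≠ 1) (ha : c ≠ 1 + a.re) :
    Continuous fun t : ℝ ↦ lambertIntegrand K a y (c + t * I) := by
  refine continuous_iff_continuousAt.mpr fun t ↦ ?_
  have h : DifferentiableAt ℂ (lambertIntegrand K a y) (c + t * I) := by
    refine differentiableAt_lambertIntegrand hK hy (by simpa using hc) ?_ ?_ ?_
    · intro h; apply h0; simpa using congrArg re h
    · intro h; apply h1; simpa using congrArg re h
    · intro h; apply ha; simpa using congrArg re h
  exact ContinuousAt.comp (f := fun t : ℝ ↦ (c + t * I : ℂ)) h.continuousAt (by fun_prop)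

/-- The Lambert series as an integral over a line to the right of all poles. -/
theorem hasSum_lambert (hK : finrank ℚ K = 2) {a y : ℂ} (hy : 0 < y.re) {c : ℝ} (hc : 1 < c)
    (hca : 1 + a.re < c) :
    HasSum (fun n : ℕ+ ↦ sigmaK K a n * exp (-(n * y)))
      ((2 * Real.pi : ℂ)⁻¹ * ∫ t : ℝ, lambertIntegrand K a y (c + t * I)) := by
  have hc0 : 0 < c := zero_lt_one.trans hc
  have hy0 : y ≠ 0 := by rintro rfl; simp at hy
  have hσ : LSeriesSummable (sigmaK K a) c := lseriesSummable_sigmaK hK (by simpa using hc)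
    (by simp; linarith)
  obtain ⟨C, hC, m, h⟩ := exists_norm_Gamma_mul_cpow_le hy hc0
  have hg : Integrable fun t : ℝ ↦ Gamma (c + t * I) * y ^ (-(c + t * I)) :=
    Integrable.mono' ((integrable_pow_mul_exp_neg_abs m (abs_arg_lt hy)).const_mul C)
      (continuous_Gamma_mul_cpow hy hc0).aestronglyMeasurable (Eventually.of_forall h)
  have h1 := hasSum_integral_dirichlet hg hσ (z := fun t : ℝ ↦ c + t * I) (by fun_prop)
    (fun t ↦ by simp)
  have h2 := h1.mul_left (2 * Real.pi : ℂ)⁻¹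
  refine h2.congr_eq (fun n ↦ ?_) ?_
  · have hn : (0 : ℝ) < n := Nat.cast_pos.mpr n.pos
    have hny : 0 < ((n : ℂ) * y).re := by
      rw [← ofReal_natCast, re_ofReal_mul]
      positivity
    have h3 : ∀ t : ℝ, sigmaK K a n / (n : ℂ) ^ (c + t * I : ℂ) *
        (Gamma (c + t * I) * y ^ (-(c + t * I : ℂ))) =
        sigmaK K a n * (Gamma (c + t * I) * ((n : ℂ) * y) ^ (-(c + t * I : ℂ))) := by
      intro t
      have h4 := ofReal_mul_cpow hn hy0 (-(c + t * I : ℂ))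
      rw [ofReal_natCast] at h4
      rw [h4, cpow_neg (n : ℂ)]
      ring
    simp_rw [h3]
    rw [integral_const_mul, integral_Gamma_mul_cpow hny hc0]
    have : (Real.pi : ℂ) ≠ 0 := ofReal_ne_zero.mpr Real.pi_ne_zero
    field_simp
  · congr 1
    refine integral_congr_ae (Eventually.of_forall fun t ↦ ?_)
    exact lambertIntegrand_right hK (by simpa using hc) (by simpa using hca)

/-- The Lambert series converges absolutely. -/
theorem summable_lambert (hK : finrank ℚ K = 2) {a y : ℂ} (hy : 0 < y.re) :
    Summable fun n : ℕ+ ↦ sigmaK K a n * exp (-(n * y)) :=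
  (hasSum_lambert hK hy (c := 2 + |a.re|) (by linarith [abs_nonneg a.re])
    (by linarith [le_abs_self a.re])).summable

end field

end QuadLambert

/-! ### Shifting the contour -/

namespace QuadLambert

open NumberField Module Complex Set MeasureTheory

/-- `Γ(s) ζ(s) = (2π)^s ζ(1-s) / (2 cos(πs/2))`. -/
theorem Gamma_mul_riemannZeta {s : ℂ} (hs : -1 < s.re) (hs0 : s.re < 0) :
    Gamma s * riemannZeta s =
      (2 * Real.pi : ℂ) ^ s * (2 * cos (Real.pi * s / 2))⁻¹ * riemannZeta (1 - s) := by
  have hπ : (Real.pi : ℂ) ≠ 0 := ofReal_ne_zero.mpr Real.pi_ne_zero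
  have h := riemannZeta_one_sub (s := 1 - s)
    (fun n hn ↦ by
      have := congrArg re hn
      simp at this
      linarith [(Nat.cast_nonneg n : (0 : ℝ) ≤ n)])
    (fun h ↦ by
      have := congrArg re h
      simp at this
      linarith)
  rw [sub_sub_cancel] at h
  have hcos : cos (Real.pi * (1 - s) / 2) = sin (Real.pi * s / 2) := by
    rw [← cos_pi_div_two_sub]
    congr 1
    ring
  have hsinne : sin (Real.pi * s / 2) ≠ 0 := by
    rw [Ne, sin_eq_zero_iff]
    rintro ⟨k, hk⟩
    have h2 : s = 2 * k := by
      apply mul_left_cancel₀ hπ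
      linear_combination 2 * hk
    have := congrArg re h2
    simp at this
    rw [this] at hs hs0
    have h3 : (-1 : ℝ) < (2 * k : ℤ) := by push_cast; exact hs
    have h4 : ((2 * k : ℤ) : ℝ) < 0 := by push_cast; exact hs0
    norm_cast at h3 h4
    omega
  have hcosne : cos (Real.pi * s / 2) ≠ 0 := by
    apply cos_pi_mul_half_ne_zero
    intro k hk
    have := congrArg re hk
    simp at this
    rw [this] at hs hs0
    have h3 : (-1 : ℝ) < (2 * k + 1 : ℤ) := by push_cast; exact hs
    have h4 : ((2 * k + 1 : ℤ) : ℝ) < 0 := by push_cast; exact hs0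
    norm_cast at h3 h4
    omega
  have hsin : sin (Real.pi * s) = 2 * sin (Real.pi * s / 2) * cos (Real.pi * s / 2) := by
    rw [← sin_two_mul]
    congr 1
    ring
  have hΓ := Gamma_mul_Gamma_one_sub s
  rw [hsin] at hΓ
  have hpow : (2 * Real.pi : ℂ) ^ (-(1 - s)) = (2 * Real.pi : ℂ) ^ s / (2 * Real.pi) := by
    rw [neg_sub, cpow_sub _ _ (by simp), cpow_one]
  rw [h, hcos, hpow]
  calc _ = (Gamma s * Gamma (1 - s)) * ((2 * Real.pi : ℂ) ^ s / Real.pi *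
        sin (Real.pi * s / 2) * riemannZeta (1 - s)) := by field_simp
    _ = _ := by
      rw [hΓ]
      field_simp

section field

variable {K : Type*} [Field K] [NumberField K]

theorem thetaScale_sq : (thetaScale K : ℂ) ^ 2 = (2 * Real.pi) ^ 2 / absDiscr K := by
  have h : thetaScale K ^ 2 = (2 * Real.pi) ^ 2 / (discr K).natAbs := by
    rw [thetaScale, div_pow, sqrtDiscr, Real.sq_sqrt (Nat.cast_nonneg _)]
  rw [← ofReal_pow, h, absDiscr]
  push_cast
  rfl

variable (K) in
theorem thetaScale_cpow (a : ℂ) : (thetaScale K : ℂ) ^ (-2 * a - 1) =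
    absDiscr K ^ (a + 1 / 2) * (2 * Real.pi : ℂ) ^ (-2 * a - 1) := by
  have hs := sqrtDiscr_pos K
  have h2 : (thetaScale K : ℂ) = ((2 * Real.pi : ℝ) : ℂ) * ((sqrtDiscr K : ℂ))⁻¹ := by
    rw [thetaScale, div_eq_mul_inv]
    push_cast
    rfl
  have hs0 : (sqrtDiscr K : ℂ) ≠ 0 := ofReal_ne_zero.mpr hs.ne'
  rw [h2, ofReal_mul_cpow (by positivity) (inv_ne_zero hs0), inv_cpow _ _
    (by rw [arg_ofReal_of_nonneg hs.le]; exact Real.pi_ne_zero.symm), ← cpow_neg, mul_comm]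
  congr 1
  · have h3 : (sqrtDiscr K : ℂ) ^ (-(-2 * a - 1)) = ((sqrtDiscr K : ℂ) ^ 2) ^ (a + 1 / 2) := by
      rw [show -(-2 * a - 1) = 2 * (a + 1 / 2) by ring, ← ofReal_pow, sq, ofReal_mul,
        mul_cpow_ofReal_nonneg hs.le hs.le, ← cpow_add _ _ hs0]
      congr 1
      ring
    rw [h3]
    congr 1
    rw [← ofReal_pow, sqrtDiscr, Real.sq_sqrt (Nat.cast_nonneg _), absDiscr]
    exact ofReal_natCast _
  · push_cast
    rfl

variable (K) in
-- `8π³ / (y D_K) = 2π · thetaScale² / y`: the powers left over from the two functional equations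
-- and from `y^{-s}` combine into one power of the kernel argument. The branches agree because `arg
-- y ≠ π`.
theorem kernelArg_one_cpow {y : ℂ} (hy : 0 < y.re) (s : ℂ) :
    kernelArg K y 1 ^ s = (2 * Real.pi : ℂ) ^ s * ((thetaScale K : ℂ) ^ (2 * s)) * y ^ (-s) := by
  have hy0 : y ≠ 0 := by rintro rfl; simp at hy
  have hθ := thetaScale_pos K
  have hθ0 : (thetaScale K : ℂ) ≠ 0 := ofReal_ne_zero.mpr hθ.ne'
  have hyarg : y.arg ≠ Real.pi := by
    intro h
    have := abs_arg_lt hy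
    rw [h, abs_of_pos Real.pi_pos] at this
    linarith [Real.pi_pos]
  have h1 : kernelArg K y 1 = ((2 * Real.pi * (thetaScale K * thetaScale K) : ℝ) : ℂ) * y⁻¹ := by
    push_cast
    rw [← sq, thetaScale_sq, kernelArg]
    have := absDiscr_ne_zero K
    field_simp
    push_cast
    ring
  rw [h1, ofReal_mul_cpow (by positivity) (inv_ne_zero hy0), inv_cpow _ _ hyarg, ← cpow_neg,
    ofReal_mul, mul_cpow_ofReal_nonneg (by positivity) (by positivity), ofReal_mul (thetaScale K),
    mul_cpow_ofReal_nonneg hθ.le hθ.le, ← cpow_add _ _ hθ0, two_mul s]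
  push_cast
  rfl

variable (K) in
theorem kernelArg_cpow {y : ℂ} (hy : 0 < y.re) {n : ℕ} (hn : 0 < n) (s : ℂ) :
    kernelArg K y n ^ s = (n : ℂ) ^ s * kernelArg K y 1 ^ s := by
  have h1 : kernelArg K y n = ((n : ℝ) : ℂ) * kernelArg K y 1 := by
    rw [kernelArg, kernelArg]
    push_cast
    ring
  have h0 : kernelArg K y 1 ≠ 0 := by
    intro h
    have := re_kernelArg_pos K hy one_pos
    rw [h] at this
    simp at this
  rw [h1, ofReal_mul_cpow (Nat.cast_pos.mpr hn) h0, ofReal_natCast]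

variable [IsTotallyComplex K]

/-- The integrand on the left of the poles. -/
theorem lambertIntegrand_left (hK : finrank ℚ K = 2) {a y s : ℂ} (hy : 0 < y.re)
    (hs : -1 < s.re) (hs0 : s.re < 0) (hsa : s.re < a.re) :
    lambertIntegrand K a y s = (thetaScale K : ℂ) ^ (-2 * a - 1) *
      (LSeries (sigmaK K (-a)) (1 - s) * barnesKernel a (kernelArg K y 1) s) := by
  have hθ0 : (thetaScale K : ℂ) ≠ 0 := ofReal_ne_zero.mpr (thetaScale_pos K).ne'
  rw [lseries_sigmaK hK (by simp; linarith) (by simp; linarith), lambertIntegrand,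
    Gamma_mul_riemannZeta hs hs0, zetaK_functional_equation hK (w := s - a) (by simp; linarith),
    barnesKernel, kernelArg_one_cpow K hy,
    show 2 * (s - a) - 1 = 2 * s + (-2 * a - 1) by ring, cpow_add _ _ hθ0,
    show 1 - (s - a) = 1 - s - -a by ring]
  ring

theorem lineBound_left (hK : finrank ℚ K = 2) {a y : ℂ} (hy : 0 < y.re) {c : ℝ} (hc : -1 < c)
    (hc0 : c < 0) (hca : c < a.re) : ∃ C : ℝ, 0 ≤ C ∧ ∃ m : ℕ, ∀ t : ℝ,
      ‖lambertIntegrand K a y (c + t * I)‖ ≤ C * ((1 + |t|) ^ m *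
        Real.exp (-((Real.pi / 2 - |(kernelArg K y 1).arg|) * |t|))) := by
  obtain ⟨C, hC, m, h⟩ := exists_norm_barnesKernel_le hc hc0 hca a.re |a.im|
  have hω := re_kernelArg_pos K hy one_pos
  have hω0 : kernelArg K y 1 ≠ 0 := by intro h; rw [h] at hω; simp at hω
  have hσ : LSeriesSummable (sigmaK K (-a)) ((1 - c : ℝ) : ℂ) :=
    lseriesSummable_sigmaK hK (by simp; linarith) (by simp; linarith)
  refine ⟨‖(thetaScale K : ℂ) ^ (-2 * a - 1)‖ *
    ((∑' n, ‖LSeries.term (sigmaK K (-a)) ((1 - c : ℝ) : ℂ) n‖) * (C * ‖kernelArg K y 1‖ ^ c)),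
    mul_nonneg (norm_nonneg _) (mul_nonneg (tsum_nonneg fun _ ↦ norm_nonneg _) (by positivity)),
    m, fun t ↦ ?_⟩
  rw [lambertIntegrand_left hK hy (by simpa using hc) (by simpa using hc0) (by simpa using hca),
    norm_mul, norm_mul, mul_assoc, mul_assoc]
  refine mul_le_mul_of_nonneg_left ?_ (norm_nonneg _)
  exact mul_le_mul (norm_lseries_le hσ (by simp)) (h a le_rfl le_rfl le_rfl _ hω0 t)
    (norm_nonneg _) (tsum_nonneg fun _ ↦ norm_nonneg _)

/-- Exponential decay absorbs the cubic that cancels the three poles, which gives the edge bounds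
for Phragmén–Lindelöf. -/
theorem norm_poly_mul_le {f : ℂ → ℂ} (a : ℂ) {σ C δ : ℝ} {m : ℕ} (hC : 0 ≤ C) (hδ : 0 < δ)
    (hf : ∀ t : ℝ, ‖f (σ + t * I)‖ ≤ C * ((1 + |t|) ^ m * Real.exp (-(δ * |t|)))) :
    ∃ B : ℝ, ∀ z : ℂ, z.re = σ → ‖z * (z - 1) * (z - (1 + a)) * f z‖ ≤ B := by
  obtain ⟨C', hC', h'⟩ := exists_pow_mul_exp_neg_le (m + 3) hδ
  set M : ℝ := |σ| + 2 + ‖a‖ with hM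
  have hM0 : 0 ≤ M := by positivity
  refine ⟨M ^ 3 * C * C', fun z hz ↦ ?_⟩
  have hzt : z = σ + z.im * I := by rw [← hz, re_add_im]
  have hn : ‖z‖ ≤ |σ| + |z.im| := by rw [← hz]; exact norm_le_abs_re_add_abs_im z
  have hi := abs_nonneg z.im
  have hσ := abs_nonneg σ
  have hna := norm_nonneg a
  have e1 : ‖z‖ ≤ M * (1 + |z.im|) := by nlinarith
  have e2 : ‖z - 1‖ ≤ M * (1 + |z.im|) := by
    have := norm_sub_le z 1
    rw [norm_one] at this
    nlinarith
  have e3 : ‖z - (1 + a)‖ ≤ M * (1 + |z.im|) := by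
    have h1 := norm_sub_le z (1 + a)
    have h2 := norm_add_le 1 a
    rw [norm_one] at h2
    nlinarith
  have e4 := hf z.im
  rw [← hzt] at e4
  have e5 := h' |z.im| hi
  rw [norm_mul, norm_mul, norm_mul]
  calc ‖z‖ * ‖z - 1‖ * ‖z - (1 + a)‖ * ‖f z‖ ≤
      (M * (1 + |z.im|)) * (M * (1 + |z.im|)) * (M * (1 + |z.im|)) *
        (C * ((1 + |z.im|) ^ m * Real.exp (-(δ * |z.im|)))) := by gcongr
    _ = M ^ 3 * C * ((1 + |z.im|) ^ (m + 3) * Real.exp (-(δ * |z.im|))) := by ring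
    _ ≤ M ^ 3 * C * C' := mul_le_mul_of_nonneg_left e5 (by positivity)

/-- The integrand decays in the strip. -/
theorem lambertIntegrand_decay (hK : finrank ℚ K = 2) {a y : ℂ} (hy : 0 < y.re)
    {c c' : ℝ} (hc : -1 < c) (hc0 : c < 0) (hca : c < a.re) (hc' : 1 < c') (hca' : 1 + a.re < c') :
    ∀ ε > 0, ∃ T : ℝ, ∀ z : ℂ, c ≤ z.re → z.re ≤ c' → T ≤ |z.im| →
      ‖lambertIntegrand K a y z‖ ≤ ε := by
  have hy0 : y ≠ 0 := by rintro rfl; simp at hy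
  -- The integrand times `s (s - 1) (s - 1 - a)`, written through the regularized functions so that
  -- it is holomorphic throughout the strip.
  let G : ℂ → ℂ := fun s ↦ Gamma (s + 1) * zetaReg s * zetaKReg hK (s + -a) * y ^ (-s)
  have hG : ∀ z : ℂ, z ≠ 0 → z ≠ 1 → z ≠ 1 + a →
      G z = z * (z - 1) * (z - (1 + a)) * lambertIntegrand K a y z := by
    intro z h0 h1 h2
    simp only [G]
    rw [Gamma_add_one z h0, zetaReg_eq h0 h1, ← sub_eq_add_neg,
      zetaKReg_eq hK (fun h ↦ h2 (by rw [← h]; ring)), lambertIntegrand]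
    ring
  have hd : ∀ z : ℂ, c ≤ z.re → z.re ≤ c' → DifferentiableAt ℂ G z := by
    intro z h1 _
    have hΓ : DifferentiableAt ℂ (fun s ↦ Gamma (s + 1)) z :=
      (differentiableAt_Gamma (z + 1) fun n hn ↦ by
        have := congrArg re hn
        simp at this
        linarith [(Nat.cast_nonneg n : (0 : ℝ) ≤ n)]).comp z (differentiableAt_id.add_const 1)
    have h3 : DifferentiableAt ℂ (fun s ↦ zetaKReg hK (s + -a)) z :=
      ((differentiable_zetaKReg hK).comp (differentiable_id.add_const (-a))) z
    have hp : DifferentiableAt ℂ (fun s : ℂ ↦ y ^ (-s)) z :=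
      differentiableAt_id.neg.const_cpow (Or.inl hy0)
    exact ((hΓ.mul (differentiable_zetaReg z)).mul h3).mul hp
  have hE : ExpBounded c c' G := by
    have h1 : ExpBounded c c' fun s ↦ Gamma (s + 1) :=
      ExpBounded.comp_add 1 (ExpBounded.Gamma (by simp; linarith))
    have h2 : ExpBounded c c' fun s ↦ zetaKReg hK (s + -a) :=
      ExpBounded.comp_add (-a) (expBounded_zetaKReg hK _ _)
    have h3 : ExpBounded c c' fun s ↦ y ^ (-s) := by
      have := ExpBounded.cpow (σ₁ := c) (σ₂ := c') (inv_ne_zero hy0)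
      refine (congrArg _ (funext fun s ↦ ?_)).mp this
      rw [inv_cpow _ _ (fun h ↦ by
        have := abs_arg_lt hy
        rw [h, abs_of_pos Real.pi_pos] at this
        linarith [Real.pi_pos]), cpow_neg]
    exact ((h1.mul (expBounded_zetaReg c c')).mul h2).mul h3
  obtain ⟨C₁, hC₁, m₁, hl⟩ := lineBound_left hK hy hc hc0 hca
  obtain ⟨C₂, hC₂, m₂, hr⟩ := lineBound_right hK hy hc' hca'
  obtain ⟨B₁, hB₁⟩ := norm_poly_mul_le a hC₁ (abs_arg_lt (re_kernelArg_pos K hy one_pos)) hl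
  obtain ⟨B₂, hB₂⟩ := norm_poly_mul_le a hC₂ (abs_arg_lt hy) hr
  set B := max (max B₁ B₂) 0 with hB
  have hB0 : 0 ≤ B := le_max_right _ _
  have hbound : ∀ z : ℂ, c ≤ z.re → z.re ≤ c' → ‖G z‖ ≤ B := by
    intro z h1 h2
    refine hE.norm_le_of_edges (by linarith) hd ?_ ?_ h1 h2
    · intro w hw
      rw [hG w (by rintro rfl; simp at hw; linarith) (by rintro rfl; simp at hw; linarith)
        (by rintro rfl; simp at hw; linarith)]
      exact (hB₁ w hw).trans ((le_max_left _ _).trans (le_max_left _ _))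
    · intro w hw
      rw [hG w (by rintro rfl; simp at hw; linarith) (by rintro rfl; simp at hw; linarith)
        (by rintro rfl; simp at hw; linarith)]
      exact (hB₂ w hw).trans ((le_max_right _ _).trans (le_max_left _ _))
  intro ε hε
  refine ⟨1 + |a.im| + B / ε, fun z h1 h2 hT ↦ ?_⟩
  have hBε : 0 ≤ B / ε := by positivity
  have hia := abs_nonneg a.im
  have hz1 : 1 ≤ |z.im| := by linarith
  have hza : 1 ≤ |z.im - a.im| := by
    have := abs_sub_abs_le_abs_sub z.im a.im
    linarith
  have hzim : z.im ≠ 0 := by rintro h; rw [h] at hz1; simp at hz1; linarith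
  have hzaim : z.im ≠ a.im := by intro h; rw [h, sub_self, abs_zero] at hza; linarith
  have hGz := hG z (by rintro rfl; simp at hzim) (by rintro rfl; simp at hzim)
    (by rintro rfl; simp at hzaim)
  have hb := hbound z h1 h2
  rw [hGz, norm_mul, norm_mul, norm_mul] at hb
  have n1 : |z.im| ≤ ‖z‖ := abs_im_le_norm z
  have n2 : 1 ≤ ‖z - 1‖ := hz1.trans (by simpa using abs_im_le_norm (z - 1))
  have n3 : 1 ≤ ‖z - (1 + a)‖ := hza.trans (by simpa using abs_im_le_norm (z - (1 + a)))
  -- One linear factor gives `|Im z|` and the other two are at least `1`, so boundedness of `G`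
  -- yields decay like `1 / |Im z|`.
  have n4 : |z.im| ≤ ‖z‖ * ‖z - 1‖ * ‖z - (1 + a)‖ := by
    calc |z.im| = |z.im| * 1 * 1 := by ring
      _ ≤ _ := by gcongr
  have n5 : |z.im| * ‖lambertIntegrand K a y z‖ ≤ B :=
    (mul_le_mul_of_nonneg_right n4 (norm_nonneg _)).trans hb
  have n6 : B / ε < |z.im| := by linarith
  rw [div_lt_iff₀ hε] at n6
  by_contra hcon
  push Not at hcon
  have : |z.im| * ε ≤ |z.im| * ‖lambertIntegrand K a y z‖ :=
    mul_le_mul_of_nonneg_left hcon.le (abs_nonneg _)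
  linarith

end field

end QuadLambert

/-! ### The transformation formula -/

namespace QuadLambert

open NumberField Module Complex Set MeasureTheory

section field

variable {K : Type*} [Field K] [NumberField K]

variable (K) in
/-- The `n`-th term of the transformed series as a contour integral on `Re s = c`. -/
noncomputable def barnesTerm (c : ℝ) (a y : ℂ) (n : ℕ) : ℂ :=
  sigmaK K (-a) n * ((thetaScale K : ℂ) ^ (-2 * a - 1) * (n : ℂ)⁻¹) *
    ((2 * Real.pi : ℂ)⁻¹ * ∫ t : ℝ, barnesKernel a (kernelArg K y n) (c + t * I))

theorem barnesTerm_eq {a y : ℂ} (hy : 0 < y.re) {c : ℝ} (hc : -1 < c) (hc0 : c < 0)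
    (hca : c < a.re) (ha : ∀ n : ℤ, a ≠ n) (hint₀ : ∀ n : ℤ, c - a.re ≠ n) {n : ℕ} (hn : 0 < n) :
    barnesTerm K c a y n = prefactor K a y * transTerm K a y n := by
  have hπ : (Real.pi : ℂ) ≠ 0 := ofReal_ne_zero.mpr Real.pi_ne_zero
  rw [prefactor_mul_transTerm K ha hy hn, barnesTerm,
    integral_barnesKernel (re_kernelArg_pos K hy hn) hc hc0 hca ha hint₀, thetaScale_cpow,
    ← mul_assoc (2 * Real.pi : ℂ)⁻¹, inv_mul_cancel₀ (by simp), one_mul]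

variable [IsTotallyComplex K]

/-- The pole is that of `Γ`, and `ζ(0) = -1/2`; `Re a > -1` keeps `-a` away from the pole of `ζ_K`.
-/
theorem tendsto_residue_zero (hK : finrank ℚ K = 2) {a y : ℂ} (ha : -1 < a.re) (hy : y ≠ 0) :
    Tendsto (fun z ↦ (z - 0) * lambertIntegrand K a y z) (𝓝[≠] 0) (𝓝 (-(1 / 2) * zetaK K (-a))) := by
  have h1 : Tendsto (fun z ↦ z * Gamma z) (𝓝[≠] 0) (𝓝 1) := tendsto_self_mul_Gamma_nhds_zero
  have h2 : Tendsto riemannZeta (𝓝[≠] 0) (𝓝 (-(1 / 2))) := by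
    have := (differentiableAt_riemannZeta zero_ne_one).continuousAt.tendsto
    rw [riemannZeta_zero, neg_div] at this
    exact this.mono_left nhdsWithin_le_nhds
  have h3 : Tendsto (fun z ↦ zetaK K (z - a)) (𝓝[≠] 0) (𝓝 (zetaK K (-a))) := by
    have h4 : ContinuousAt (zetaK K) (0 - a) := (differentiableAt_zetaK hK (by
      intro h
      have := congrArg re h
      simp at this
      linarith)).continuousAt
    have h5 : ContinuousAt (fun z ↦ zetaK K (z - a)) 0 :=
      ContinuousAt.comp (f := fun z : ℂ ↦ z - a) h4 (by fun_prop)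
    have := h5.tendsto
    rw [zero_sub] at this
    exact this.mono_left nhdsWithin_le_nhds
  have h4 : Tendsto (fun z : ℂ ↦ y ^ (-z)) (𝓝[≠] 0) (𝓝 1) := by
    have : Continuous fun z : ℂ ↦ y ^ (-z) := continuous_neg.const_cpow (Or.inl hy)
    exact (this.tendsto' 0 1 (by simp)).mono_left nhdsWithin_le_nhds
  have h := ((h1.mul h2).mul h3).mul h4
  rw [one_mul, mul_one] at h
  refine h.congr fun z ↦ ?_
  rw [lambertIntegrand, sub_zero]
  ring

/-- `a ≠ 0` separates the pole of `ζ` at `1` from that of `ζ_K(s - a)` at `1 + a`. -/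
theorem tendsto_residue_one (hK : finrank ℚ K = 2) {a y : ℂ} (ha : a ≠ 0) (hy : y ≠ 0) :
    Tendsto (fun z ↦ (z - 1) * lambertIntegrand K a y z) (𝓝[≠] 1) (𝓝 (zetaK K (1 - a) / y)) := by
  have h1 : Tendsto Gamma (𝓝[≠] 1) (𝓝 1) := by
    have := (differentiableAt_Gamma_one).continuousAt.tendsto
    rw [Gamma_one] at this
    exact this.mono_left nhdsWithin_le_nhds
  have h3 : Tendsto (fun z ↦ zetaK K (z - a)) (𝓝[≠] 1) (𝓝 (zetaK K (1 - a))) := by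
    have h4 : ContinuousAt (zetaK K) (1 - a) := (differentiableAt_zetaK hK (by
      simpa using ha)).continuousAt
    have h5 : ContinuousAt (fun z ↦ zetaK K (z - a)) 1 :=
      ContinuousAt.comp (f := fun z : ℂ ↦ z - a) h4 (by fun_prop)
    exact h5.tendsto.mono_left nhdsWithin_le_nhds
  have h4 : Tendsto (fun z : ℂ ↦ y ^ (-z)) (𝓝[≠] 1) (𝓝 y⁻¹) := by
    have : Continuous fun z : ℂ ↦ y ^ (-z) := continuous_neg.const_cpow (Or.inl hy)
    exact (this.tendsto' 1 y⁻¹ (by rw [cpow_neg_one])).mono_left nhdsWithin_le_nhds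
  have h := ((h1.mul riemannZeta_residue_one).mul h3).mul h4
  rw [one_mul, one_mul, ← div_eq_mul_inv] at h
  refine h.congr fun z ↦ ?_
  rw [lambertIntegrand]
  ring

theorem tendsto_residue_one_add (hK : finrank ℚ K = 2) {a y : ℂ} (ha : -1 < a.re) (ha0 : a ≠ 0)
    (hy : y ≠ 0) :
    Tendsto (fun z ↦ (z - (1 + a)) * lambertIntegrand K a y z) (𝓝[≠] (1 + a))
      (𝓝 (quadraticL (discr K) 1 * Gamma (a + 1) * riemannZeta (a + 1) / y ^ (a + 1))) := by
  rw [add_comm 1 a]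
  have h1 : Tendsto Gamma (𝓝[≠] (a + 1)) (𝓝 (Gamma (a + 1))) :=
    (differentiableAt_Gamma _ fun n hn ↦ by
      have := congrArg re hn
      simp at this
      linarith [(Nat.cast_nonneg n : (0 : ℝ) ≤ n)]).continuousAt.tendsto.mono_left
        nhdsWithin_le_nhds
  have h2 : Tendsto riemannZeta (𝓝[≠] (a + 1)) (𝓝 (riemannZeta (a + 1))) :=
    (differentiableAt_riemannZeta (by simpa using ha0)).continuousAt.tendsto.mono_left
      nhdsWithin_le_nhds
  have h3 : Tendsto (fun z ↦ (z - a - 1) * zetaK K (z - a)) (𝓝[≠] (a + 1))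
      (𝓝 (quadraticL (discr K) 1)) := by
    refine (zetaK_residue_one hK).comp (tendsto_nhdsWithin_iff.mpr ⟨?_, ?_⟩)
    · have : Continuous fun z : ℂ ↦ z - a := by fun_prop
      exact (this.tendsto' (a + 1) 1 (by ring)).mono_left nhdsWithin_le_nhds
    · filter_upwards [self_mem_nhdsWithin] with z hz h
      exact hz (by rw [← h]; simp)
  have h4 : Tendsto (fun z : ℂ ↦ y ^ (-z)) (𝓝[≠] (a + 1)) (𝓝 (y ^ (-(a + 1)))) := by
    have : Continuous fun z : ℂ ↦ y ^ (-z) := continuous_neg.const_cpow (Or.inl hy)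
    exact (this.tendsto _).mono_left nhdsWithin_le_nhds
  have h := ((h1.mul h2).mul h3).mul h4
  have e : Gamma (a + 1) * riemannZeta (a + 1) * quadraticL (discr K) 1 * y ^ (-(a + 1)) =
      quadraticL (discr K) 1 * Gamma (a + 1) * riemannZeta (a + 1) / y ^ (a + 1) := by
    rw [cpow_neg, div_eq_mul_inv]
    ring
  rw [e] at h
  refine h.congr fun z ↦ ?_
  rw [lambertIntegrand]
  ring

/-- The series side is the integral over a line to the left of the poles. -/
theorem lambertSide_eq_integral (hK : finrank ℚ K = 2) {a y : ℂ} (hy : 0 < y.re) (ha : -1 < a.re)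
    (ha0 : a ≠ 0) {c : ℝ} (hc : -1 < c) (hc0 : c < 0) (hca : c < a.re) :
    lambertSide K a y =
      (2 * Real.pi : ℂ)⁻¹ * ∫ t : ℝ, lambertIntegrand K a y (c + t * I) := by
  have hy0 : y ≠ 0 := by rintro rfl; simp at hy
  set c' : ℝ := 2 + |a.re| with hc'
  have h1 : 1 < c' := by linarith [abs_nonneg a.re]
  have h2 : 1 + a.re < c' := by linarith [le_abs_self a.re]
  have hπ : (Real.pi : ℂ) ≠ 0 := ofReal_ne_zero.mpr Real.pi_ne_zero
  have h01 : (0 : ℂ) ≠ 1 := zero_ne_one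
  have h0a : (0 : ℂ) ≠ 1 + a := by
    intro h
    have := congrArg re h
    simp at this
    linarith
  have h1a : (1 : ℂ) ≠ 1 + a := by simpa using ha0
  let r : ℂ → ℂ := fun p ↦ if p = 0 then -(1 / 2) * zetaK K (-a) else
    if p = 1 then zetaK K (1 - a) / y else
      quadraticL (discr K) 1 * Gamma (a + 1) * riemannZeta (a + 1) / y ^ (a + 1)
  have hl : Integrable fun t : ℝ ↦ lambertIntegrand K a y (c + t * I) := by
    obtain ⟨C, hC, m, h⟩ := lineBound_left hK hy hc hc0 hca
    exact Integrable.mono' ((integrable_pow_mul_exp_neg_abs m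
      (abs_arg_lt (re_kernelArg_pos K hy one_pos))).const_mul C)
      (continuous_lambertIntegrand_line hK hy0 hc hc0.ne (by linarith)
        (by linarith)).aestronglyMeasurable (Eventually.of_forall h)
  have hr : Integrable fun t : ℝ ↦ lambertIntegrand K a y (c' + t * I) := by
    obtain ⟨C, hC, m, h⟩ := lineBound_right hK hy h1 h2
    exact Integrable.mono' ((integrable_pow_mul_exp_neg_abs m (abs_arg_lt hy)).const_mul C)
      (continuous_lambertIntegrand_line hK hy0 (by linarith) (by linarith) (by linarith)
        (by linarith)).aestronglyMeasurable (Eventually.of_forall h)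
  have key := integral_vertical_sub_eq_sum_residues (σ₁ := c) (σ₂ := c') (by linarith)
    ({0, 1, 1 + a} : Finset ℂ) r (lambertIntegrand K a y)
    (by
      intro p hp
      simp only [Finset.mem_insert, Finset.mem_singleton] at hp
      rcases hp with rfl | rfl | rfl
      · exact ⟨by simpa using hc0, by simp; linarith⟩
      · exact ⟨by simp; linarith, by simpa using h1⟩
      · exact ⟨by simp; linarith, by simpa using h2⟩)
    (by
      intro z hz1 _ hzP
      simp only [Finset.mem_insert, Finset.mem_singleton, not_or] at hzP
      exact differentiableAt_lambertIntegrand hK hy0 (by linarith) hzP.1 hzP.2.1 hzP.2.2)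
    (by
      intro p hp
      simp only [Finset.mem_insert, Finset.mem_singleton] at hp
      rcases hp with rfl | rfl | rfl
      · simpa only [r, if_true] using tendsto_residue_zero hK ha hy0
      · simpa only [r, if_true, if_neg h01.symm] using tendsto_residue_one hK ha0 hy0
      · simpa only [r, if_neg h0a.symm, if_neg h1a.symm] using
          tendsto_residue_one_add hK ha ha0 hy0)
    (lambertIntegrand_decay hK hy hc hc0 hca h1 h2) hl hr
  have hsum := (hasSum_lambert hK hy h1 h2).tsum_eq
  have hres : ∑ p ∈ ({0, 1, 1 + a} : Finset ℂ), r p = -(1 / 2) * zetaK K (-a) +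
      (zetaK K (1 - a) / y +
      quadraticL (discr K) 1 * Gamma (a + 1) * riemannZeta (a + 1) / y ^ (a + 1)) := by
    rw [Finset.sum_insert (by simp [h0a]), Finset.sum_insert (by simpa using ha0),
      Finset.sum_singleton]
    simp only [r, if_true, if_neg h01.symm, if_neg h0a.symm, if_neg h1a.symm]
  rw [hres, sub_eq_iff_eq_add] at key
  rw [lambertSide, hsum, key]
  generalize ∫ t : ℝ, lambertIntegrand K a y (c + t * I) = J
  generalize quadraticL (discr K) 1 * Gamma (a + 1) * riemannZeta (a + 1) / y ^ (a + 1) = Q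
  generalize zetaK K (1 - a) / y = R
  field_simp
  ring

/-- On the left line the Dirichlet series in `1 - s` is integrated term by term, and `n^s` is
absorbed into the kernel argument, which is linear in `n`. The integrals carry no `sin(πa)`, so
positive integers `a` are included. -/
theorem hasSum_barnesTerm (hK : finrank ℚ K = 2) {a y : ℂ} (hy : 0 < y.re) (ha : -1 < a.re)
    (ha0 : a ≠ 0) {c : ℝ} (hc : -1 < c) (hc0 : c < 0) (hca : c < a.re) :
    HasSum (fun n : ℕ+ ↦ barnesTerm K c a y n) (lambertSide K a y) := by
  have hω := re_kernelArg_pos K hy one_pos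
  have hσ : LSeriesSummable (sigmaK K (-a)) ((1 - c : ℝ) : ℂ) :=
    lseriesSummable_sigmaK hK (by simp; linarith) (by simp; linarith)
  have h1 := hasSum_integral_dirichlet (integrable_barnesKernel_line hω hc hc0 hca) hσ
    (z := fun t : ℝ ↦ 1 - (c + t * I)) (by fun_prop) (fun t ↦ by simp)
  have h2 := h1.mul_left ((2 * Real.pi : ℂ)⁻¹ * (thetaScale K : ℂ) ^ (-2 * a - 1))
  refine h2.congr_eq (fun n ↦ ?_) ?_
  · have hn : (n : ℂ) ≠ 0 := Nat.cast_ne_zero.mpr n.ne_zero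
    have h3 : ∀ t : ℝ, sigmaK K (-a) n / (n : ℂ) ^ (1 - (c + t * I) : ℂ) *
        barnesKernel a (kernelArg K y 1) (c + t * I) =
        sigmaK K (-a) n * (n : ℂ)⁻¹ * barnesKernel a (kernelArg K y n) (c + t * I) := by
      intro t
      have hp : (n : ℂ) ^ (c + t * I : ℂ) ≠ 0 := by simp [cpow_eq_zero_iff]
      rw [barnesKernel, barnesKernel, kernelArg_cpow K hy n.pos, cpow_sub _ _ hn, cpow_one]
      field_simp
    simp_rw [h3]
    rw [integral_const_mul, barnesTerm]
    ring
  · rw [lambertSide_eq_integral hK hy ha ha0 hc hc0 hca, mul_assoc]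
    congr 1
    rw [← integral_const_mul]
    refine integral_congr_ae (Eventually.of_forall fun t ↦ ?_)
    exact lambertIntegrand_left hK hy (by simpa using hc) (by simpa using hc0) (by simpa using hca)

end field

end QuadLambert

/-! ### Integer values of the parameter -/

namespace QuadLambert

open NumberField Module Complex Set MeasureTheory

theorem continuousAt_barnesKernel {a ω s : ℂ} (h : s.re < a.re) :
    ContinuousAt (fun a ↦ barnesKernel a ω s) a := by
  have h1 : ContinuousAt Gamma (1 - (s - a)) := (differentiableAt_Gamma _ fun n hn ↦ by
    have := congrArg re hn
    simp at this
    linarith [(Nat.cast_nonneg n : (0 : ℝ) ≤ n)]).continuousAt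
  have h2 : ContinuousAt (fun a ↦ Gamma (1 - (s - a))) a :=
    ContinuousAt.comp (f := fun a : ℂ ↦ 1 - (s - a)) h1 (by fun_prop)
  have h3 : Continuous fun z : ℂ ↦ (Gamma z)⁻¹ := differentiable_one_div_Gamma.continuous
  have h4 : Continuous fun a : ℂ ↦ (Gamma (s - a))⁻¹ := h3.comp (by fun_prop)
  exact (continuousAt_const.mul (h2.mul h4.continuousAt)).mul continuousAt_const

section field

variable {K : Type*} [Field K] [NumberField K]

theorem continuous_sigmaK_neg {n : ℕ} : Continuous fun a : ℂ ↦ sigmaK K (-a) n := by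
  unfold sigmaK
  refine continuous_finsetSum _ fun d hd ↦ continuous_const.mul ?_
  have hd0 : (d : ℂ) ≠ 0 := Nat.cast_ne_zero.mpr (Nat.pos_of_mem_divisors hd).ne'
  exact continuous_neg.const_cpow (Or.inl hd0)

theorem norm_sigmaK_neg_le {a : ℂ} {r : ℝ} (ha : -r ≤ a.re) (n : ℕ) :
    ‖sigmaK K (-a) n‖ ≤ ‖sigmaK K r n‖ := by
  have h1 : sigmaK K r n = ((∑ d ∈ n.divisors, (idealCount K d : ℝ) * (d : ℝ) ^ r : ℝ) : ℂ) := by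
    rw [sigmaK]
    push_cast
    refine Finset.sum_congr rfl fun d _ ↦ ?_
    rw [ofReal_cpow (Nat.cast_nonneg d), ofReal_natCast]
  rw [h1, norm_real, Real.norm_of_nonneg (Finset.sum_nonneg fun d _ ↦ by positivity), sigmaK]
  refine norm_sum_le_of_le _ fun d hd ↦ ?_
  have hd0 := Nat.pos_of_mem_divisors hd
  rw [norm_mul, norm_natCast, norm_natCast_cpow_of_pos hd0, neg_re]
  refine mul_le_mul_of_nonneg_left ?_ (Nat.cast_nonneg _)
  exact Real.rpow_le_rpow_of_exponent_le (by exact_mod_cast hd0) (by linarith)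

theorem arg_kernelArg (y : ℂ) {n : ℕ} (hn : 0 < n) :
    (kernelArg K y n).arg = (kernelArg K y 1).arg := by
  have h1 : kernelArg K y n = ((n : ℝ) : ℂ) * kernelArg K y 1 := by
    rw [kernelArg, kernelArg]
    push_cast
    ring
  rw [h1, arg_real_mul _ (Nat.cast_pos.mpr hn)]

theorem norm_kernelArg (y : ℂ) (n : ℕ) :
    ‖kernelArg K y n‖ = n * ‖kernelArg K y 1‖ := by
  have h1 : kernelArg K y n = (n : ℂ) * kernelArg K y 1 := by
    rw [kernelArg, kernelArg]
    push_cast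
    ring
  rw [h1, norm_mul, norm_natCast]

theorem ne_zero_of_re_pos {z : ℂ} (hz : 0 < z.re) : z ≠ 0 := by
  rintro rfl
  simp at hz

/-- Near a natural number the terms are bounded by a convergent series. -/
theorem exists_norm_barnesTerm_le (hK : finrank ℚ K = 2) {y : ℂ} (hy : 0 < y.re) {c : ℝ}
    (hc : -1 < c) (hc4 : c < -(1 / 4)) (N : ℕ) :
    ∃ u : ℕ+ → ℝ, Summable u ∧ ∀ᶠ a : ℂ in 𝓝 (N : ℂ), ∀ n : ℕ+, ‖barnesTerm K c a y n‖ ≤ u n := by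
  -- `c < -1/4` together with `|a - N| < 1/4` keeps the line to the left of `Re a`, even for `N =
  -- 0`.
  obtain ⟨C, hC, m, hb⟩ := exists_norm_barnesKernel_le hc (by linarith) hc4 (N + 1) 1
  have hω := re_kernelArg_pos K hy one_pos
  have hθ0 : (thetaScale K : ℂ) ≠ 0 := ofReal_ne_zero.mpr (thetaScale_pos K).ne'
  have hcont : Continuous fun a : ℂ ↦ ‖(thetaScale K : ℂ) ^ (-2 * a - 1)‖ :=
    (Continuous.const_cpow (by fun_prop) (Or.inl hθ0)).norm
  set B : ℝ := ‖(thetaScale K : ℂ) ^ (-2 * (N : ℂ) - 1)‖ + 1 with hB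
  have hBev : ∀ᶠ a : ℂ in 𝓝 (N : ℂ), ‖(thetaScale K : ℂ) ^ (-2 * a - 1)‖ < B :=
    (hcont.tendsto (N : ℂ)).eventually (gt_mem_nhds (lt_add_one _))
  have hball : ∀ᶠ a : ℂ in 𝓝 (N : ℂ), ‖a - N‖ < 1 / 4 := by
    filter_upwards [Metric.ball_mem_nhds (N : ℂ) (show (0 : ℝ) < 1 / 4 by norm_num)] with a ha
    simpa [dist_eq_norm] using ha
  set δ : ℝ := Real.pi / 2 - |(kernelArg K y 1).arg| with hδ
  have hδ0 : 0 < δ := abs_arg_lt hω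
  set J : ℝ := ∫ t : ℝ, (1 + |t|) ^ m * Real.exp (-(δ * |t|)) with hJ
  set W : ℝ := ‖kernelArg K y 1‖ ^ c with hW
  -- `Re a ≥ -1/4` near `N`, so `σ_{K,1/4}` dominates `σ_{K,-a}`, and its series converges because
  -- `1 - c - 1/4 > 1`.
  have hσ : LSeriesSummable (sigmaK K ((1 / 4 : ℝ) : ℂ)) ((1 - c : ℝ) : ℂ) :=
    lseriesSummable_sigmaK hK (by simp; linarith)
      (by simp only [sub_re, ofReal_re]; linarith)
  refine ⟨fun n ↦ ‖LSeries.term (sigmaK K ((1 / 4 : ℝ) : ℂ)) ((1 - c : ℝ) : ℂ) n‖ *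
    (B * ((2 * Real.pi)⁻¹ * (C * W * J))), (hσ.norm.comp_injective PNat.coe_injective).mul_right _,
    ?_⟩
  filter_upwards [hBev, hball] with a haB hab n
  have hn : (0 : ℝ) < n := Nat.cast_pos.mpr n.pos
  have hre : |a.re - N| < 1 / 4 := by
    refine lt_of_le_of_lt ?_ hab
    simpa using abs_re_le_norm (a - N)
  have him : |a.im| < 1 / 4 := by
    refine lt_of_le_of_lt ?_ hab
    simpa using abs_im_le_norm (a - N)
  have hN : (0 : ℝ) ≤ N := Nat.cast_nonneg N
  obtain ⟨hre1, hre2⟩ := abs_lt.mp hre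
  have hker : ‖∫ t : ℝ, barnesKernel a (kernelArg K y n) (c + t * I)‖ ≤
      C * ((n : ℝ) ^ c * W) * J := by
    rw [hJ, ← integral_const_mul]
    refine norm_integral_le_of_norm_le ((integrable_pow_mul_exp_neg_abs m hδ0).const_mul _)
      (Eventually.of_forall fun t ↦ ?_)
    have := hb a (by linarith) (by linarith) (by linarith) (kernelArg K y n)
      (ne_zero_of_re_pos (re_kernelArg_pos K hy n.pos)) t
    rwa [arg_kernelArg y n.pos, norm_kernelArg, Real.mul_rpow hn.le (norm_nonneg _)] at this
  have hσ' := norm_sigmaK_neg_le (K := K) (a := a) (r := 1 / 4) (by linarith) n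
  rw [barnesTerm, norm_mul, norm_mul, norm_mul, norm_mul, norm_inv, norm_natCast,
    LSeries.norm_term_eq, if_neg n.ne_zero, ofReal_re, norm_inv,
    show ‖(2 * Real.pi : ℂ)‖ = 2 * Real.pi by
      rw [norm_mul, norm_real, Real.norm_of_nonneg Real.pi_pos.le]; simp]
  have hW0 : 0 ≤ W := by positivity
  have hB0 : 0 ≤ B := by positivity
  calc _ ≤ ‖sigmaK K ((1 / 4 : ℝ) : ℂ) n‖ * (B * (n : ℝ)⁻¹) *
        ((2 * Real.pi)⁻¹ * (C * ((n : ℝ) ^ c * W) * J)) := by gcongr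
    _ = _ := by
      rw [Real.rpow_sub hn, Real.rpow_one]
      field_simp

/-- The terms are continuous in the parameter. -/
theorem tendsto_barnesTerm {y : ℂ} (hy : 0 < y.re) {c : ℝ}
    (hc : -1 < c) (hc4 : c < -(1 / 4)) (N : ℕ) (n : ℕ+) :
    Tendsto (fun a ↦ barnesTerm K c a y n) (𝓝 (N : ℂ)) (𝓝 (barnesTerm K c N y n)) := by
  obtain ⟨C, hC, m, hb⟩ := exists_norm_barnesKernel_le hc (by linarith) hc4 (N + 1) 1
  have hω := re_kernelArg_pos K hy n.pos
  have hθ0 : (thetaScale K : ℂ) ≠ 0 := ofReal_ne_zero.mpr (thetaScale_pos K).ne'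
  have h1 : Continuous fun a : ℂ ↦ (thetaScale K : ℂ) ^ (-2 * a - 1) :=
    Continuous.const_cpow (by fun_prop) (Or.inl hθ0)
  have hball : ∀ᶠ a : ℂ in 𝓝 (N : ℂ), ‖a - N‖ < 1 / 4 := by
    filter_upwards [Metric.ball_mem_nhds (N : ℂ) (show (0 : ℝ) < 1 / 4 by norm_num)] with a ha
    simpa [dist_eq_norm] using ha
  have hN : (0 : ℝ) ≤ N := Nat.cast_nonneg N
  have hreim : ∀ a : ℂ, ‖a - N‖ < 1 / 4 → |a.re - N| < 1 / 4 ∧ |a.im| < 1 / 4 := by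
    intro a ha
    constructor
    · refine lt_of_le_of_lt ?_ ha
      simpa using abs_re_le_norm (a - N)
    · refine lt_of_le_of_lt ?_ ha
      simpa using abs_im_le_norm (a - N)
  have h2 : Tendsto (fun a ↦ ∫ t : ℝ, barnesKernel a (kernelArg K y n) (c + t * I)) (𝓝 (N : ℂ))
      (𝓝 (∫ t : ℝ, barnesKernel N (kernelArg K y n) (c + t * I))) := by
    refine tendsto_integral_filter_of_dominated_convergence (fun t ↦ C * ‖kernelArg K y n‖ ^ c *
      ((1 + |t|) ^ m * Real.exp (-((Real.pi / 2 - |(kernelArg K y n).arg|) * |t|)))) ?_ ?_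
      ((integrable_pow_mul_exp_neg_abs m (abs_arg_lt hω)).const_mul _) ?_
    · filter_upwards [hball] with a ha
      obtain ⟨h3, h4⟩ := hreim a ha
      have := abs_lt.mp h3
      exact (continuous_barnesKernel_line (ne_zero_of_re_pos hω) hc (by linarith)
        (by linarith [this.1])).aestronglyMeasurable
    · filter_upwards [hball] with a ha
      obtain ⟨h3, h4⟩ := hreim a ha
      have := abs_lt.mp h3
      exact Eventually.of_forall fun t ↦ hb a (by linarith [this.1]) (by linarith [this.2])
        (by linarith) _ (ne_zero_of_re_pos hω) t
    · refine Eventually.of_forall fun t ↦ ?_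
      exact (continuousAt_barnesKernel (by simp; linarith)).tendsto
  exact ((continuous_sigmaK_neg.tendsto (N : ℂ)).mul
    ((h1.tendsto (N : ℂ)).mul tendsto_const_nhds)).mul (tendsto_const_nhds.mul h2)

/-- Only countably many abscissas are forbidden. Avoiding them keeps every line `Re s = c + 2L` off
the poles `a + 1 + j`. -/
theorem exists_contour (r : ℝ) (hr : -1 < r) :
    ∃ c : ℝ, -1 < c ∧ c < 0 ∧ c < r ∧ ∀ n : ℤ, c - r ≠ n := by
  have hcount : (Set.range fun n : ℤ ↦ r + n).Countable := Set.countable_range _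
  obtain ⟨c, hc, hmem⟩ := (hcount.dense_compl ℝ).exists_mem_open isOpen_Ioo
    (Set.nonempty_Ioo.mpr (show -1 < min 0 r from lt_min (by norm_num) hr))
  refine ⟨c, hmem.1, hmem.2.trans_le (min_le_left _ _), hmem.2.trans_le (min_le_right _ _),
    fun n hn ↦ hc ⟨n, ?_⟩⟩
  simp only
  linarith

theorem sin_pi_mul_ne_zero {a : ℂ} (ha : ∀ n : ℤ, a ≠ n) : sin (Real.pi * a) ≠ 0 := by
  have hπ : (Real.pi : ℂ) ≠ 0 := ofReal_ne_zero.mpr Real.pi_ne_zero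
  rw [Ne, sin_eq_zero_iff]
  rintro ⟨k, hk⟩
  exact ha k (mul_left_cancel₀ hπ (by rw [hk, mul_comm]))

theorem prefactor_ne_zero {a y : ℂ} (ha : ∀ n : ℤ, a ≠ n) (hy : y ≠ 0) : prefactor K a y ≠ 0 := by
  have hπ : (Real.pi : ℂ) ≠ 0 := ofReal_ne_zero.mpr Real.pi_ne_zero
  have h1 : (Real.pi : ℂ) ^ (2 - 2 * a) ≠ 0 := by simp [cpow_eq_zero_iff]
  have h2 : absDiscr K ^ (a - 1 / 2) ≠ 0 := by
    simp [cpow_eq_zero_iff, absDiscr_ne_zero K]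
  exact div_ne_zero (mul_ne_zero (mul_ne_zero (by norm_num) h1) h2)
    (mul_ne_zero hy (sin_pi_mul_ne_zero ha))

variable [IsTotallyComplex K]

/-- The transformation formula at parameters which are not integers. -/
theorem transformation_formula (hK : finrank ℚ K = 2) {a y : ℂ} (hy : 0 < y.re) (ha : -1 < a.re)
    (hN : ∀ N : ℕ, a ≠ N) :
    (Summable fun n : ℕ+ ↦ transTerm K a y n) ∧
      lambertSide K a y = prefactor K a y * ∑' n : ℕ+, transTerm K a y n := by
  have haZ : ∀ n : ℤ, a ≠ n := by
    intro n hn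
    have hre := congrArg re hn
    rw [intCast_re] at hre
    rw [hre] at ha
    have h0 : 0 ≤ n := by
      have : (-1 : ℤ) < n := by exact_mod_cast ha
      omega
    obtain ⟨k, rfl⟩ := Int.eq_ofNat_of_zero_le h0
    exact hN k (by simpa using hn)
  obtain ⟨c, hc, hc0, hca, hint₀⟩ := exists_contour a.re ha
  have h := hasSum_barnesTerm hK hy ha (by simpa using hN 0) hc hc0 hca
  have h2 : HasSum (fun n : ℕ+ ↦ prefactor K a y * transTerm K a y n) (lambertSide K a y) :=
    h.congr_eq (fun n ↦ (barnesTerm_eq hy hc hc0 hca haZ hint₀ n.pos).symm) rfl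
  have hp := prefactor_ne_zero (K := K) haZ (ne_zero_of_re_pos hy)
  refine ⟨(summable_mul_left_iff hp).mp h2.summable, ?_⟩
  rw [← tsum_mul_left, h2.tsum_eq]

theorem eventually_not_int (N : ℕ) : ∀ᶠ a : ℂ in 𝓝[≠] (N : ℂ), |a.re - N| < 1 / 4 ∧
    ∀ n : ℤ, a ≠ n := by
  have hball : ∀ᶠ a : ℂ in 𝓝[≠] (N : ℂ), a ∈ Metric.ball (N : ℂ) (1 / 4) :=
    nhdsWithin_le_nhds (Metric.ball_mem_nhds _ (by norm_num))
  filter_upwards [hball, self_mem_nhdsWithin] with a ha hne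
  have hre : |a.re - N| < 1 / 4 := by
    have h1 : ‖a - N‖ < 1 / 4 := by simpa [dist_eq_norm] using ha
    refine lt_of_le_of_lt ?_ h1
    simpa using abs_re_le_norm (a - N)
  refine ⟨hre, ?_⟩
  rintro n rfl
  rw [intCast_re] at hre
  have h2 : |((n - N : ℤ) : ℝ)| < 1 := by push_cast; linarith
  rw [← Int.cast_abs] at h2
  have h3 : |n - (N : ℤ)| < 1 := by exact_mod_cast h2
  have h4 : n = N := by rw [Int.abs_lt_one_iff] at h3; omega
  exact hne (by rw [h4]; simp)

/-- The transformation formula at natural numbers, in the limit. -/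
theorem transformation_formula_nat (hK : finrank ℚ K = 2) {y : ℂ} (hy : 0 < y.re) (N : ℕ) :
    ∃ T : ℕ+ → ℂ,
      (∀ n : ℕ+, Tendsto (fun a : ℂ ↦ prefactor K a y * transTerm K a y n)
        (𝓝[≠] (N : ℂ)) (𝓝 (T n))) ∧
      Summable T ∧
      Tendsto (fun a : ℂ ↦ lambertSide K a y) (𝓝[≠] (N : ℂ)) (𝓝 (∑' n, T n)) ∧
      (N ≠ 0 → lambertSide K N y = ∑' n, T n) := by
  -- One line must serve all `a` near `N`. For `|Re a - N| < 1/4` the number `c - Re a + N` lies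
  -- between `-3/4` and `-1/4`, so `c - Re a` is never an integer.
  obtain ⟨c, hcdef⟩ : ∃ c : ℝ, c = -(1 / 2) := ⟨_, rfl⟩
  have hc : -1 < c := by norm_num [hcdef]
  have hc0 : c < 0 := by norm_num [hcdef]
  have hc4 : c < -(1 / 4) := by norm_num [hcdef]
  have hN : (0 : ℝ) ≤ N := Nat.cast_nonneg N
  obtain ⟨u, hu, hbound⟩ := exists_norm_barnesTerm_le hK hy hc hc4 N
  have hlim := fun n : ℕ+ ↦ (tendsto_barnesTerm (K := K) hy hc hc4 N n).mono_left
    (nhdsWithin_le_nhds (s := {(N : ℂ)}ᶜ))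
  refine ⟨fun n ↦ barnesTerm K c N y n, fun n ↦ ?_, ?_, ?_, fun hN0 ↦ ?_⟩
  · refine (hlim n).congr' ?_
    filter_upwards [eventually_not_int N] with a ha
    obtain ⟨h1, h1r⟩ := abs_lt.mp ha.1
    refine barnesTerm_eq hy hc hc0 (by linarith) ha.2 ?_ n.pos
    intro k hk
    have h2 : (-1 : ℝ) < (k + N : ℤ) := by push_cast; rw [← hk]; linarith
    have h3 : ((k + N : ℤ) : ℝ) < 0 := by push_cast; rw [← hk]; linarith
    norm_cast at h2 h3
    omega
  · exact Summable.of_norm_bounded hu hbound.self_of_nhds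
  -- Limit and sum are exchanged by domination; off the integers the sum is the left-hand side.
  · have h := tendsto_tsum_of_dominated_convergence hu hlim
      (nhdsWithin_le_nhds (s := {(N : ℂ)}ᶜ) hbound)
    refine h.congr' ?_
    filter_upwards [eventually_not_int N] with a ha
    obtain ⟨h1, h1r⟩ := abs_lt.mp ha.1
    exact (hasSum_barnesTerm hK hy (by linarith) (by simpa using ha.2 0) hc hc0
      (by linarith)).tsum_eq
  -- For `N ≠ 0` the contour formula holds at `a = N` itself. At `a = 0` the left side contains
  -- `ζ_K` and `ζ` at their pole `1`, so only the limit has meaning.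
  · exact (hasSum_barnesTerm hK hy (by simp; linarith) (Nat.cast_ne_zero.mpr hN0) hc hc0
      (by simp; linarith)).tsum_eq.symm

end field

end QuadLambert

theorem mainTheorem2 (K : Type*) [Field K] [NumberField K] [NumberField.IsTotallyComplex K]
    (hK : Module.finrank ℚ K = 2) :
    -- the continuations of `ζ_K(s)` and `L(s, χ_D)` exist
    QuadLambert.IsContinuation {1} (NumberField.dedekindZeta K) (QuadLambert.zetaK K) ∧
    QuadLambert.IsContinuation ∅
      (LSeries fun n ↦ (QuadLambert.kroneckerSym (NumberField.discr K) n : ℂ))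
      (QuadLambert.quadraticL (NumberField.discr K)) ∧
    ∀ y : ℂ, 0 < y.re →
      (∀ a : ℂ, -1 < a.re →
        Summable fun n : ℕ+ ↦ QuadLambert.sigmaK K a n * Complex.exp (-(n * y))) ∧
      -- the identity, where `sin (π a) ≠ 0`
      (∀ a : ℂ, -1 < a.re → (∀ N : ℕ, a ≠ N) →
        (Summable fun n : ℕ+ ↦ QuadLambert.transTerm K a y n) ∧
        QuadLambert.lambertSide K a y =
          QuadLambert.prefactor K a y * ∑' n : ℕ+, QuadLambert.transTerm K a y n) ∧
      -- at `a = 0, 1, 2, …` the terms on the right are read as their limits, and for `a = 0`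
      -- the left side too
      (∀ N : ℕ, ∃ T : ℕ+ → ℂ,
        (∀ n : ℕ+, Tendsto
          (fun a : ℂ ↦ QuadLambert.prefactor K a y * QuadLambert.transTerm K a y n)
          (𝓝[≠] (N : ℂ)) (𝓝 (T n))) ∧
        Summable T ∧
        Tendsto (fun a : ℂ ↦ QuadLambert.lambertSide K a y) (𝓝[≠] (N : ℂ)) (𝓝 (∑' n, T n)) ∧
        (N ≠ 0 → QuadLambert.lambertSide K N y = ∑' n, T n)) :=
  ⟨QuadLambert.isContinuation_zetaK hK, QuadLambert.isContinuation_quadraticL hK, fun _ hy ↦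
    ⟨fun _ _ ↦ QuadLambert.summable_lambert hK hy,
      fun _ ha hN ↦ QuadLambert.transformation_formula hK hy ha hN,
      fun N ↦ QuadLambert.transformation_formula_nat hK hy N⟩⟩
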